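/- We work over $\mathbb{C}$. Let $T\subset\mathbb{P}^3$ be a tetrahedron with vertices $v_0,\dots,v_3$, and let $f_i$ be the face opposite to $v_i$. Let $\mathcal{S}$ be the linear system of the sextic surfaces of $\mathbb{P}^3$ that are double along the six edges $l_{ij}=f_i\cap f_j$ of $T$. Then $\dim\mathcal{S}=13$. Let $\nu_{\mathcal{S}}:\mathbb{P}^3\dashrightarrow\mathbb{P}^{13}$ be the rational map defined by $\mathcal{S}$ (by any choice of a basis of the space of these sextic forms), and let $W_F^{13}\subset\mathbb{P}^{13}$ be its image, i.e. the Zariski closure of the set of its values. Let $Y'\to\mathbb{P}^3$ be the blow-up at the four vertices, with exceptional divisor $E_i$ over $v_i$; let $\gamma_{ij}\subset Y'$, for $i\neq j$, be the line cut out on $E_i$ by the strict transform of $f_j$. Let $Y''\to Y'$ be the blow-up along the strict transforms of the six edges, and let $Y\to Y''$ be the blow-up along the strict transforms $\widetilde\gamma_{ij}$ of the twelve lines $\gamma_{ij}$, with exceptional divisors $\Gamma_{ij}$ over $\widetilde\gamma_{ij}$. Let $\mathcal{E}_i$ and $\widetilde f_i$ be the strict transforms on $Y$ of $E_i$ and of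 $f_i$, and let $\nu_{\widetilde{\mathcal{S}}}$ be the extension of $\nu_{\mathcal{S}}$ to $Y$. Two distinct singular points of $W_F^{13}$ are called associated if the line joining them is contained in $W_F^{13}$. Theorem. Each singular point of $W_F^{13}$ is associated with at least three of the other singular points. Concretely, $\nu_{\widetilde{\mathcal{S}}}$ is defined at all points of the divisors $\mathcal{E}_i$, $\widetilde f_i$ and $\Gamma_{ij}$, it contracts $\mathcal{E}_i$ to a point $P_{i+1}$ and $\widetilde f_i$ to a point $P'_{i+1}$ $(0\le i\le 3)$, these eight points are distinct and are exactly the singular points of $W_F^{13}$, and for all $i\neq j$ in $\{0,1,2,3\}$ the image $\nu_{\widetilde{\mathcal{S}}}(\Gamma_{ij})$ is the line joining $P_{i+1}$ and $P'_{j+1}$, which is contained in $W_F^{13}$. -/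

import Mathlib

open scoped LinearAlgebra.Projectivization

noncomputable section

namespace EnriquesFano

/-! ### The tetrahedron and the linear system of sextics -/

/-- The homogeneous coordinate ring of complex projective 3-space. -/
abbrev Poly := MvPolynomial (Fin 4) ℂ

/-- A tetrahedron in complex projective 3-space: four linearly independent linear forms,
the equations of its faces `f₀, …, f₃`. -/
structure Tetrahedron where
  face : Fin 4 → Poly
  isHomogeneous : ∀ i, (face i).IsHomogeneous 1
  linearIndependent : LinearIndependent ℂ face

/-- The vector space of sextic forms that are double along the six edges `f_i ∩ f_j`: the form and
all its first partial derivatives vanish at every point of every edge. -/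
def sextics (T : Tetrahedron) : Submodule ℂ Poly where
  carrier := {F | F.IsHomogeneous 6 ∧ ∀ i j, i ≠ j → ∀ x : Fin 4 → ℂ,
    MvPolynomial.eval x (T.face i) = 0 → MvPolynomial.eval x (T.face j) = 0 →
      MvPolynomial.eval x F = 0 ∧ ∀ a, MvPolynomial.eval x (MvPolynomial.pderiv a F) = 0}
  add_mem' := by
    rintro F G ⟨hF, hF'⟩ ⟨hG, hG'⟩
    refine ⟨hF.add hG, fun i j hij x hi hj => ?_⟩
    obtain ⟨h1, h2⟩ := hF' i j hij x hi hj
    obtain ⟨h3, h4⟩ := hG' i j hij x hi hj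
    exact ⟨by simp [h1, h3], fun a => by simp [h2 a, h4 a]⟩
  zero_mem' := ⟨MvPolynomial.isHomogeneous_zero _ _ _, fun i j _ x _ _ => by simp⟩
  smul_mem' := by
    rintro c F ⟨hF, hF'⟩
    refine ⟨(MvPolynomial.homogeneousSubmodule (Fin 4) ℂ 6).smul_mem c hF,
      fun i j hij x hi hj => ?_⟩
    obtain ⟨h1, h2⟩ := hF' i j hij x hi hj
    exact ⟨by simp [h1], fun a => by simp [h2 a]⟩

/-- Complex projective space of dimension 13. -/
abbrev P13 := ℙ ℂ (Fin 14 → ℂ)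

/-- The smallest Zariski closed subset of `P13` containing `A`. -/
def zariskiClosure (A : Set P13) : Set P13 :=
  {p | ∀ (n : ℕ) (F : MvPolynomial (Fin 14) ℂ), F.IsHomogeneous n →
    (∀ q ∈ A, MvPolynomial.eval q.rep F = 0) → MvPolynomial.eval p.rep F = 0}

/-- The image, in the sense of rational maps, of projective 3-space under the map given by a basis
of the space of sextics: the Zariski closure of the set of values of the map outside the base
locus. -/
def threefold {T : Tetrahedron} (b : Module.Basis (Fin 14) ℂ (sextics T)) : Set P13 :=
  zariskiClosure {p | ∃ (x : Fin 4 → ℂ)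
    (h : (fun k => MvPolynomial.eval x (b k : Poly)) ≠ 0), p = Projectivization.mk ℂ _ h}

/-! ### Singular points, lines, associated points -/

/-- The affine cone over a subset of `P13`. -/
def affineCone (W : Set P13) : Set (Fin 14 → ℂ) :=
  {w | ∀ h : w ≠ 0, Projectivization.mk ℂ w h ∈ W}

/-- The Zariski tangent space to the affine cone over `W` at a vector `w`: the common kernel of the
differentials at `w` of all polynomials vanishing on the cone. -/
def coneTangentSpace (W : Set P13) (w : Fin 14 → ℂ) : Submodule ℂ (Fin 14 → ℂ) :=
  ⨅ F ∈ MvPolynomial.vanishingIdeal ℂ (affineCone W),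
    LinearMap.ker (∑ k, MvPolynomial.eval w (MvPolynomial.pderiv k F) •
      (LinearMap.proj k : (Fin 14 → ℂ) →ₗ[ℂ] ℂ))

/-- The singular points of an irreducible projective variety `W` (Jacobian criterion): the points
over which the tangent space of the affine cone has dimension larger than the dimension of the
cone. Both dimensions exceed those of the tangent space of `W` and of `W` by one. -/
def singularPoints (W : Set P13) : Set P13 :=
  {p | p ∈ W ∧
    ringKrullDim (MvPolynomial (Fin 14) ℂ ⧸ MvPolynomial.vanishingIdeal ℂ (affineCone W)) <
      ((Module.finrank ℂ (coneTangentSpace W p.rep) : ℕ) : WithBot ℕ∞)}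

/-- The line joining two (distinct) points. -/
def line (p q : P13) : Set P13 := {r | r.submodule ≤ p.submodule ⊔ q.submodule}

/-- Two distinct singular points of `W` are associated if the line joining them lies in `W`. -/
def AreAssociated (W : Set P13) (p q : P13) : Prop :=
  p ∈ singularPoints W ∧ q ∈ singularPoints W ∧ p ≠ q ∧ line p q ⊆ W

/-! ### Varieties as sets of local rings, and their blow-ups

An integral separated scheme with a fixed function field is treated, following Zariski, as the set
of its local rings, seen as subrings of a field: one local ring for every scheme-theoretic point.
The point `R` is a specialization of the point `η` if and only if `R ⊆ η`. A morphism that is the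
identity on function fields sends `R'` to the unique `R` that `R'` dominates, which is `R ≤ R'` in
Mathlib's order on local subrings. -/

/-- The field of fractions of the homogeneous coordinate ring of projective 3-space; it contains
the function field of projective 3-space as the subfield of elements of degree zero. -/
abbrev L := FractionRing Poly

/-- `x` belongs to the maximal ideal of `R`. -/
def InMax (R : LocalSubring L) (x : L) : Prop :=
  ∃ h : x ∈ R.toSubring, (⟨x, h⟩ : R.toSubring) ∈ IsLocalRing.maximalIdeal R.toSubring

/-- `x` is regular at the point `R` and takes the value `c` there. -/
def HasValue (R : LocalSubring L) (x : L) (c : ℂ) : Prop :=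
  x ∈ R.toSubring ∧ InMax R (x - algebraMap ℂ L c)

/-- The point is closed: its residue field is `ℂ`. -/
def IsClosedPt (R : LocalSubring L) : Prop := ∀ x ∈ R.toSubring, ∃ c, HasValue R x c

/-- The coordinate ring of the affine chart `m ≠ 0` of projective 3-space, for a linear
form `m`: it is generated over `ℂ` by the quotients `n / m` for all linear forms `n`. -/
def chart (m : Poly) : Subring L :=
  Subring.closure (Set.range (algebraMap ℂ L) ∪
    {x | ∃ n : Poly, n.IsHomogeneous 1 ∧ x = algebraMap Poly L n / algebraMap Poly L m})

/-- The local rings of projective 3-space: the localizations at primes of the affine charts. -/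
def P3 : Set (LocalSubring L) :=
  {R | ∃ m : Poly, m.IsHomogeneous 1 ∧ m ≠ 0 ∧
    ∃ (P : Ideal (chart m)) (_ : P.IsPrime), R = LocalSubring.ofPrime (chart m) P}

/-- The linear form `l` vanishes at the point `R` of projective 3-space. -/
def FormVanishes (l : Poly) (R : LocalSubring L) : Prop :=
  ∃ m : Poly, m.IsHomogeneous 1 ∧ m ≠ 0 ∧ InMax R (algebraMap Poly L l / algebraMap Poly L m)

/-- The stalk at `R` of the ideal sheaf of the closed subset `Z` with its reduced structure: the
functions that vanish at all points of `Z` specializing to `R` (the unit ideal if there are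
none). -/
def idealOf (Z : Set (LocalSubring L)) (R : LocalSubring L) : Ideal R.toSubring :=
  ⨅ η ∈ Z, ⨅ h : R.toSubring ≤ η.toSubring,
    (IsLocalRing.maximalIdeal η.toSubring).comap (Subring.inclusion h)

/-- The affine blow-up algebra `R[I/a]`. -/
def blowupAlgebra (R : LocalSubring L) (I : Ideal R.toSubring) (a : R.toSubring) : Subring L :=
  Subring.closure ((R.toSubring : Set L) ∪ {y | ∃ x ∈ I, y = (x : L) / (a : L)})

/-- The blow-up of `X` along the reduced closed subset `Z`. Over a point `R` of `X` with ideal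
`I` its points are those points of the spectra of the algebras `R[I/a]`, for nonzero `a` in `I`,
that lie over the closed point of the spectrum of `R`. -/
def blowup (X Z : Set (LocalSubring L)) : Set (LocalSubring L) :=
  {R' | ∃ R ∈ X, ∃ a ∈ idealOf Z R, a ≠ 0 ∧
    ∃ (P : Ideal (blowupAlgebra R (idealOf Z R) a)) (_ : P.IsPrime),
      R' = LocalSubring.ofPrime (blowupAlgebra R (idealOf Z R) a) P ∧ R ≤ R'}

/-- The inverse image in `X'` of a subset `A` of a variety that `X'` maps to. -/
def preimage (X' A : Set (LocalSubring L)) : Set (LocalSubring L) :=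
  {R' ∈ X' | ∃ R ∈ A, R ≤ R'}

/-- The strict transform of `A` in the blow-up `X'` of a variety along `Z`: the closure in `X'` of
`A` minus `Z`. (Outside the centre the blow-up does not change local rings.) -/
def strictTransform (X' Z A : Set (LocalSubring L)) : Set (LocalSubring L) :=
  {R' ∈ X' | ∃ η ∈ A, η ∉ Z ∧ R'.toSubring ≤ η.toSubring}

/-! ### The tower `Y → Y'' → Y' → ℙ³` -/

/-- The face `f_i`. -/
def faceSet (T : Tetrahedron) (i : Fin 4) : Set (LocalSubring L) :=
  {R ∈ P3 | FormVanishes (T.face i) R}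

/-- The edge `l_ij = f_i ∩ f_j`. -/
def edgeSet (T : Tetrahedron) (i j : Fin 4) : Set (LocalSubring L) := faceSet T i ∩ faceSet T j

/-- The vertex `v_i` (as a one-point set), where the three faces other than `f_i` meet. -/
def vertexSet (T : Tetrahedron) (i : Fin 4) : Set (LocalSubring L) :=
  {R ∈ P3 | ∀ j, j ≠ i → FormVanishes (T.face j) R}

/-- The four vertices. -/
def centre₁ (T : Tetrahedron) : Set (LocalSubring L) := ⋃ i, vertexSet T i

/-- `Y'`, the blow-up of projective 3-space at the four vertices. -/
def Y₁ (T : Tetrahedron) : Set (LocalSubring L) := blowup P3 (centre₁ T)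

/-- The exceptional divisor `E_i` of `Y'` over `v_i`. -/
def E₁ (T : Tetrahedron) (i : Fin 4) : Set (LocalSubring L) := preimage (Y₁ T) (vertexSet T i)

/-- The strict transform of the face `f_j` on `Y'`. -/
def f₁ (T : Tetrahedron) (j : Fin 4) : Set (LocalSubring L) :=
  strictTransform (Y₁ T) (centre₁ T) (faceSet T j)

/-- The strict transform of the edge `l_ij` on `Y'`. -/
def edge₁ (T : Tetrahedron) (i j : Fin 4) : Set (LocalSubring L) :=
  strictTransform (Y₁ T) (centre₁ T) (edgeSet T i j)

/-- The line `γ_ij`, the intersection of `E_i` with the strict transform of `f_j`. -/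
def gamma₁ (T : Tetrahedron) (i j : Fin 4) : Set (LocalSubring L) := E₁ T i ∩ f₁ T j

/-- The strict transforms on `Y'` of the six edges. -/
def centre₂ (T : Tetrahedron) : Set (LocalSubring L) := ⋃ i, ⋃ j, ⋃ _ : i ≠ j, edge₁ T i j

/-- `Y''`, the blow-up of `Y'` along the strict transforms of the six edges. -/
def Y₂ (T : Tetrahedron) : Set (LocalSubring L) := blowup (Y₁ T) (centre₂ T)

/-- The strict transform of `E_i` on `Y''`. -/
def E₂ (T : Tetrahedron) (i : Fin 4) : Set (LocalSubring L) :=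
  strictTransform (Y₂ T) (centre₂ T) (E₁ T i)

/-- The strict transform of the face `f_j` on `Y''`. -/
def f₂ (T : Tetrahedron) (j : Fin 4) : Set (LocalSubring L) :=
  strictTransform (Y₂ T) (centre₂ T) (f₁ T j)

/-- The strict transform of `γ_ij` on `Y''`. -/
def gamma₂ (T : Tetrahedron) (i j : Fin 4) : Set (LocalSubring L) :=
  strictTransform (Y₂ T) (centre₂ T) (gamma₁ T i j)

/-- The strict transforms on `Y''` of the twelve lines `γ_ij`. -/
def centre₃ (T : Tetrahedron) : Set (LocalSubring L) := ⋃ i, ⋃ j, ⋃ _ : i ≠ j, gamma₂ T i j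

/-- `Y`, the blow-up of `Y''` along the strict transforms of the twelve lines `γ_ij`. -/
def Y (T : Tetrahedron) : Set (LocalSubring L) := blowup (Y₂ T) (centre₃ T)

/-- The strict transform of `E_i` on `Y`. -/
def excE (T : Tetrahedron) (i : Fin 4) : Set (LocalSubring L) :=
  strictTransform (Y T) (centre₃ T) (E₂ T i)

/-- The strict transform of the face `f_j` on `Y`. -/
def strictFace (T : Tetrahedron) (j : Fin 4) : Set (LocalSubring L) :=
  strictTransform (Y T) (centre₃ T) (f₂ T j)

/-- The exceptional divisor `Γ_ij` of `Y` over the strict transform of `γ_ij` on `Y''`. -/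
def excGamma (T : Tetrahedron) (i j : Fin 4) : Set (LocalSubring L) :=
  preimage (Y T) (gamma₂ T i j)

/-! ### The map to `P13` -/

/-- The map to `P13` given by the sextics `b 0, …, b 13` is defined at the point `R` and sends it
to `p`: after multiplication by a common factor `g`, the sextics become regular functions at `R`
whose values there are not all zero and are homogeneous coordinates of `p`. -/
def MapsPoint {T : Tetrahedron} (b : Module.Basis (Fin 14) ℂ (sextics T))
    (R : LocalSubring L) (p : P13) : Prop :=
  ∃ (w : Fin 14 → ℂ) (hw : w ≠ 0) (g : L),
    (∀ k, HasValue R (algebraMap Poly L (b k : Poly) * g) (w k)) ∧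
    p = Projectivization.mk ℂ w hw

/-- The map to `P13` is defined at all closed points of `D`, and the image of `D` is `A`. -/
def MapsOnto {T : Tetrahedron} (b : Module.Basis (Fin 14) ℂ (sextics T))
    (D : Set (LocalSubring L)) (A : Set P13) : Prop :=
  (∀ R ∈ D, IsClosedPt R → ∃ p ∈ A, MapsPoint b R p) ∧
    ∀ p ∈ A, ∃ R ∈ D, IsClosedPt R ∧ MapsPoint b R p

end EnriquesFano

end

/-!
The sextics that are double along the edges of the tetrahedron are spanned by fourteen monomials in
the equations `s₀, …, s₃` of the faces: with `S = s₀ s₁ s₂ s₃`, the four `s_i² S`, the four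
`S² / s_j²` and the six `s_i s_j S` (`Tetrahedron.monBasis`). Everything happens in the coordinates
of the ambient space that correspond to this basis (`monCoord`). The eight points are the coordinate
points of the monomials `s_i² S` and `S² / s_j²`, the vertices of a cube.

*Singular points.* The monomials satisfy the binomial quadratic relations `m m' = n n'`, and so do
their differentials on tangent vectors of the cone. A nonzero solution either is one of the eight
coordinate vectors or has nonzero coordinates at `s_i² S` and `S² / s_j²` for some `i ≠ j`
(`Related.trichotomy`), and in the latter case the relations leave only four coordinates of a
tangent vector free (`TangentRelated.eq_zero`). At the eight points the tangent space is larger: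
the cone is parametrized by three copies of the plane (`segre`, `eval_segre`), which exhibits curves
whose velocities span five dimensions (`five_le_finrank_of_curves`). The same parametrization shows
that the lines joining the points `s_i² S` and `S² / s_j²`, `i ≠ j`, lie on the threefold
(`line_subset`). The cone is four-dimensional (`ringKrullDim_cone`), because the equations of the
faces are algebraic over the ring generated by the sextics.

*The blow-ups.* The field `L` carries explicit coordinate charts for the tower of blow-ups
(`chart₀`, `chart₁`, `chart₂`, `faceChart`, `excChart`), one for each permutation of the faces, in
which all the centres are coordinate subspaces. The blow-up of such a centre is covered by the
usual charts (`mem_blowup_iff_exists_chart`), which leads to `mem_Y` and to the local equations of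
the divisors (`mem_excE_iff`, `mem_strictFace_iff`, `mem_excGamma_iff`). In each chart of `Y` one of
the fourteen monomials divides all the others (`mon_eq_faceChart`, `mon_eq_excChart`), so the map is
defined there, and its values on the divisors can be read off.
-/

noncomputable section

namespace EnriquesFano

/-! ### Local subrings of the field `L` -/

/-- `x` is a unit of the local ring `R`. -/
def UnitAt (R : LocalSubring L) (x : L) : Prop :=
  x ≠ 0 ∧ x ∈ R.toSubring ∧ x⁻¹ ∈ R.toSubring

lemma isUnit_mk_iff {R : LocalSubring L} {x : L} (h : x ∈ R.toSubring) :
    IsUnit (⟨x, h⟩ : R.toSubring) ↔ UnitAt R x := by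
  constructor
  · intro hu
    obtain ⟨⟨y, hy⟩, hxy⟩ := isUnit_iff_exists_inv.mp hu
    have hxy' : x * y = 1 := congrArg Subtype.val hxy
    have hx : x ≠ 0 := left_ne_zero_of_mul_eq_one hxy'
    refine ⟨hx, h, ?_⟩
    rwa [inv_eq_of_mul_eq_one_right hxy']
  · rintro ⟨hx, _, hi⟩
    exact isUnit_iff_exists_inv.mpr ⟨⟨x⁻¹, hi⟩, Subtype.ext (mul_inv_cancel₀ hx)⟩

lemma inMax_iff {R : LocalSubring L} {x : L} :
    InMax R x ↔ x ∈ R.toSubring ∧ ¬ UnitAt R x := by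
  constructor
  · rintro ⟨h, hm⟩
    refine ⟨h, fun hu => ?_⟩
    exact (IsLocalRing.mem_maximalIdeal _).mp hm ((isUnit_mk_iff h).mpr hu)
  · rintro ⟨h, hu⟩
    exact ⟨h, (IsLocalRing.mem_maximalIdeal _).mpr fun h' => hu ((isUnit_mk_iff h).mp h')⟩

namespace InMax

variable {R R' : LocalSubring L} {x y : L}

lemma mem (h : InMax R x) : x ∈ R.toSubring := h.1

lemma not_unitAt (h : InMax R x) : ¬ UnitAt R x := (inMax_iff.mp h).2

lemma zero (R : LocalSubring L) : InMax R 0 := inMax_iff.mpr ⟨zero_mem _, fun h => h.1 rfl⟩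

lemma add (hx : InMax R x) (hy : InMax R y) : InMax R (x + y) := by
  obtain ⟨h, hm⟩ := hx
  obtain ⟨h', hm'⟩ := hy
  exact ⟨add_mem h h', Ideal.add_mem _ hm hm'⟩

lemma mul_left (hr : y ∈ R.toSubring) (hx : InMax R x) : InMax R (y * x) := by
  obtain ⟨h, hm⟩ := hx
  exact ⟨mul_mem hr h, Ideal.mul_mem_left _ ⟨y, hr⟩ hm⟩

lemma mul_right (hx : InMax R x) (hr : y ∈ R.toSubring) : InMax R (x * y) :=
  mul_comm y x ▸ hx.mul_left hr

lemma of_le (h : R.toSubring ≤ R'.toSubring) (hx : x ∈ R.toSubring) (hm : InMax R' x) :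
    InMax R x :=
  inMax_iff.mpr ⟨hx, fun hu => hm.not_unitAt ⟨hu.1, h hu.2.1, h hu.2.2⟩⟩

end InMax

namespace UnitAt

variable {R R' : LocalSubring L} {x y : L}

lemma mono (h : R.toSubring ≤ R'.toSubring) (hx : UnitAt R x) : UnitAt R' x :=
  ⟨hx.1, h hx.2.1, h hx.2.2⟩

lemma mul (hx : UnitAt R x) (hy : UnitAt R y) : UnitAt R (x * y) :=
  ⟨mul_ne_zero hx.1 hy.1, mul_mem hx.2.1 hy.2.1, by rw [mul_inv]; exact mul_mem hx.2.2 hy.2.2⟩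

lemma inv (hx : UnitAt R x) : UnitAt R x⁻¹ := ⟨inv_ne_zero hx.1, hx.2.2, by simpa using hx.2.1⟩

lemma of_mul_left (hx : x ∈ R.toSubring) (hy : y ∈ R.toSubring) (h : UnitAt R (x * y)) :
    UnitAt R x := by
  have hx0 := left_ne_zero_of_mul h.1
  have hy0 := right_ne_zero_of_mul h.1
  refine ⟨hx0, hx, ?_⟩
  have := mul_mem hy h.2.2
  rwa [mul_inv, mul_comm, mul_assoc, inv_mul_cancel₀ hy0, mul_one] at this

lemma one (R : LocalSubring L) : UnitAt R 1 := ⟨one_ne_zero, one_mem _, by simp [one_mem]⟩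

end UnitAt

variable {R R' η V : LocalSubring L} {A B : Subring L} {x y : L}

lemma inMax_or_unitAt (hx : x ∈ R.toSubring) : InMax R x ∨ UnitAt R x := by
  by_cases h : UnitAt R x
  · exact .inr h
  · exact .inl (inMax_iff.mpr ⟨hx, h⟩)

lemma InMax.or_of_mul (hx : x ∈ R.toSubring) (hy : y ∈ R.toSubring) (h : InMax R (x * y)) :
    InMax R x ∨ InMax R y := by
  rcases inMax_or_unitAt hx with h1 | h1
  · exact .inl h1
  rcases inMax_or_unitAt hy with h2 | h2
  · exact .inr h2
  exact absurd (h1.mul h2) h.not_unitAt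

lemma InMax.sum {ι : Type*} (s : Finset ι) (f : ι → L) (h : ∀ i ∈ s, InMax R (f i)) :
    InMax R (∑ i ∈ s, f i) := by
  classical
  induction s using Finset.induction_on with
  | empty => simpa using InMax.zero R
  | insert a s ha ih =>
    rw [Finset.sum_insert ha]
    exact (h a (by simp)).add (ih fun i hi => h i (by simp [hi]))

lemma exists_unitAt_of_sum {ι : Type*} (s : Finset ι) (f : ι → L)
    (hf : ∀ i ∈ s, f i ∈ R.toSubring) (h : UnitAt R (∑ i ∈ s, f i)) : ∃ i ∈ s, UnitAt R (f i) := by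
  by_contra hc
  push Not at hc
  exact (InMax.sum s f fun i hi => inMax_iff.mpr ⟨hf i hi, hc i hi⟩).not_unitAt h

lemma le_iff : R ≤ R' ↔ R.toSubring ≤ R'.toSubring ∧
    ∀ x ∈ R.toSubring, UnitAt R' x → UnitAt R x := by
  rw [LocalSubring.le_def]
  constructor
  · rintro ⟨h, hl⟩
    refine ⟨h, fun x hx hu => ?_⟩
    rw [← isUnit_mk_iff hx]
    apply hl.map_nonunit
    exact (isUnit_mk_iff (h hx)).mpr hu
  · rintro ⟨h, hl⟩
    refine ⟨h, ⟨?_⟩⟩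
    rintro ⟨x, hx⟩ hu
    exact (isUnit_mk_iff hx).mpr (hl x hx ((isUnit_mk_iff (h hx)).mp hu))

lemma InMax.of_dominated (h : R ≤ R') (hx : InMax R x) : InMax R' x := by
  rw [le_iff] at h
  exact inMax_iff.mpr ⟨h.1 hx.mem, fun hu => hx.not_unitAt (h.2 x hx.mem hu)⟩

/-! ### Localizations of subrings -/

/-- The local ring `R` is a localization of the subring `A` at a prime ideal, expressed through
fractions with denominators in `A` that are units of `R`; see `isLoc_iff`. -/
def IsLoc (A : Subring L) (R : LocalSubring L) : Prop :=
  A ≤ R.toSubring ∧ ∀ x ∈ R.toSubring, ∃ a ∈ A, ∃ b ∈ A, UnitAt R b ∧ x = a / b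

lemma mem_ofPrime (A : Subring L) (P : Ideal A) [P.IsPrime] {x : L} :
    x ∈ (LocalSubring.ofPrime A P).toSubring ↔ ∃ a b : A, b ∉ P ∧ x = a / b := by
  constructor
  · intro hx
    obtain ⟨⟨a, s⟩, h⟩ := IsLocalization.surj P.primeCompl
      (⟨x, hx⟩ : (LocalSubring.ofPrime A P).toSubring)
    have h' : x * (s : A) = a := congrArg Subtype.val h
    refine ⟨a, s, s.2, ?_⟩
    have hs : ((s : A) : L) ≠ 0 := by
      intro h0
      have : (s : A) = 0 := Subtype.ext h0
      exact s.2 (this ▸ P.zero_mem)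
    rw [eq_div_iff hs, h']
  · rintro ⟨a, b, hb, rfl⟩
    have hb0 : (b : L) ≠ 0 := by
      intro h0
      have : b = 0 := Subtype.ext h0
      exact hb (this ▸ P.zero_mem)
    have hu := IsLocalization.map_units (LocalSubring.ofPrime A P).toSubring
      (⟨b, hb⟩ : P.primeCompl)
    have hu' : UnitAt (LocalSubring.ofPrime A P) (b : L) :=
      (isUnit_mk_iff (LocalSubring.le_ofPrime A P b.2)).mp hu
    rw [div_eq_mul_inv]
    exact mul_mem (LocalSubring.le_ofPrime A P a.2) hu'.2.2

lemma isLoc_ofPrime (A : Subring L) (P : Ideal A) [P.IsPrime] :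
    IsLoc A (LocalSubring.ofPrime A P) := by
  refine ⟨LocalSubring.le_ofPrime A P, fun x hx => ?_⟩
  obtain ⟨a, b, hb, rfl⟩ := (mem_ofPrime A P).mp hx
  refine ⟨a, a.2, b, b.2, ⟨?_, LocalSubring.le_ofPrime A P b.2, ?_⟩, rfl⟩
  · intro h0
    have : b = 0 := Subtype.ext h0
    exact hb (this ▸ P.zero_mem)
  · exact (mem_ofPrime A P).mpr ⟨1, b, hb, by simp⟩

lemma unitAt_ofPrime (A : Subring L) (P : Ideal A) [P.IsPrime] {x : L} (hx : x ∈ A) :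
    UnitAt (LocalSubring.ofPrime A P) x ↔ (⟨x, hx⟩ : A) ∉ P := by
  constructor
  · rintro ⟨h0, _, hi⟩ hP
    obtain ⟨a, b, hb, hab⟩ := (mem_ofPrime A P).mp hi
    have hb0 : (b : L) ≠ 0 := by
      intro h0
      have : b = 0 := Subtype.ext h0
      exact hb (this ▸ P.zero_mem)
    have : b = a * ⟨x, hx⟩ := by
      apply Subtype.ext
      rw [eq_div_iff hb0] at hab
      simp only [Subring.coe_mul, ← hab]
      field_simp
    exact hb (this ▸ P.mul_mem_left _ hP)
  · intro hP
    refine ⟨?_, LocalSubring.le_ofPrime A P hx, (mem_ofPrime A P).mpr ⟨1, ⟨x, hx⟩, hP, by simp⟩⟩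
    rintro rfl
    exact hP P.zero_mem

/-- The prime ideal of the elements of `A` that vanish at `R`. -/
def centreIdeal (h : A ≤ R.toSubring) : Ideal A :=
  (IsLocalRing.maximalIdeal R.toSubring).comap (Subring.inclusion h)

instance (h : A ≤ R.toSubring) : (centreIdeal h).IsPrime := by
  unfold centreIdeal; infer_instance

lemma notMem_centreIdeal (h : A ≤ R.toSubring) {x : L} (hx : x ∈ A) :
    (⟨x, hx⟩ : A) ∉ centreIdeal h ↔ UnitAt R x := by
  rw [← isUnit_mk_iff (h hx), ← not_iff_not, not_not]
  exact (IsLocalRing.mem_maximalIdeal _)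

/-- The localization of `A` at the prime ideal of the elements vanishing at `R`. -/
lemma exists_isLoc_le (h : A ≤ R.toSubring) : ∃ R₀ : LocalSubring L, IsLoc A R₀ ∧ R₀ ≤ R := by
  refine ⟨LocalSubring.ofPrime A (centreIdeal h), isLoc_ofPrime _ _, ?_⟩
  have hle : (LocalSubring.ofPrime A (centreIdeal h)).toSubring ≤ R.toSubring := by
    intro x hx
    obtain ⟨a, b, hb, rfl⟩ := (mem_ofPrime A _).mp hx
    have := (notMem_centreIdeal h b.2).mp hb
    rw [div_eq_mul_inv]
    exact mul_mem (h a.2) this.2.2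
  refine le_iff.mpr ⟨hle, fun x hx hu => ?_⟩
  obtain ⟨a, b, hb, rfl⟩ := (mem_ofPrime A _).mp hx
  have hb' := (notMem_centreIdeal h b.2).mp hb
  have ha : UnitAt R (a : L) := by
    have := hu.mul hb'
    rwa [div_mul_cancel₀ _ hb'.1] at this
  have h1 : UnitAt (LocalSubring.ofPrime A (centreIdeal h)) (a : L) :=
    (unitAt_ofPrime A _ a.2).mpr ((notMem_centreIdeal h a.2).mpr ha)
  have h2 : UnitAt (LocalSubring.ofPrime A (centreIdeal h)) (b : L) :=
    (unitAt_ofPrime A _ b.2).mpr ((notMem_centreIdeal h b.2).mpr hb')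
  rw [div_eq_mul_inv]
  exact h1.mul h2.inv

lemma IsLoc.toSubring_le (h : IsLoc A R) (hA : A ≤ R'.toSubring)
    (hu : ∀ b ∈ A, UnitAt R b → UnitAt R' b) : R.toSubring ≤ R'.toSubring := by
  intro x hx
  obtain ⟨a, ha, b, hb, hub, rfl⟩ := h.2 x hx
  rw [div_eq_mul_inv]
  exact mul_mem (hA ha) (hu b hb hub).2.2

/-- Two localizations of the same ring that are dominated by the same local ring coincide. -/
lemma IsLoc.eq_of_le (h : IsLoc A R) (h' : IsLoc A R') (hV : R ≤ V) (hV' : R' ≤ V) : R = R' := by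
  apply LocalSubring.toSubring_injective
  rw [le_iff] at hV hV'
  apply le_antisymm
  · exact h.toSubring_le h'.1 fun b hb hu => hV'.2 b (h'.1 hb) (hu.mono hV.1)
  · exact h'.toSubring_le h.1 fun b hb hu => hV.2 b (h.1 hb) (hu.mono hV'.1)

lemma isLoc_iff (A : Subring L) (R : LocalSubring L) :
    IsLoc A R ↔ ∃ (P : Ideal A) (_ : P.IsPrime), R = LocalSubring.ofPrime A P := by
  constructor
  · intro h
    refine ⟨centreIdeal h.1, inferInstance, ?_⟩
    apply LocalSubring.toSubring_injective
    apply le_antisymm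
    · refine h.toSubring_le (LocalSubring.le_ofPrime A _) fun b hb hu => ?_
      exact (unitAt_ofPrime A _ hb).mpr ((notMem_centreIdeal h.1 hb).mpr hu)
    · refine (isLoc_ofPrime A _).toSubring_le h.1 fun b hb hu => ?_
      exact (notMem_centreIdeal h.1 hb).mp ((unitAt_ofPrime A _ hb).mp hu)
  · rintro ⟨P, _, rfl⟩
    exact isLoc_ofPrime A P

/-- To pass from one coordinate ring `A` of a local ring `R` to another one, `B`, it suffices that
every local ring dominated by `R` and containing `B` contains `A`. -/
lemma IsLoc.change (h : IsLoc A R) (hB : B ≤ R.toSubring)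
    (hAB : ∀ R₀ : LocalSubring L, R₀ ≤ R → B ≤ R₀.toSubring → A ≤ R₀.toSubring) : IsLoc B R := by
  obtain ⟨R₀, h₀, hle⟩ := exists_isLoc_le hB
  have hle' := le_iff.mp hle
  have hA := hAB R₀ hle h₀.1
  have : R₀ = R := LocalSubring.toSubring_injective <| le_antisymm hle'.1 <|
    h.toSubring_le hA fun b hb hu => hle'.2 b (hA hb) hu
  exact this ▸ h₀

/-! ### Coordinate charts and their points -/

/-- The subring `ℂ[x₀, x₁, x₂]` of `L`. -/
def chartRing (x : Fin 3 → L) : Subring L :=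
  Subring.closure (Set.range (algebraMap ℂ L) ∪ Set.range x)

section

variable {R R' η V : LocalSubring L} {A B : Subring L} {x y : Fin 3 → L}

lemma algebraMap_mem_chartRing (x : Fin 3 → L) (c : ℂ) : algebraMap ℂ L c ∈ chartRing x :=
  Subring.subset_closure (.inl ⟨c, rfl⟩)

lemma gen_mem_chartRing (x : Fin 3 → L) (i : Fin 3) : x i ∈ chartRing x :=
  Subring.subset_closure (.inr ⟨i, rfl⟩)

lemma chartRing_le : chartRing x ≤ A ↔ (∀ c, algebraMap ℂ L c ∈ A) ∧ ∀ i, x i ∈ A := by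
  rw [chartRing, Subring.closure_le, Set.union_subset_iff, Set.range_subset_iff,
    Set.range_subset_iff]
  rfl

lemma aeval_mem_of_le (h : chartRing x ≤ A) (p : MvPolynomial (Fin 3) ℂ) :
    MvPolynomial.aeval x p ∈ A := by
  rw [chartRing_le] at h
  induction p using MvPolynomial.induction_on with
  | C a => simpa using h.1 a
  | add p q hp hq => rw [map_add]; exact add_mem hp hq
  | mul_X p i hp => rw [map_mul, MvPolynomial.aeval_X]; exact mul_mem hp (h.2 i)

lemma mem_chartRing {a : L} : a ∈ chartRing x ↔
    ∃ p : MvPolynomial (Fin 3) ℂ, MvPolynomial.aeval x p = a := by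
  constructor
  · intro h
    have : chartRing x ≤ (MvPolynomial.aeval x : MvPolynomial (Fin 3) ℂ →ₐ[ℂ] L).range.toSubring :=
      chartRing_le.mpr ⟨fun c => ⟨MvPolynomial.C c, by simp⟩, fun i => ⟨MvPolynomial.X i, by simp⟩⟩
    exact this h
  · rintro ⟨p, rfl⟩
    exact aeval_mem_of_le le_rfl p

/-- Change of charts at a local ring: the new coordinates `y` have to be regular, and the old ones
have to be regular wherever the new ones are. -/
lemma IsLoc.changeChart (h : IsLoc (chartRing x) R) (hy : ∀ i, y i ∈ R.toSubring)
    (hxy : ∀ R₀ : LocalSubring L, R₀ ≤ R → chartRing y ≤ R₀.toSubring →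
      ∀ i, x i ∈ R₀.toSubring) : IsLoc (chartRing y) R :=
  h.change (chartRing_le.mpr ⟨(chartRing_le.mp h.1).1, hy⟩) fun R₀ h₀ hB =>
    chartRing_le.mpr ⟨(chartRing_le.mp hB).1, hxy R₀ h₀ hB⟩

/-- For independent coordinates `x` and a homomorphism `ψ` from the polynomial ring to a domain,
the localization of `ℂ[x₀, x₁, x₂]` at the kernel of `ψ`. -/
lemma exists_point (hx : AlgebraicIndependent ℂ x) {D : Type*} [CommRing D] [IsDomain D]
    [Algebra ℂ D] (ψ : MvPolynomial (Fin 3) ℂ →ₐ[ℂ] D) :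
    ∃ R : LocalSubring L, IsLoc (chartRing x) R ∧
      ∀ p, UnitAt R (MvPolynomial.aeval x p) ↔ ψ p ≠ 0 := by
  let g : MvPolynomial (Fin 3) ℂ →+* chartRing x :=
    (MvPolynomial.aeval x : MvPolynomial (Fin 3) ℂ →ₐ[ℂ] L).toRingHom.codRestrict (chartRing x)
      (aeval_mem_of_le le_rfl)
  have hg : Function.Surjective g := by
    rintro ⟨a, ha⟩
    obtain ⟨p, rfl⟩ := mem_chartRing.mp ha
    exact ⟨p, rfl⟩
  have hinj : Function.Injective g := by
    intro p q hpq
    exact hx (congrArg Subtype.val hpq)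
  have hker : RingHom.ker g ≤ RingHom.ker ψ.toRingHom := by
    rw [(RingHom.injective_iff_ker_eq_bot g).mp hinj]; exact bot_le
  have hprime : (Ideal.map g (RingHom.ker ψ.toRingHom)).IsPrime :=
    have := RingHom.ker_isPrime ψ.toRingHom
    Ideal.map_isPrime_of_surjective hg hker
  refine ⟨LocalSubring.ofPrime (chartRing x) (Ideal.map g (RingHom.ker ψ.toRingHom)),
    isLoc_ofPrime _ _, fun p => ?_⟩
  rw [unitAt_ofPrime _ _ (aeval_mem_of_le le_rfl p), not_iff_not,
    Ideal.mem_map_iff_of_surjective g hg]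
  constructor
  · rintro ⟨q, hq, hqp⟩
    have : q = p := hx (congrArg Subtype.val hqp)
    rw [← this]; exact hq
  · intro hp
    exact ⟨p, hp, rfl⟩

/-- Restriction of polynomials to the coordinate subspace where the variables in `S` vanish. -/
def restrict {ι : Type*} [DecidableEq ι] (S : Finset ι) :
    MvPolynomial ι ℂ →ₐ[ℂ] MvPolynomial ι ℂ :=
  MvPolynomial.aeval fun i => if i ∈ S then 0 else MvPolynomial.X i

/-- `η` is the local ring of the chart `x` at the generic point of the coordinate subspace
where the `x i`, `i ∈ S`, vanish. -/
def IsGenericPt (x : Fin 3 → L) (S : Finset (Fin 3)) (η : LocalSubring L) : Prop :=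
  IsLoc (chartRing x) η ∧ ∀ p, UnitAt η (MvPolynomial.aeval x p) ↔ restrict S p ≠ 0

/-- `R` is the local ring of the chart `x` at the point with coordinates `c`. -/
def IsPoint (x : Fin 3 → L) (c : Fin 3 → ℂ) (R : LocalSubring L) : Prop :=
  IsLoc (chartRing x) R ∧ ∀ p, UnitAt R (MvPolynomial.aeval x p) ↔ MvPolynomial.eval c p ≠ 0

lemma exists_isGenericPt (hx : AlgebraicIndependent ℂ x) (S : Finset (Fin 3)) :
    ∃ η, IsGenericPt x S η := exists_point hx (restrict S)

lemma exists_isPoint (hx : AlgebraicIndependent ℂ x) (c : Fin 3 → ℂ) : ∃ R, IsPoint x c R := by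
  obtain ⟨R, h, h'⟩ := exists_point hx (MvPolynomial.aeval c : _ →ₐ[ℂ] ℂ)
  exact ⟨R, h, fun p => by rw [h', MvPolynomial.aeval_eq_eval]⟩

lemma exists_eq_restrict_add {ι : Type*} [DecidableEq ι] (S : Finset ι) (p : MvPolynomial ι ℂ) :
    ∃ q : ι → MvPolynomial ι ℂ, p = restrict S p + ∑ i ∈ S, q i * MvPolynomial.X i := by
  induction p using MvPolynomial.induction_on with
  | C a => exact ⟨0, by simp [restrict]⟩
  | add p p' hp hp' =>
    obtain ⟨q, hq⟩ := hp
    obtain ⟨q', hq'⟩ := hp'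
    refine ⟨q + q', ?_⟩
    simp only [Pi.add_apply, add_mul, Finset.sum_add_distrib, map_add]
    conv_lhs => rw [hq, hq']
    ring
  | mul_X p j hp =>
    obtain ⟨q, hq⟩ := hp
    by_cases hj : j ∈ S
    · refine ⟨Pi.single j p, ?_⟩
      simp [restrict, hj, Pi.single_apply]
    · refine ⟨fun i => q i * MvPolynomial.X j, ?_⟩
      rw [map_mul, show restrict S (MvPolynomial.X j) = MvPolynomial.X j by simp [restrict, hj]]
      conv_lhs => rw [hq, add_mul, Finset.sum_mul]
      congr 1
      exact Finset.sum_congr rfl fun i _ => by ring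

lemma IsGenericPt.inMax {S : Finset (Fin 3)} (h : IsGenericPt x S η) {i : Fin 3} (hi : i ∈ S) :
    InMax η (x i) := by
  refine inMax_iff.mpr ⟨h.1.1 (gen_mem_chartRing x i), fun hu => ?_⟩
  have := (h.2 (MvPolynomial.X i)).mp (by simpa using hu)
  simp [restrict, hi] at this

lemma IsGenericPt.unitAt {S : Finset (Fin 3)} (h : IsGenericPt x S η) {i : Fin 3} (hi : i ∉ S) :
    UnitAt η (x i) := by
  have := (h.2 (MvPolynomial.X i)).mpr (by simp [restrict, hi])
  simpa using this

lemma aeval_eq_sum_of_restrict_eq_zero {S : Finset (Fin 3)} {p : MvPolynomial (Fin 3) ℂ}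
    (h : restrict S p = 0) : ∃ q : Fin 3 → MvPolynomial (Fin 3) ℂ,
      MvPolynomial.aeval x p = ∑ i ∈ S, MvPolynomial.aeval x (q i) * x i := by
  obtain ⟨q, hq⟩ := exists_eq_restrict_add S p
  refine ⟨q, ?_⟩
  conv_lhs => rw [hq, h, zero_add]
  simp

/-- A point of the chart at which the coordinates in `S` vanish is a specialization of the generic
point of the corresponding coordinate subspace. -/
lemma IsGenericPt.toSubring_le {S : Finset (Fin 3)} (h : IsGenericPt x S η)
    (hR : IsLoc (chartRing x) R) (hm : ∀ i ∈ S, InMax R (x i)) : R.toSubring ≤ η.toSubring := by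
  refine hR.toSubring_le h.1.1 fun b hb hu => ?_
  obtain ⟨p, rfl⟩ := mem_chartRing.mp hb
  rw [h.2]
  intro h0
  obtain ⟨q, hq⟩ := aeval_eq_sum_of_restrict_eq_zero (x := x) h0
  refine InMax.not_unitAt ?_ hu
  rw [hq]
  exact InMax.sum _ _ fun i hi => (hm i hi).mul_left (aeval_mem_of_le hR.1 _)

lemma IsPoint.isClosedPt {c : Fin 3 → ℂ} (h : IsPoint x c R) : IsClosedPt R := by
  intro z hz
  obtain ⟨a, ha, b, hb, hu, rfl⟩ := h.1.2 z hz
  obtain ⟨p, rfl⟩ := mem_chartRing.mp ha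
  obtain ⟨q, rfl⟩ := mem_chartRing.mp hb
  have hq := (h.2 q).mp hu
  refine ⟨MvPolynomial.eval c p / MvPolynomial.eval c q, hz, ?_⟩
  set k := MvPolynomial.eval c p / MvPolynomial.eval c q with hk
  have hm : InMax R (MvPolynomial.aeval x (p - MvPolynomial.C k * q)) := by
    refine inMax_iff.mpr ⟨aeval_mem_of_le h.1.1 _, ?_⟩
    rw [h.2, not_not]
    simp [hk, hq]
  have := hm.mul_right hu.2.2
  have e : MvPolynomial.aeval x (p - MvPolynomial.C k * q) * (MvPolynomial.aeval x q)⁻¹ =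
      MvPolynomial.aeval x p / MvPolynomial.aeval x q - algebraMap ℂ L k := by
    rw [map_sub, map_mul, MvPolynomial.aeval_C, sub_mul, mul_assoc, mul_inv_cancel₀ hu.1, mul_one,
      div_eq_mul_inv]
  rwa [e] at this

lemma IsPoint.hasValue {c : Fin 3 → ℂ} (h : IsPoint x c R) (i : Fin 3) :
    HasValue R (x i) (c i) := by
  refine ⟨h.1.1 (gen_mem_chartRing x i), ?_⟩
  have : InMax R (MvPolynomial.aeval x (MvPolynomial.X i - MvPolynomial.C (c i))) := by
    refine inMax_iff.mpr ⟨aeval_mem_of_le h.1.1 _, ?_⟩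
    rw [h.2, not_not]
    simp
  simpa using this

/-! ### Blow-ups along coordinate subspaces -/

lemma mem_idealOf {Z : Set (LocalSubring L)} {z : R.toSubring} :
    z ∈ idealOf Z R ↔ ∀ η ∈ Z, R.toSubring ≤ η.toSubring → InMax η (z : L) := by
  simp only [idealOf, Ideal.mem_iInf, Ideal.mem_comap]
  refine forall₂_congr fun η _ => forall_congr' fun h => ?_
  exact ⟨fun hz => ⟨h z.2, hz⟩, fun hz => hz.2⟩

/-- In every local ring of the chart `x` the ideal of `Z` is generated by the coordinates
in `S`. -/
def IsIdealOf (x : Fin 3 → L) (S : Finset (Fin 3)) (Z : Set (LocalSubring L)) : Prop :=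
  ∀ R, IsLoc (chartRing x) R → ∀ z : R.toSubring, z ∈ idealOf Z R ↔
    ∃ r : Fin 3 → L, (∀ i, r i ∈ R.toSubring) ∧ (z : L) = ∑ i ∈ S, r i * x i

/-- The ideal of `Z` is that of a coordinate subspace of the chart if `Z` contains the generic point
of the subspace and if the coordinates in question vanish at all points of `Z` in the chart. -/
lemma isIdealOf (hx : AlgebraicIndependent ℂ x) {S : Finset (Fin 3)} {Z : Set (LocalSubring L)}
    (h1 : ∀ η ∈ Z, chartRing x ≤ η.toSubring → ∀ i ∈ S, InMax η (x i))
    (h2 : ∀ η, IsGenericPt x S η → η ∈ Z) : IsIdealOf x S Z := by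
  intro R hR z
  rw [mem_idealOf]
  constructor
  · intro hz
    by_cases hc : ∃ j ∈ S, UnitAt R (x j)
    · obtain ⟨j, hj, hu⟩ := hc
      refine ⟨Pi.single j (z * (x j)⁻¹), fun i => ?_, ?_⟩
      · rcases eq_or_ne i j with rfl | hij
        · simpa using mul_mem z.2 hu.2.2
        · simp [hij, zero_mem]
      · simp [Pi.single_apply, hj, hu.1]
    · push Not at hc
      have hm : ∀ i ∈ S, InMax R (x i) := fun i hi =>
        inMax_iff.mpr ⟨hR.1 (gen_mem_chartRing x i), hc i hi⟩
      obtain ⟨η, hη⟩ := exists_isGenericPt hx S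
      have hle := hη.toSubring_le hR hm
      have hzm := hz η (h2 η hη) hle
      obtain ⟨a, ha, b, hb, hu, hab⟩ := hR.2 z z.2
      have ham : InMax η a := by
        have := hzm.mul_right (hle hu.2.1)
        rwa [hab, div_mul_cancel₀ _ hu.1] at this
      obtain ⟨p, rfl⟩ := mem_chartRing.mp ha
      have hp : restrict S p = 0 := by
        by_contra h0
        exact ham.not_unitAt ((hη.2 p).mpr h0)
      obtain ⟨q, hq⟩ := aeval_eq_sum_of_restrict_eq_zero (x := x) hp
      refine ⟨fun i => MvPolynomial.aeval x (q i) * b⁻¹,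
        fun i => mul_mem (aeval_mem_of_le hR.1 _) hu.2.2, ?_⟩
      rw [hab, hq, Finset.sum_div]
      exact Finset.sum_congr rfl fun i _ => by ring
  · rintro ⟨r, hr, hz⟩ η hη hle
    rw [hz]
    exact InMax.sum _ _ fun i hi => (h1 η hη (hR.1.trans hle) i hi).mul_left (hle (hr i))

/-- The coordinates on the chart with exceptional divisor `x t = 0` of the blow-up of the
coordinate subspace where the `x i`, `i ∈ S`, vanish. -/
def blowChart (x : Fin 3 → L) (S : Finset (Fin 3)) (t : Fin 3) : Fin 3 → L :=
  fun i => if i ∈ S ∧ i ≠ t then x i / x t else x i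

lemma div_mem_of_blowChart {S : Finset (Fin 3)} {t : Fin 3} (ht0 : x t ≠ 0)
    (h : chartRing (blowChart x S t) ≤ A) {i : Fin 3} (hi : i ∈ S) : x i / x t ∈ A := by
  by_cases hit : i = t
  · subst hit; rw [div_self ht0]; exact one_mem _
  · have := h (gen_mem_chartRing _ i)
    simpa [blowChart, hi, hit] using this

lemma le_of_blowChart {S : Finset (Fin 3)} {t : Fin 3} (ht0 : x t ≠ 0)
    (h : chartRing (blowChart x S t) ≤ A) : chartRing x ≤ A := by
  refine chartRing_le.mpr ⟨(chartRing_le.mp h).1, fun i => ?_⟩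
  by_cases hi : i ∈ S ∧ i ≠ t
  · have h1 := div_mem_of_blowChart ht0 h hi.1
    have h2 := h (gen_mem_chartRing _ t)
    simp only [blowChart, ne_eq, not_true_eq_false, and_false, if_false] at h2
    have := mul_mem h1 h2
    rwa [div_mul_cancel₀ _ ht0] at this
  · have h2 := h (gen_mem_chartRing _ i)
    rwa [blowChart, if_neg hi] at h2

lemma blowChart_le {S : Finset (Fin 3)} {t : Fin 3}
    (h : chartRing x ≤ A) (h' : ∀ i ∈ S, x i / x t ∈ A) : chartRing (blowChart x S t) ≤ A := by
  refine chartRing_le.mpr ⟨(chartRing_le.mp h).1, fun i => ?_⟩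
  rw [blowChart]
  split_ifs with hi
  · exact h' i hi.1
  · exact h (gen_mem_chartRing x i)

lemma le_blowupAlgebra (R : LocalSubring L) (I : Ideal R.toSubring) (a : R.toSubring) :
    R.toSubring ≤ blowupAlgebra R I a :=
  fun _ hx => Subring.subset_closure (.inl hx)

lemma div_mem_blowupAlgebra (R : LocalSubring L) (I : Ideal R.toSubring) (a : R.toSubring)
    {z : R.toSubring} (hz : z ∈ I) : (z : L) / a ∈ blowupAlgebra R I a :=
  Subring.subset_closure (.inr ⟨z, hz, rfl⟩)

lemma blowupAlgebra_le {I : Ideal R.toSubring} {a : R.toSubring} (h : R.toSubring ≤ A)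
    (h' : ∀ z ∈ I, (z : L) / a ∈ A) : blowupAlgebra R I a ≤ A := by
  rw [blowupAlgebra, Subring.closure_le, Set.union_subset_iff]
  refine ⟨h, ?_⟩
  rintro _ ⟨z, hz, rfl⟩
  exact h' z hz

lemma mem_blowup {X Z : Set (LocalSubring L)} : R' ∈ blowup X Z ↔
    ∃ R ∈ X, ∃ a ∈ idealOf Z R, a ≠ 0 ∧ IsLoc (blowupAlgebra R (idealOf Z R) a) R' ∧ R ≤ R' := by
  simp only [blowup, Set.mem_ofPred_eq, isLoc_iff]
  refine exists_congr fun R => and_congr_right fun _ => exists_congr fun a =>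
    and_congr_right fun _ => and_congr_right fun _ => ?_
  constructor
  · rintro ⟨P, hP, h, h'⟩; exact ⟨⟨P, hP, h⟩, h'⟩
  · rintro ⟨⟨P, hP, h⟩, h'⟩; exact ⟨P, hP, h, h'⟩

lemma IsIdealOf.gen_mem {S : Finset (Fin 3)} {Z : Set (LocalSubring L)} (h : IsIdealOf x S Z)
    (hR : IsLoc (chartRing x) R) {i : Fin 3} (hi : i ∈ S) :
    (⟨x i, hR.1 (gen_mem_chartRing x i)⟩ : R.toSubring) ∈ idealOf Z R := by
  refine (h R hR _).mpr ⟨Pi.single i 1, fun j => ?_, ?_⟩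
  · rcases eq_or_ne j i with rfl | hij
    · simp [one_mem]
    · simp [hij, zero_mem]
  · simp [Pi.single_apply, hi]

/-- The blow-up of `X` along `Z` is covered by the charts `blowChart x S t`, `t ∈ S`, if `X` is
covered by charts `x` in which `Z` is the coordinate subspace where the `x i`, `i ∈ S`, vanish. -/
lemma mem_blowup_iff_exists_chart {ι : Type*} {X Z : Set (LocalSubring L)} {x : ι → Fin 3 → L}
    (hx0 : ∀ σ i, x σ i ≠ 0) (S : Finset (Fin 3))
    (hX : ∀ R, R ∈ X ↔ ∃ σ, IsLoc (chartRing (x σ)) R)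
    (hZ : ∀ σ, IsIdealOf (x σ) S Z) :
    R' ∈ blowup X Z ↔ ∃ σ, ∃ t ∈ S, IsLoc (chartRing (blowChart (x σ) S t)) R' := by
  rw [mem_blowup]
  constructor
  · rintro ⟨R, hR, a, ha, ha0, hR', hle⟩
    obtain ⟨σ, hσ⟩ := (hX R).mp hR
    have ha0' : (a : L) ≠ 0 := fun h => ha0 (Subtype.ext h)
    obtain ⟨r, hr, har⟩ := (hZ σ R hσ a).mp ha
    have hle' := le_iff.mp hle
    have hdiv : ∀ i ∈ S, x σ i / a ∈ R'.toSubring := fun i hi =>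
      hR'.1 (div_mem_blowupAlgebra _ _ _ ((hZ σ).gen_mem hσ hi))
    obtain ⟨t, ht, hut⟩ := exists_unitAt_of_sum (R := R') S (fun i => (x σ i / a) * r i)
      (fun i hi => mul_mem (hdiv i hi) (hle'.1 (hr i))) (by
        have : ∑ i ∈ S, x σ i / a * r i = 1 := by
          rw [← div_self ha0']
          conv_rhs => rw [har, Finset.sum_div]
          rw [← har]
          exact Finset.sum_congr rfl fun i _ => by ring
        rw [this]; exact UnitAt.one R')
    have hut' : UnitAt R' (x σ t / a) := hut.of_mul_left (hdiv t ht) (hle'.1 (hr t))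
    have hdiv' : ∀ i ∈ S, x σ i / x σ t ∈ R'.toSubring := fun i hi => by
      have := mul_mem (hdiv i hi) hut'.2.2
      rwa [inv_div, div_mul_div_cancel₀ ha0'] at this
    refine ⟨σ, t, ht, hR'.change (blowChart_le (hσ.1.trans hle'.1) hdiv') fun R₀ h₀ hB => ?_⟩
    have h₀' := le_iff.mp h₀
    have hle₀ : R.toSubring ≤ R₀.toSubring :=
      hσ.toSubring_le (le_of_blowChart (hx0 σ t) hB) fun b hb hu =>
        h₀'.2 b (le_of_blowChart (hx0 σ t) hB hb) (hu.mono hle'.1)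
    have key : ∀ z ∈ idealOf Z R, (z : L) / x σ t ∈ R₀.toSubring := fun z hz => by
      obtain ⟨r', hr', hz'⟩ := (hZ σ R hσ z).mp hz
      rw [hz', Finset.sum_div]
      refine sum_mem fun i hi => ?_
      rw [mul_div_assoc]
      exact mul_mem (hle₀ (hr' i)) (div_mem_of_blowChart (hx0 σ t) hB hi)
    refine blowupAlgebra_le hle₀ fun z hz => ?_
    have hu₀ : UnitAt R₀ (a / x σ t) :=
      h₀'.2 _ (key a ha) (by simpa using hut'.inv)
    have := mul_mem (key z hz) hu₀.2.2
    rwa [inv_div, div_mul_div_cancel₀ (hx0 σ t)] at this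
  · rintro ⟨σ, t, ht, hR'⟩
    have hle := le_of_blowChart (hx0 σ t) hR'.1
    obtain ⟨R, hR, hRR'⟩ := exists_isLoc_le hle
    have hRR := le_iff.mp hRR'
    refine ⟨R, (hX R).mpr ⟨σ, hR⟩, ⟨x σ t, hR.1 (gen_mem_chartRing _ t)⟩, (hZ σ).gen_mem hR ht,
      fun h => hx0 σ t (congrArg Subtype.val h), hR'.change ?_ ?_, hRR'⟩
    · refine blowupAlgebra_le hRR.1 fun z hz => ?_
      obtain ⟨r', hr', hz'⟩ := (hZ σ R hR z).mp hz
      rw [hz', Finset.sum_div]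
      refine sum_mem fun i hi => ?_
      rw [mul_div_assoc]
      exact mul_mem (hRR.1 (hr' i)) (div_mem_of_blowChart (hx0 σ t) hR'.1 hi)
    · intro R₀ _ hB
      exact blowChart_le (hR.1.trans ((le_blowupAlgebra _ _ _).trans hB)) fun i hi =>
        hB (div_mem_blowupAlgebra _ _ _ ((hZ σ).gen_mem hR hi))

/-! ### Separatedness -/

/-- The valuative criterion of separatedness: every local ring dominates at most one point. -/
def Separated (X : Set (LocalSubring L)) : Prop :=
  ∀ R ∈ X, ∀ R' ∈ X, ∀ V, R ≤ V → R' ≤ V → R = R'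

lemma Separated.blowup {X : Set (LocalSubring L)} (hX : Separated X) (Z : Set (LocalSubring L)) :
    Separated (blowup X Z) := by
  intro R₁ h₁ R₂ h₂ V hV₁ hV₂
  obtain ⟨R, hR, a, ha, ha0, hRa, hR₁⟩ := mem_blowup.mp h₁
  obtain ⟨R', hR', b, hb, hb0, hRb, hR₂⟩ := mem_blowup.mp h₂
  obtain rfl := hX R hR R' hR' V (hR₁.trans hV₁) (hR₂.trans hV₂)
  have ha0' : (a : L) ≠ 0 := fun h => ha0 (Subtype.ext h)
  have hb0' : (b : L) ≠ 0 := fun h => hb0 (Subtype.ext h)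
  have h1 : (b : L) / a ∈ R₁.toSubring := hRa.1 (div_mem_blowupAlgebra _ _ _ hb)
  have h2 : (a : L) / b ∈ R₂.toSubring := hRb.1 (div_mem_blowupAlgebra _ _ _ ha)
  have hu : UnitAt R₁ ((b : L) / a) := (le_iff.mp hV₁).2 _ h1
    ⟨div_ne_zero hb0' ha0', (le_iff.mp hV₁).1 h1, by rw [inv_div]; exact (le_iff.mp hV₂).1 h2⟩
  refine IsLoc.eq_of_le (hRa.change ?_ ?_) hRb hV₁ hV₂
  · refine blowupAlgebra_le (le_iff.mp hR₁).1 fun z hz => ?_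
    have := mul_mem (hRa.1 (div_mem_blowupAlgebra _ _ _ hz)) hu.2.2
    rwa [inv_div, div_mul_div_cancel₀ ha0'] at this
  · intro R₀ h₀ hB
    refine blowupAlgebra_le ((le_blowupAlgebra _ _ _).trans hB) fun z hz => ?_
    have hu₀ : UnitAt R₀ ((a : L) / b) := (le_iff.mp h₀).2 _
      (hB (div_mem_blowupAlgebra _ _ _ ha)) (by simpa using hu.inv)
    have := mul_mem (hB (div_mem_blowupAlgebra _ _ _ hz)) hu₀.2.2
    rwa [inv_div, div_mul_div_cancel₀ hb0'] at this

/-- A point of a separated variety that lies in an affine chart is a localization of its coordinate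
ring. -/
lemma Separated.isLoc {X : Set (LocalSubring L)} (hX : Separated X)
    (hA : ∀ R, IsLoc A R → R ∈ X) (hη : η ∈ X) (h : A ≤ η.toSubring) : IsLoc A η := by
  obtain ⟨R, hR, hle⟩ := exists_isLoc_le h
  rwa [← hX R (hA R hR) η hη η hle le_rfl]

end

/-! ### The faces as homogeneous coordinates -/

lemma eq_sum_of_isHomogeneous_one {f : Poly} (h : f.IsHomogeneous 1) :
    f = ∑ a, MvPolynomial.C (f.coeff (Finsupp.single a 1)) * MvPolynomial.X a := by
  ext d
  simp only [MvPolynomial.coeff_sum, MvPolynomial.coeff_C_mul, MvPolynomial.coeff_X]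
  by_cases hd : d.degree = 1
  · obtain ⟨a, rfl⟩ : ∃ a, d = Finsupp.single a 1 := by
      simpa [Finsupp.degree_apply] using d.sum_eq_one_iff.mp hd
    rw [Finset.sum_eq_single a]
    · simp
    · intro b _ hb
      rw [if_neg, mul_zero]
      intro h'
      exact hb (Finsupp.single_left_injective one_ne_zero h')
    · simp
  · rw [h.coeff_eq_zero hd, Finset.sum_eq_zero]
    intro a _
    rw [if_neg, mul_zero]
    rintro rfl
    exact hd (by simp)

namespace Tetrahedron

variable (T : Tetrahedron)

/-- The coefficients of the equations of the faces. -/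
def matrix : Matrix (Fin 4) (Fin 4) ℂ := fun i a => (T.face i).coeff (Finsupp.single a 1)

lemma face_eq (i : Fin 4) : T.face i = ∑ a, MvPolynomial.C (T.matrix i a) * MvPolynomial.X a :=
  eq_sum_of_isHomogeneous_one (T.isHomogeneous i)

lemma isUnit_matrix : IsUnit T.matrix := by
  rw [← Matrix.linearIndependent_rows_iff_isUnit]
  rw [Fintype.linearIndependent_iff]
  intro g hg
  refine Fintype.linearIndependent_iff.mp T.linearIndependent g ?_
  have : ∀ a, ∑ i, g i * T.matrix i a = 0 := fun a => by
    simpa using congrFun hg a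
  calc ∑ i, g i • T.face i = ∑ a, MvPolynomial.C (∑ i, g i * T.matrix i a) * MvPolynomial.X a := by
        simp only [map_sum, Finset.sum_mul]
        rw [Finset.sum_comm]
        refine Finset.sum_congr rfl fun i _ => ?_
        rw [T.face_eq i, Finset.smul_sum]
        refine Finset.sum_congr rfl fun a _ => ?_
        rw [MvPolynomial.smul_eq_C_mul, map_mul, mul_assoc]
    _ = 0 := by simp [this]

/-- The linear forms that express the coordinates through the faces. -/
def dualForm (i : Fin 4) : Poly := ∑ a, MvPolynomial.C (T.matrix⁻¹ i a) * MvPolynomial.X a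

lemma dualForm_isHomogeneous (i : Fin 4) : (T.dualForm i).IsHomogeneous 1 := by
  refine MvPolynomial.IsHomogeneous.sum _ _ _ fun a _ => ?_
  simpa using (MvPolynomial.isHomogeneous_C _ _).mul (MvPolynomial.isHomogeneous_X ℂ a)

lemma aeval_dualForm (i : Fin 4) :
    MvPolynomial.aeval T.face (T.dualForm i) = MvPolynomial.X i := by
  have h : T.matrix⁻¹ * T.matrix = 1 :=
    Matrix.nonsing_inv_mul _ ((Matrix.isUnit_iff_isUnit_det _).mp T.isUnit_matrix)
  simp only [dualForm, map_sum, map_mul, MvPolynomial.aeval_X, MvPolynomial.algHom_C]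
  simp only [T.face_eq, Finset.mul_sum]
  rw [Finset.sum_comm]
  calc _ = ∑ b, MvPolynomial.C ((T.matrix⁻¹ * T.matrix) i b) * MvPolynomial.X b := by
        refine Finset.sum_congr rfl fun b _ => ?_
        rw [Matrix.mul_apply, map_sum, Finset.sum_mul]
        refine Finset.sum_congr rfl fun a _ => ?_
        rw [map_mul, ← mul_assoc]; rfl
    _ = _ := by
        rw [h]
        simp [Matrix.one_apply, apply_ite MvPolynomial.C]

lemma aeval_face (i : Fin 4) :
    MvPolynomial.aeval T.dualForm (T.face i) = MvPolynomial.X i := by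
  have h : T.matrix * T.matrix⁻¹ = 1 :=
    Matrix.mul_nonsing_inv _ ((Matrix.isUnit_iff_isUnit_det _).mp T.isUnit_matrix)
  rw [T.face_eq]
  simp only [map_sum, map_mul, MvPolynomial.aeval_X, MvPolynomial.algHom_C]
  simp only [dualForm, Finset.mul_sum]
  rw [Finset.sum_comm]
  calc _ = ∑ b, MvPolynomial.C ((T.matrix * T.matrix⁻¹) i b) * MvPolynomial.X b := by
        refine Finset.sum_congr rfl fun b _ => ?_
        rw [Matrix.mul_apply, map_sum, Finset.sum_mul]
        refine Finset.sum_congr rfl fun a _ => ?_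
        rw [map_mul, ← mul_assoc]; rfl
    _ = _ := by
        rw [h]
        simp [Matrix.one_apply, apply_ite MvPolynomial.C]

/-- The change of homogeneous coordinates to the equations of the faces. -/
def coordEquiv : Poly ≃ₐ[ℂ] Poly :=
  AlgEquiv.ofAlgHom (MvPolynomial.aeval T.face) (MvPolynomial.aeval T.dualForm)
    (MvPolynomial.algHom_ext fun i => by
      rw [AlgHom.comp_apply, MvPolynomial.aeval_X]; exact T.aeval_dualForm i)
    (MvPolynomial.algHom_ext fun i => by
      rw [AlgHom.comp_apply, MvPolynomial.aeval_X]; exact T.aeval_face i)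

@[simp] lemma coordEquiv_apply (p : Poly) : T.coordEquiv p = MvPolynomial.aeval T.face p := rfl

lemma exists_eq_sum_face {f : Poly} (h : f.IsHomogeneous 1) :
    ∃ c : Fin 4 → ℂ, f = ∑ i, MvPolynomial.C (c i) * T.face i := by
  have h1 : (MvPolynomial.aeval T.dualForm f).IsHomogeneous 1 := by
    simpa using h.aeval (T.dualForm) (n := 1) fun i => T.dualForm_isHomogeneous i
  refine ⟨fun a => (MvPolynomial.aeval T.dualForm f).coeff (Finsupp.single a 1), ?_⟩
  have h2 := congrArg T.coordEquiv (eq_sum_of_isHomogeneous_one h1)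
  have h3 : T.coordEquiv (MvPolynomial.aeval T.dualForm f) = f := T.coordEquiv.apply_symm_apply f
  rw [h3] at h2
  conv_lhs => rw [h2]
  simp

lemma face_ne_zero (i : Fin 4) : T.face i ≠ 0 := T.linearIndependent.ne_zero i

/-- The equation of a face as an element of `L`. -/
def coord (i : Fin 4) : L := algebraMap Poly L (T.face i)

lemma coord_ne_zero (i : Fin 4) : T.coord i ≠ 0 := by
  have := IsFractionRing.injective Poly L
  rw [coord, ne_eq, map_eq_zero_iff _ this]
  exact T.face_ne_zero i

lemma aeval_coord (p : Poly) :
    MvPolynomial.aeval T.coord p = algebraMap Poly L (MvPolynomial.aeval T.face p) := by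
  have := MvPolynomial.aeval_algebraMap_apply L T.face p
  exact this

lemma algebraicIndependent_coord : AlgebraicIndependent ℂ T.coord := by
  intro p q h
  rw [T.aeval_coord, T.aeval_coord] at h
  exact T.coordEquiv.injective (IsFractionRing.injective Poly L h)

/-- Four elements that generate the field `L` are algebraically independent. -/
lemma algebraicIndependent_of_generate (y : Fin 4 → L)
    (h : ∀ F : IntermediateField ℂ L, (∀ i, y i ∈ F) → ∀ i, T.coord i ∈ F) :
    AlgebraicIndependent ℂ y := by
  have htop : IntermediateField.adjoin ℂ (Set.range y) = ⊤ := by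
    rw [eq_top_iff]
    intro z _
    have hc := h (IntermediateField.adjoin ℂ (Set.range y))
      fun i => IntermediateField.subset_adjoin _ _ ⟨i, rfl⟩
    have hpoly : ∀ p : Poly, algebraMap Poly L p ∈ IntermediateField.adjoin ℂ (Set.range y) := by
      intro p
      obtain ⟨q, rfl⟩ := T.coordEquiv.surjective p
      rw [T.coordEquiv_apply, ← T.aeval_coord]
      induction q using MvPolynomial.induction_on with
      | C a => rw [MvPolynomial.aeval_C]; exact IntermediateField.algebraMap_mem _ a
      | add p q hp hq => rw [map_add]; exact add_mem hp hq
      | mul_X p i hp => rw [map_mul, MvPolynomial.aeval_X]; exact mul_mem hp (hc i)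
    obtain ⟨a, b, _, rfl⟩ := IsFractionRing.div_surjective (A := Poly) z
    exact div_mem (hpoly a) (hpoly b)
  have halg : Algebra.IsAlgebraic (Algebra.adjoin ℂ (Set.range y)) L := by
    refine ⟨fun z => ?_⟩
    have hz : z ∈ IntermediateField.adjoin ℂ (Set.range y) := htop ▸ IntermediateField.mem_top
    obtain ⟨a, ha, b, hb, rfl⟩ := (IntermediateField.mem_adjoin_iff_div (F := ℂ)).mp hz
    rw [div_eq_mul_inv]
    exact (isAlgebraic_algebraMap (⟨a, ha⟩ : Algebra.adjoin ℂ (Set.range y))).mul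
      (isAlgebraic_algebraMap (⟨b, hb⟩ : Algebra.adjoin ℂ (Set.range y))).inv
  have hle : Cardinal.mk (Fin 4) ≤ Algebra.trdeg ℂ L :=
    T.algebraicIndependent_coord.cardinalMk_le_trdeg
  exact (Algebra.IsAlgebraic.isTranscendenceBasis_of_le_trdeg_of_finite ℂ y hle).1

end Tetrahedron

variable {R R' η V : LocalSubring L} {A : Subring L} {T : Tetrahedron} {σ : Equiv.Perm (Fin 4)}

/-- Away from the exceptional divisor the blow-up does not change local rings. -/
lemma IsLoc.of_blowChart {x : Fin 3 → L} {S : Finset (Fin 3)} {t : Fin 3}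
    (h : IsLoc (chartRing (blowChart x S t)) R) (hu : UnitAt R (x t)) : IsLoc (chartRing x) R := by
  have hle := le_of_blowChart hu.1 h.1
  refine h.changeChart (fun i => hle (gen_mem_chartRing x i)) fun R₀ h₀ hB i => ?_
  have hx := (chartRing_le.mp hB).2
  rw [blowChart]
  split_ifs with hi
  · rw [div_eq_mul_inv]
    exact mul_mem (hx i) ((le_iff.mp h₀).2 _ (hx t) hu).2.2
  · exact hx i

/-! ### The charts of the tower -/

namespace Tetrahedron

variable (T : Tetrahedron) (σ : Equiv.Perm (Fin 4))

/-- Affine coordinates on projective 3-space centred at the vertex `v_{σ 0}`. -/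
def chart₀ : Fin 3 → L :=
  ![T.coord (σ 1) / T.coord (σ 0), T.coord (σ 2) / T.coord (σ 0), T.coord (σ 3) / T.coord (σ 0)]

/-- Coordinates on `Y'`: the coordinates are equations of the strict transforms of `f_{σ 1}` and
`f_{σ 2}` and of `E_{σ 0}`. -/
def chart₁ : Fin 3 → L :=
  ![T.coord (σ 1) / T.coord (σ 3), T.coord (σ 2) / T.coord (σ 3), T.coord (σ 3) / T.coord (σ 0)]

/-- Coordinates on `Y''`: the coordinates are equations of the strict transform of `f_{σ 1}`, of the
exceptional divisor over the edge `l_{σ 1, σ 2}` and of the strict transform of `E_{σ 0}`. -/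
def chart₂ : Fin 3 → L :=
  ![T.coord (σ 1) / T.coord (σ 2), T.coord (σ 2) / T.coord (σ 3), T.coord (σ 3) / T.coord (σ 0)]

/-- Coordinates on `Y`: the coordinates are equations of the strict transform of `f_{σ 1}`, of the
exceptional divisor over the edge `l_{σ 1, σ 2}` and of `Γ_{σ 0, σ 1}`. -/
def faceChart : Fin 3 → L :=
  ![T.coord (σ 0) * T.coord (σ 1) / (T.coord (σ 2) * T.coord (σ 3)),
    T.coord (σ 2) / T.coord (σ 3), T.coord (σ 3) / T.coord (σ 0)]

/-- Coordinates on `Y`: the coordinates are equations of `Γ_{σ 0, σ 1}`, of the exceptional divisor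
over the edge `l_{σ 1, σ 2}` and of the strict transform of `E_{σ 0}`. -/
def excChart : Fin 3 → L :=
  ![T.coord (σ 1) / T.coord (σ 2), T.coord (σ 2) / T.coord (σ 3),
    T.coord (σ 2) * T.coord (σ 3) / (T.coord (σ 0) * T.coord (σ 1))]

lemma chart₀_ne_zero (i : Fin 3) : T.chart₀ σ i ≠ 0 := by
  fin_cases i <;> simp [chart₀, T.coord_ne_zero]

lemma chart₁_ne_zero (i : Fin 3) : T.chart₁ σ i ≠ 0 := by
  fin_cases i <;> simp [chart₁, T.coord_ne_zero]

lemma chart₂_ne_zero (i : Fin 3) : T.chart₂ σ i ≠ 0 := by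
  fin_cases i <;> simp [chart₂, T.coord_ne_zero]

lemma blowChart_chart₀ : blowChart (T.chart₀ σ) Finset.univ 2 = T.chart₁ σ := by
  have h := T.coord_ne_zero
  funext i
  fin_cases i <;> simp [blowChart, chart₀, chart₁, div_div_div_cancel_right₀, h]

lemma blowChart_chart₁ : blowChart (T.chart₁ σ) {0, 1} 1 = T.chart₂ σ := by
  have h := T.coord_ne_zero
  funext i
  fin_cases i <;> simp [blowChart, chart₂, chart₁, div_div_div_cancel_right₀, h]

lemma blowChart_chart₂ : blowChart (T.chart₂ σ) {0, 2} 2 = T.faceChart σ := by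
  have h := T.coord_ne_zero
  funext i
  fin_cases i
  · simp only [blowChart, chart₂, faceChart]
    simp [div_div_div_eq, mul_comm]
  · simp [blowChart, chart₂, faceChart]
  · simp [blowChart, chart₂, faceChart]

lemma blowChart_chart₂' : blowChart (T.chart₂ σ) {0, 2} 0 = T.excChart σ := by
  have h := T.coord_ne_zero
  funext i
  fin_cases i
  · simp [blowChart, chart₂, excChart]
  · simp [blowChart, chart₂, excChart]
  · simp only [blowChart, chart₂, excChart]
    simp [div_div_div_eq, mul_comm]

lemma exists_perm (i : Fin 4) : ∃ τ : Equiv.Perm (Fin 4), τ 0 = i :=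
  ⟨Equiv.swap 0 i, by simp⟩

/-- Three elements that together with one homogeneous coordinate generate the field `L` are
algebraically independent. -/
lemma algebraicIndependent_chart {x : Fin 3 → L} {i : Fin 4}
    (h : ∀ F : IntermediateField ℂ L, T.coord i ∈ F → (∀ i, x i ∈ F) → ∀ i, T.coord (σ i) ∈ F) :
    AlgebraicIndependent ℂ x := by
  have := T.algebraicIndependent_of_generate (Fin.cons (T.coord i) x) fun F hF j => by
    rw [← σ.apply_symm_apply j]
    exact h F (hF 0) (fun i => hF i.succ) _
  exact this.comp Fin.succ (Fin.succ_injective _)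

lemma algebraicIndependent_chart₀ : AlgebraicIndependent ℂ (T.chart₀ σ) := by
  have hs := T.coord_ne_zero
  refine T.algebraicIndependent_chart σ (i := σ 0) fun F h0 hx => ?_
  have h1 := mul_mem (hx 0) h0
  have h2 := mul_mem (hx 1) h0
  have h3 := mul_mem (hx 2) h0
  simp [chart₀, hs] at h1 h2 h3
  intro i; fin_cases i <;> assumption

lemma algebraicIndependent_chart₁ : AlgebraicIndependent ℂ (T.chart₁ σ) := by
  have hs := T.coord_ne_zero
  refine T.algebraicIndependent_chart σ (i := σ 0) fun F h0 hx => ?_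
  have h3 := mul_mem (hx 2) h0
  simp [chart₁, hs] at h3
  have h1 := mul_mem (hx 0) h3
  have h2 := mul_mem (hx 1) h3
  simp [chart₁, hs] at h1 h2
  intro i; fin_cases i <;> assumption

lemma algebraicIndependent_chart₂ : AlgebraicIndependent ℂ (T.chart₂ σ) := by
  have hs := T.coord_ne_zero
  refine T.algebraicIndependent_chart σ (i := σ 0) fun F h0 hx => ?_
  have h3 := mul_mem (hx 2) h0
  simp [chart₂, hs] at h3
  have h2 := mul_mem (hx 1) h3
  simp [chart₂, hs] at h2
  have h1 := mul_mem (hx 0) h2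
  simp [chart₂, hs] at h1
  intro i; fin_cases i <;> assumption

lemma algebraicIndependent_faceChart : AlgebraicIndependent ℂ (T.faceChart σ) := by
  have hs := T.coord_ne_zero
  refine T.algebraicIndependent_chart σ (i := σ 0) fun F h0 hx => ?_
  have h3 := mul_mem (hx 2) h0
  simp [faceChart, hs] at h3
  have h2 := mul_mem (hx 1) h3
  simp [faceChart, hs] at h2
  have h1 := mul_mem (hx 0) (mul_mem (div_mem h2 h0) h3)
  have e : T.faceChart σ 0 * (T.coord (σ 2) / T.coord (σ 0) * T.coord (σ 3)) = T.coord (σ 1) := by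
    have := hs (σ 0); have := hs (σ 2); have := hs (σ 3)
    simp only [faceChart, Matrix.cons_val_zero]
    field_simp
  rw [e] at h1
  intro i; fin_cases i <;> assumption

lemma algebraicIndependent_excChart : AlgebraicIndependent ℂ (T.excChart σ) := by
  have hs := T.coord_ne_zero
  refine T.algebraicIndependent_chart σ (i := σ 3) fun F h3 hx => ?_
  have h2 := mul_mem (hx 1) h3
  simp [excChart, hs] at h2
  have h1 := mul_mem (hx 0) h2
  simp [excChart, hs] at h1
  have h0 := div_mem (mul_mem h2 h3) (mul_mem (hx 2) h1)
  have e : T.coord (σ 2) * T.coord (σ 3) / (T.excChart σ 2 * T.coord (σ 1)) = T.coord (σ 0) := by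
    have := hs (σ 0); have := hs (σ 1); have := hs (σ 2); have := hs (σ 3)
    simp only [excChart]
    simp
    field_simp
  rw [e] at h0
  intro i; fin_cases i <;> assumption

end Tetrahedron

/-! ### Projective space -/

section ProjectiveSpace

lemma coord_div_mem (h : chartRing (T.chart₀ σ) ≤ A) (j : Fin 4) :
    T.coord j / T.coord (σ 0) ∈ A := by
  have h' := (chartRing_le.mp h).2
  rw [← σ.apply_symm_apply j]
  generalize σ.symm j = k
  fin_cases k
  · simp [T.coord_ne_zero, one_mem]
  · exact h' 0
  · exact h' 1
  · exact h' 2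

lemma form_div_mem (h : chartRing (T.chart₀ σ) ≤ A) {n : Poly} (hn : n.IsHomogeneous 1) :
    algebraMap Poly L n / T.coord (σ 0) ∈ A := by
  obtain ⟨c, rfl⟩ := T.exists_eq_sum_face hn
  rw [map_sum, Finset.sum_div]
  refine sum_mem fun i _ => ?_
  rw [map_mul, mul_div_assoc]
  refine mul_mem ?_ (coord_div_mem h i)
  have := (chartRing_le.mp h).1 (c i)
  rwa [IsScalarTower.algebraMap_apply ℂ Poly L] at this

lemma chart_eq_chartRing (T : Tetrahedron) (σ : Equiv.Perm (Fin 4)) :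
    chart (T.face (σ 0)) = chartRing (T.chart₀ σ) := by
  apply le_antisymm
  · rw [chart, Subring.closure_le, Set.union_subset_iff]
    constructor
    · rintro _ ⟨c, rfl⟩; exact algebraMap_mem_chartRing _ c
    · rintro _ ⟨n, hn, rfl⟩; exact form_div_mem le_rfl hn
  · refine chartRing_le.mpr ⟨fun c => Subring.subset_closure (.inl ⟨c, rfl⟩), fun i => ?_⟩
    fin_cases i
    · exact Subring.subset_closure (.inr ⟨T.face (σ 1), T.isHomogeneous _, rfl⟩)
    · exact Subring.subset_closure (.inr ⟨T.face (σ 2), T.isHomogeneous _, rfl⟩)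
    · exact Subring.subset_closure (.inr ⟨T.face (σ 3), T.isHomogeneous _, rfl⟩)

lemma mem_P3 (T : Tetrahedron) : R ∈ P3 ↔ ∃ σ, IsLoc (chartRing (T.chart₀ σ)) R := by
  constructor
  · rintro ⟨m, hm, hm0, hP⟩
    have hR := (isLoc_iff _ _).mpr hP
    have hm0' : algebraMap Poly L m ≠ 0 := by
      rwa [ne_eq, map_eq_zero_iff _ (IsFractionRing.injective Poly L)]
    have hC : ∀ c, algebraMap ℂ L c ∈ R.toSubring := fun c =>
      hR.1 (Subring.subset_closure (.inl ⟨c, rfl⟩))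
    have hn : ∀ n : Poly, n.IsHomogeneous 1 →
        algebraMap Poly L n / algebraMap Poly L m ∈ R.toSubring :=
      fun n hn => hR.1 (Subring.subset_closure (.inr ⟨n, hn, rfl⟩))
    obtain ⟨c, hc⟩ := T.exists_eq_sum_face hm
    obtain ⟨i, -, hu⟩ := exists_unitAt_of_sum (R := R) Finset.univ
      (fun i => T.coord i / algebraMap Poly L m * algebraMap ℂ L (c i))
      (fun i _ => mul_mem (hn _ (T.isHomogeneous i)) (hC _)) (by
        have : ∑ i, T.coord i / algebraMap Poly L m * algebraMap ℂ L (c i) = 1 := by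
          rw [← div_self hm0']
          rw [show algebraMap Poly L m / algebraMap Poly L m =
            algebraMap Poly L (∑ i, MvPolynomial.C (c i) * T.face i) / algebraMap Poly L m by
              rw [← hc], map_sum, Finset.sum_div]
          refine Finset.sum_congr rfl fun i _ => ?_
          rw [map_mul, IsScalarTower.algebraMap_apply ℂ Poly L]
          simp only [Tetrahedron.coord, MvPolynomial.algebraMap_eq]
          ring
        rw [this]; exact UnitAt.one R)
    have hu' := hu.of_mul_left (hn _ (T.isHomogeneous i)) (hC _)
    obtain ⟨σ, rfl⟩ := Tetrahedron.exists_perm i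
    have hle : chartRing (T.chart₀ σ) ≤ R.toSubring := by
      rw [← chart_eq_chartRing, chart, Subring.closure_le, Set.union_subset_iff]
      constructor
      · rintro _ ⟨c, rfl⟩; exact hC c
      · rintro _ ⟨n, hn', rfl⟩
        have := mul_mem (hn n hn') hu'.2.2
        rwa [inv_div, div_mul_div_cancel₀ hm0'] at this
    refine ⟨σ, hR.change hle fun R₀ h₀ hB => ?_⟩
    have hu₀ := (le_iff.mp h₀).2 _ (form_div_mem hB hm) (by
      have := hu'.inv; rwa [inv_div] at this)
    rw [chart, Subring.closure_le, Set.union_subset_iff]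
    constructor
    · rintro _ ⟨c, rfl⟩; exact (chartRing_le.mp hB).1 c
    · rintro _ ⟨n, hn', rfl⟩
      have := mul_mem (form_div_mem hB hn') hu₀.2.2
      rwa [inv_div, div_mul_div_cancel₀ (T.coord_ne_zero _)] at this
  · rintro ⟨σ, h⟩
    rw [← chart_eq_chartRing] at h
    exact ⟨T.face (σ 0), T.isHomogeneous _, T.face_ne_zero _, (isLoc_iff _ _).mp h⟩

lemma separated_P3 (T : Tetrahedron) : Separated P3 := by
  intro R hR R' hR' V hV hV'
  obtain ⟨σ, hσ⟩ := (mem_P3 T).mp hR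
  obtain ⟨τ, hτ⟩ := (mem_P3 T).mp hR'
  have hle := le_iff.mp hV
  have hle' := le_iff.mp hV'
  have h1 := coord_div_mem hσ.1 (τ 0)
  have h2 := coord_div_mem hτ.1 (σ 0)
  have hu := hle.2 _ h1 ⟨div_ne_zero (T.coord_ne_zero _) (T.coord_ne_zero _), hle.1 h1,
    by rw [inv_div]; exact hle'.1 h2⟩
  refine IsLoc.eq_of_le ?_ hτ hV hV'
  have key : ∀ j, T.coord j / T.coord (τ 0) ∈ R.toSubring := fun j => by
    have := mul_mem (coord_div_mem hσ.1 j) hu.2.2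
    rwa [inv_div, div_mul_div_cancel₀ (T.coord_ne_zero _)] at this
  refine hσ.changeChart (fun i => by fin_cases i <;> exact key _) fun R₀ h₀ hC => ?_
  have hu₀ := (le_iff.mp h₀).2 _ (coord_div_mem hC (σ 0)) (by simpa using hu.inv)
  have key : ∀ j, T.coord j / T.coord (σ 0) ∈ R₀.toSubring := fun j => by
    have := mul_mem (coord_div_mem hC j) hu₀.2.2
    rwa [inv_div, div_mul_div_cancel₀ (T.coord_ne_zero _)] at this
  intro i
  fin_cases i <;> exact key _

end ProjectiveSpace

variable {R R' η V : LocalSubring L} {A : Subring L} {T : Tetrahedron} {σ : Equiv.Perm (Fin 4)}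
  {i j : Fin 4}

lemma perm_cases (σ : Equiv.Perm (Fin 4)) (j : Fin 4) :
    j = σ 0 ∨ j = σ 1 ∨ j = σ 2 ∨ j = σ 3 := by
  obtain ⟨k, rfl⟩ := σ.surjective j
  fin_cases k <;> simp

lemma formVanishes_iff (h : chartRing (T.chart₀ σ) ≤ η.toSubring) :
    FormVanishes (T.face j) η ↔ InMax η (T.coord j / T.coord (σ 0)) := by
  constructor
  · rintro ⟨m, hm, hm0, hmax⟩
    have hm0' : algebraMap Poly L m ≠ 0 := by
      rwa [ne_eq, map_eq_zero_iff _ (IsFractionRing.injective Poly L)]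
    have := hmax.mul_right (form_div_mem h hm)
    rwa [div_mul_div_cancel₀ hm0'] at this
  · intro h'
    exact ⟨T.face (σ 0), T.isHomogeneous _, T.face_ne_zero _, h'⟩

lemma not_inMax_self : ¬ InMax η (T.coord i / T.coord i) := by
  rw [div_self (T.coord_ne_zero i)]
  exact fun h => h.not_unitAt (UnitAt.one η)

lemma mem_vertexSet_iff (hη : η ∈ P3) (h : chartRing (T.chart₀ σ) ≤ η.toSubring) :
    η ∈ vertexSet T i ↔ i = σ 0 ∧ ∀ k, InMax η (T.chart₀ σ k) := by
  simp only [vertexSet, Set.mem_ofPred_eq, hη, true_and, formVanishes_iff h]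
  constructor
  · intro h'
    have hi : i = σ 0 := by
      by_contra hi
      exact not_inMax_self (h' _ (Ne.symm hi))
    refine ⟨hi, fun k => ?_⟩
    subst hi
    fin_cases k <;> exact h' _ (by simp)
  · rintro ⟨rfl, h'⟩ j hj
    rcases perm_cases σ j with rfl | rfl | rfl | rfl
    · exact absurd rfl hj
    · exact h' 0
    · exact h' 1
    · exact h' 2

lemma mem_centre₁_iff (hη : η ∈ P3) (h : chartRing (T.chart₀ σ) ≤ η.toSubring) :
    η ∈ centre₁ T ↔ ∀ k, InMax η (T.chart₀ σ k) := by
  simp [centre₁, mem_vertexSet_iff hη h]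

lemma mem_faceSet_iff (hη : η ∈ P3) (h : chartRing (T.chart₀ σ) ≤ η.toSubring) :
    η ∈ faceSet T j ↔ InMax η (T.coord j / T.coord (σ 0)) := by
  simp [faceSet, hη, formVanishes_iff h]

/-- Local rings of a vertex: they lie in the chart centred at that vertex. -/
lemma inMax_of_mem_vertexSet (hR : R ∈ vertexSet T i) (hj : j ≠ i) :
    InMax R (T.coord j / T.coord i) := by
  obtain ⟨τ, hτ⟩ := (mem_P3 T).mp hR.1
  obtain ⟨rfl, -⟩ := (mem_vertexSet_iff hR.1 hτ.1).mp hR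
  exact (formVanishes_iff hτ.1).mp (hR.2 j hj)

/-! ### The blow-up of the vertices -/

lemma isIdealOf_centre₁ (T : Tetrahedron) (σ : Equiv.Perm (Fin 4)) :
    IsIdealOf (T.chart₀ σ) Finset.univ (centre₁ T) := by
  refine isIdealOf (T.algebraicIndependent_chart₀ σ) (fun η hη h k _ => ?_) fun η hη => ?_
  · have hP : η ∈ P3 := by
      obtain ⟨i, hi⟩ := Set.mem_iUnion.mp hη
      exact hi.1
    exact (mem_centre₁_iff hP h).mp hη k
  · exact (mem_centre₁_iff ((mem_P3 T).mpr ⟨σ, hη.1⟩) hη.1.1).mpr fun k =>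
      hη.inMax (Finset.mem_univ k)

lemma chartRing_congr {x y : Fin 3 → L} (h : Set.range x = Set.range y) :
    chartRing x = chartRing y := by
  rw [chartRing, chartRing, h]

lemma range_comp_perm {x y : Fin 3 → L} (e : Equiv.Perm (Fin 3)) (h : ∀ i, x i = y (e i)) :
    Set.range x = Set.range y := by
  rw [show x = y ∘ e from funext h, e.surjective.range_comp]

lemma mem_Y₁ (T : Tetrahedron) : R ∈ Y₁ T ↔ ∃ σ, IsLoc (chartRing (T.chart₁ σ)) R := by
  rw [Y₁, mem_blowup_iff_exists_chart T.chart₀_ne_zero Finset.univ (fun _ => mem_P3 T)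
    (isIdealOf_centre₁ T)]
  have hs := T.coord_ne_zero
  constructor
  · rintro ⟨σ, t, -, h⟩
    fin_cases t
    · refine ⟨Equiv.swap 1 3 |>.trans σ, ?_⟩
      rwa [chartRing_congr (range_comp_perm (Equiv.swap 0 2) ?_)] at h
      intro i
      fin_cases i <;> simp [blowChart, Tetrahedron.chart₀, Tetrahedron.chart₁,
        div_div_div_cancel_right₀, hs, Equiv.swap_apply_def]
    · refine ⟨Equiv.swap 2 3 |>.trans σ, ?_⟩
      rwa [chartRing_congr (range_comp_perm (Equiv.swap 1 2) ?_)] at h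
      intro i
      fin_cases i <;> simp [blowChart, Tetrahedron.chart₀, Tetrahedron.chart₁,
        div_div_div_cancel_right₀, hs, Equiv.swap_apply_def]
    · exact ⟨σ, T.blowChart_chart₀ σ ▸ h⟩
  · rintro ⟨σ, h⟩
    exact ⟨σ, 2, Finset.mem_univ _, (T.blowChart_chart₀ σ).symm ▸ h⟩

lemma separated_Y₁ (T : Tetrahedron) : Separated (Y₁ T) := (separated_P3 T).blowup _

lemma isLoc_of_mem_Y₁ (hη : η ∈ Y₁ T) (h : chartRing (T.chart₁ σ) ≤ η.toSubring) :
    IsLoc (chartRing (T.chart₁ σ)) η :=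
  (separated_Y₁ T).isLoc (fun _ hR => (mem_Y₁ T).mpr ⟨σ, hR⟩) hη h

lemma chart₀_le (h : chartRing (T.chart₁ σ) ≤ A) : chartRing (T.chart₀ σ) ≤ A :=
  le_of_blowChart (T.chart₀_ne_zero σ 2) ((T.blowChart_chart₀ σ).symm ▸ h)

lemma mem_P3_of_chart₁ (h : IsLoc (chartRing (T.chart₁ σ)) η) (hu : UnitAt η (T.chart₁ σ 2)) :
    η ∈ P3 :=
  (mem_P3 T).mpr ⟨σ, ((T.blowChart_chart₀ σ).symm ▸ h).of_blowChart (t := 2) hu⟩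

lemma coord_one_div (T : Tetrahedron) (σ : Equiv.Perm (Fin 4)) :
    T.coord (σ 1) / T.coord (σ 0) = T.chart₁ σ 0 * T.chart₁ σ 2 := by
  simp [Tetrahedron.chart₁, div_mul_div_cancel₀, T.coord_ne_zero]

lemma coord_two_div (T : Tetrahedron) (σ : Equiv.Perm (Fin 4)) :
    T.coord (σ 2) / T.coord (σ 0) = T.chart₁ σ 1 * T.chart₁ σ 2 := by
  simp [Tetrahedron.chart₁, div_mul_div_cancel₀, T.coord_ne_zero]

lemma coord_three_div (T : Tetrahedron) (σ : Equiv.Perm (Fin 4)) :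
    T.coord (σ 3) / T.coord (σ 0) = T.chart₁ σ 2 := by
  simp [Tetrahedron.chart₁]

lemma forall_inMax_chart₀_iff (h : chartRing (T.chart₁ σ) ≤ R.toSubring) :
    (∀ k, InMax R (T.chart₀ σ k)) ↔ InMax R (T.chart₁ σ 2) := by
  have e : T.chart₀ σ = ![T.chart₁ σ 0 * T.chart₁ σ 2, T.chart₁ σ 1 * T.chart₁ σ 2,
      T.chart₁ σ 2] := by
    rw [Tetrahedron.chart₀, coord_one_div, coord_two_div, coord_three_div]
  rw [e]
  generalize T.chart₁ σ = x at h ⊢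
  constructor
  · intro h'; exact h' 2
  · intro h' k
    fin_cases k
    · exact h'.mul_left (h (gen_mem_chartRing _ 0))
    · exact h'.mul_left (h (gen_mem_chartRing _ 1))
    · exact h'

/-- In the charts of `Y'` the inverse image of the vertices is the exceptional divisor. -/
lemma mem_centre₁_iff_of_chart₁ (hη : η ∈ P3) (h : chartRing (T.chart₁ σ) ≤ η.toSubring) :
    η ∈ centre₁ T ↔ InMax η (T.chart₁ σ 2) := by
  rw [mem_centre₁_iff hη (chart₀_le h), forall_inMax_chart₀_iff h]

lemma mem_E₁_iff (hη : η ∈ Y₁ T) (h : chartRing (T.chart₁ σ) ≤ η.toSubring) :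
    η ∈ E₁ T i ↔ i = σ 0 ∧ InMax η (T.chart₁ σ 2) := by
  constructor
  · rintro ⟨-, R, hR, hle⟩
    have key : ∀ j, j ≠ i → InMax η (T.coord j / T.coord i) := fun j hj =>
      (inMax_of_mem_vertexSet hR hj).of_dominated hle
    have hi : i = σ 0 := by
      by_contra hi
      have := (key _ (Ne.symm hi)).mul_right (coord_div_mem (chart₀_le h) i)
      rw [div_mul_div_cancel₀ (T.coord_ne_zero _)] at this
      exact not_inMax_self this
    subst hi
    exact ⟨rfl, coord_three_div T σ ▸ key (σ 3) (by simp)⟩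
  · rintro ⟨rfl, hm⟩
    obtain ⟨R, hR, hle⟩ := exists_isLoc_le (chart₀_le h)
    have hP : R ∈ P3 := (mem_P3 T).mpr ⟨σ, hR⟩
    exact ⟨hη, R, (mem_vertexSet_iff hP hR.1).mpr ⟨rfl, fun k =>
      ((forall_inMax_chart₀_iff h).mpr hm k).of_le (le_iff.mp hle).1
        (hR.1 (gen_mem_chartRing _ k))⟩, hle⟩

/-- The chart meets the strict transforms of two faces only. -/
lemma mem_faceSet_of_notMem_centre₁ (hη : η ∈ P3) (hη' : η ∉ centre₁ T)
    (h : chartRing (T.chart₁ σ) ≤ η.toSubring) :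
    η ∈ faceSet T j ↔ j = σ 1 ∧ InMax η (T.chart₁ σ 0) ∨ j = σ 2 ∧ InMax η (T.chart₁ σ 1) := by
  have h2 := gen_mem_chartRing (T.chart₁ σ) 2
  have hu : UnitAt η (T.chart₁ σ 2) := (inMax_or_unitAt (h h2)).resolve_left
    fun h' => hη' ((mem_centre₁_iff_of_chart₁ hη h).mpr h')
  have cancel : ∀ {z}, InMax η (z * T.chart₁ σ 2) ↔ InMax η z := fun {z} => by
    refine ⟨fun h' => ?_, fun h' => h'.mul_right (h h2)⟩
    have := h'.mul_right hu.2.2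
    rwa [mul_inv_cancel_right₀ hu.1] at this
  rw [mem_faceSet_iff hη (chart₀_le h)]
  rcases perm_cases σ j with rfl | rfl | rfl | rfl
  · simp [not_inMax_self]
  · rw [coord_one_div, cancel]; simp
  · rw [coord_two_div, cancel]; simp
  · simp only [EmbeddingLike.apply_eq_iff_eq, Fin.reduceEq, false_and, or_self, iff_false]
    rw [coord_three_div]
    exact fun h' => h'.not_unitAt hu

lemma mem_f₁_iff (hη : η ∈ Y₁ T) (h : chartRing (T.chart₁ σ) ≤ η.toSubring) :
    η ∈ f₁ T j ↔ j = σ 1 ∧ InMax η (T.chart₁ σ 0) ∨ j = σ 2 ∧ InMax η (T.chart₁ σ 1) := by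
  constructor
  · rintro ⟨-, ξ, hξ, hξ', hle⟩
    refine ((mem_faceSet_of_notMem_centre₁ hξ.1 hξ' (h.trans hle)).mp hξ).imp ?_ ?_
    · exact And.imp_right fun h' => h'.of_le hle (h (gen_mem_chartRing _ 0))
    · exact And.imp_right fun h' => h'.of_le hle (h (gen_mem_chartRing _ 1))
  · have hloc := isLoc_of_mem_Y₁ hη h
    have key : ∀ t : Fin 3, t ≠ 2 → InMax η (T.chart₁ σ t) → ∃ ξ ∈ P3, ξ ∉ centre₁ T ∧
        η.toSubring ≤ ξ.toSubring ∧ chartRing (T.chart₁ σ) ≤ ξ.toSubring ∧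
          InMax ξ (T.chart₁ σ t) := fun t ht hm => by
      obtain ⟨ξ, hξ⟩ := exists_isGenericPt (T.algebraicIndependent_chart₁ σ) {t}
      have hu : UnitAt ξ (T.chart₁ σ 2) := hξ.unitAt (by simpa using ht.symm)
      have hP := mem_P3_of_chart₁ hξ.1 hu
      refine ⟨ξ, hP, ?_, hξ.toSubring_le hloc (by simpa using hm), hξ.1.1, hξ.inMax (by simp)⟩
      rw [mem_centre₁_iff_of_chart₁ hP hξ.1.1]
      exact fun h' => h'.not_unitAt hu
    rintro (⟨rfl, hm⟩ | ⟨rfl, hm⟩)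
    · obtain ⟨ξ, hP, hc, hle, h', hm'⟩ := key 0 (by decide) hm
      exact ⟨hη, ξ, (mem_faceSet_of_notMem_centre₁ hP hc h').mpr (.inl ⟨rfl, hm'⟩), hc, hle⟩
    · obtain ⟨ξ, hP, hc, hle, h', hm'⟩ := key 1 (by decide) hm
      exact ⟨hη, ξ, (mem_faceSet_of_notMem_centre₁ hP hc h').mpr (.inr ⟨rfl, hm'⟩), hc, hle⟩

lemma inMax_of_mem_edge₁ (hij : i ≠ j) (hη : η ∈ edge₁ T i j)
    (h : chartRing (T.chart₁ σ) ≤ η.toSubring) :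
    InMax η (T.chart₁ σ 0) ∧ InMax η (T.chart₁ σ 1) := by
  obtain ⟨-, ξ, ⟨hi, hj⟩, hξ', hle⟩ := hη
  have h0 := fun h' : InMax ξ (T.chart₁ σ 0) => h'.of_le hle (h (gen_mem_chartRing _ 0))
  have h1 := fun h' : InMax ξ (T.chart₁ σ 1) => h'.of_le hle (h (gen_mem_chartRing _ 1))
  rcases (mem_faceSet_of_notMem_centre₁ hi.1 hξ' (h.trans hle)).mp hi with ⟨rfl, ha⟩ | ⟨rfl, ha⟩ <;>
  rcases (mem_faceSet_of_notMem_centre₁ hj.1 hξ' (h.trans hle)).mp hj with ⟨rfl, hb⟩ | ⟨rfl, hb⟩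
  · exact absurd rfl hij
  · exact ⟨h0 ha, h1 hb⟩
  · exact ⟨h0 hb, h1 ha⟩
  · exact absurd rfl hij

lemma mem_edge₁ (hη : η ∈ Y₁ T) (h : chartRing (T.chart₁ σ) ≤ η.toSubring)
    (h0 : InMax η (T.chart₁ σ 0)) (h1 : InMax η (T.chart₁ σ 1)) :
    η ∈ edge₁ T (σ 1) (σ 2) := by
  have hloc := isLoc_of_mem_Y₁ hη h
  obtain ⟨ξ, hξ⟩ := exists_isGenericPt (T.algebraicIndependent_chart₁ σ) {0, 1}
  have hu : UnitAt ξ (T.chart₁ σ 2) := hξ.unitAt (by decide)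
  have hP := mem_P3_of_chart₁ hξ.1 hu
  have hc : ξ ∉ centre₁ T := by
    rw [mem_centre₁_iff_of_chart₁ hP hξ.1.1]
    exact fun h' => h'.not_unitAt hu
  refine ⟨hη, ξ, ⟨?_, ?_⟩, hc, hξ.toSubring_le hloc (by simp [h0, h1])⟩
  · exact (mem_faceSet_of_notMem_centre₁ hP hc hξ.1.1).mpr (.inl ⟨rfl, hξ.inMax (by decide)⟩)
  · exact (mem_faceSet_of_notMem_centre₁ hP hc hξ.1.1).mpr (.inr ⟨rfl, hξ.inMax (by decide)⟩)

lemma mem_centre₂_iff (hη : η ∈ Y₁ T) (h : chartRing (T.chart₁ σ) ≤ η.toSubring) :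
    η ∈ centre₂ T ↔ InMax η (T.chart₁ σ 0) ∧ InMax η (T.chart₁ σ 1) := by
  simp only [centre₂, Set.mem_iUnion]
  constructor
  · rintro ⟨i, j, hij, hη'⟩
    exact inMax_of_mem_edge₁ hij hη' h
  · rintro ⟨h0, h1⟩
    exact ⟨σ 1, σ 2, by simp, mem_edge₁ hη h h0 h1⟩

/-! ### The blow-up of the edges -/

lemma centre₂_subset (T : Tetrahedron) : centre₂ T ⊆ Y₁ T := by
  simp only [centre₂, Set.iUnion_subset_iff]
  exact fun i j _ η hη => hη.1

lemma isIdealOf_centre₂ (T : Tetrahedron) (σ : Equiv.Perm (Fin 4)) :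
    IsIdealOf (T.chart₁ σ) {0, 1} (centre₂ T) := by
  refine isIdealOf (T.algebraicIndependent_chart₁ σ) (fun η hη h k hk => ?_) fun η hη => ?_
  · have := (mem_centre₂_iff (centre₂_subset T hη) h).mp hη
    simp only [Finset.mem_insert, Finset.mem_singleton] at hk
    rcases hk with rfl | rfl
    exacts [this.1, this.2]
  · exact (mem_centre₂_iff ((mem_Y₁ T).mpr ⟨σ, hη.1⟩) hη.1.1).mpr
      ⟨hη.inMax (by decide), hη.inMax (by decide)⟩

lemma mem_Y₂ (T : Tetrahedron) : R ∈ Y₂ T ↔ ∃ σ, IsLoc (chartRing (T.chart₂ σ)) R := by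
  rw [Y₂, mem_blowup_iff_exists_chart T.chart₁_ne_zero {0, 1} (fun _ => mem_Y₁ T)
    (isIdealOf_centre₂ T)]
  have hs := T.coord_ne_zero
  constructor
  · rintro ⟨σ, t, ht, h⟩
    simp only [Finset.mem_insert, Finset.mem_singleton] at ht
    rcases ht with rfl | rfl
    · refine ⟨Equiv.swap 1 2 |>.trans σ, ?_⟩
      rwa [chartRing_congr (range_comp_perm (Equiv.swap 0 1) ?_)] at h
      intro i
      fin_cases i <;> simp [blowChart, Tetrahedron.chart₂, Tetrahedron.chart₁,
        div_div_div_cancel_right₀, hs, Equiv.swap_apply_def]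
    · exact ⟨σ, T.blowChart_chart₁ σ ▸ h⟩
  · rintro ⟨σ, h⟩
    exact ⟨σ, 1, by decide, (T.blowChart_chart₁ σ).symm ▸ h⟩

lemma separated_Y₂ (T : Tetrahedron) : Separated (Y₂ T) := (separated_Y₁ T).blowup _

lemma isLoc_of_mem_Y₂ (hη : η ∈ Y₂ T) (h : chartRing (T.chart₂ σ) ≤ η.toSubring) :
    IsLoc (chartRing (T.chart₂ σ)) η :=
  (separated_Y₂ T).isLoc (fun _ hR => (mem_Y₂ T).mpr ⟨σ, hR⟩) hη h

lemma chart₁_le (h : chartRing (T.chart₂ σ) ≤ A) : chartRing (T.chart₁ σ) ≤ A :=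
  le_of_blowChart (T.chart₁_ne_zero σ 1) ((T.blowChart_chart₁ σ).symm ▸ h)

lemma mem_Y₁_of_chart₂ (h : IsLoc (chartRing (T.chart₂ σ)) η) (hu : UnitAt η (T.chart₂ σ 1)) :
    η ∈ Y₁ T :=
  (mem_Y₁ T).mpr ⟨σ, ((T.blowChart_chart₁ σ).symm ▸ h).of_blowChart (t := 1) hu⟩

lemma chart₁_zero (T : Tetrahedron) (σ : Equiv.Perm (Fin 4)) :
    T.chart₁ σ 0 = T.chart₂ σ 0 * T.chart₂ σ 1 := by
  simp [Tetrahedron.chart₁, Tetrahedron.chart₂, div_mul_div_cancel₀, T.coord_ne_zero]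

/-- In the charts of `Y''` the inverse image of the edges is the exceptional divisor. -/
lemma mem_centre₂_iff_of_chart₂ (hη : η ∈ Y₁ T) (h : chartRing (T.chart₂ σ) ≤ η.toSubring) :
    η ∈ centre₂ T ↔ InMax η (T.chart₂ σ 1) := by
  rw [mem_centre₂_iff hη (chart₁_le h), chart₁_zero]
  exact ⟨fun h' => h'.2, fun h' => ⟨h'.mul_left (h (gen_mem_chartRing _ 0)), h'⟩⟩

lemma mem_f₁_of_notMem_centre₂ (hη : η ∈ Y₁ T) (hη' : η ∉ centre₂ T)
    (h : chartRing (T.chart₂ σ) ≤ η.toSubring) :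
    η ∈ f₁ T j ↔ j = σ 1 ∧ InMax η (T.chart₂ σ 0) := by
  have h0 := h (gen_mem_chartRing (T.chart₂ σ) 0)
  have h1 := h (gen_mem_chartRing (T.chart₂ σ) 1)
  rw [mem_centre₂_iff_of_chart₂ hη h] at hη'
  rw [mem_f₁_iff hη (chart₁_le h), chart₁_zero]
  constructor
  · rintro (⟨rfl, hm⟩ | ⟨rfl, hm⟩)
    · exact ⟨rfl, (hm.or_of_mul h0 h1).resolve_right hη'⟩
    · exact absurd hm hη'
  · rintro ⟨rfl, hm⟩
    exact .inl ⟨rfl, hm.mul_right h1⟩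

/-- The generic point of a coordinate subspace of a chart of `Y''` that is not contained in the
exceptional divisor is a point of `Y'` outside the centre. -/
lemma exists_generalization_chart₂ {S : Finset (Fin 3)} (hS : 1 ∉ S)
    (hη : IsLoc (chartRing (T.chart₂ σ)) η) (hm : ∀ k ∈ S, InMax η (T.chart₂ σ k)) :
    ∃ ξ ∈ Y₁ T, ξ ∉ centre₂ T ∧ η.toSubring ≤ ξ.toSubring ∧
      chartRing (T.chart₂ σ) ≤ ξ.toSubring ∧ ∀ k ∈ S, InMax ξ (T.chart₂ σ k) := by
  obtain ⟨ξ, hξ⟩ := exists_isGenericPt (T.algebraicIndependent_chart₂ σ) S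
  have hu : UnitAt ξ (T.chart₂ σ 1) := hξ.unitAt hS
  have hP := mem_Y₁_of_chart₂ hξ.1 hu
  refine ⟨ξ, hP, ?_, hξ.toSubring_le hη hm, hξ.1.1, fun k hk => hξ.inMax hk⟩
  rw [mem_centre₂_iff_of_chart₂ hP hξ.1.1]
  exact fun h' => h'.not_unitAt hu

lemma mem_E₂_iff (hη : η ∈ Y₂ T) (h : chartRing (T.chart₂ σ) ≤ η.toSubring) :
    η ∈ E₂ T i ↔ i = σ 0 ∧ InMax η (T.chart₂ σ 2) := by
  constructor
  · rintro ⟨-, ξ, hξ, -, hle⟩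
    obtain ⟨rfl, hm⟩ := (mem_E₁_iff hξ.1 (chart₁_le (h.trans hle))).mp hξ
    exact ⟨rfl, hm.of_le hle (h (gen_mem_chartRing _ 2))⟩
  · rintro ⟨rfl, hm⟩
    obtain ⟨ξ, hξ, hc, hle, h', hm'⟩ := exists_generalization_chart₂ (S := {2}) (by decide)
      (isLoc_of_mem_Y₂ hη h) (by simpa using hm)
    exact ⟨hη, ξ, (mem_E₁_iff hξ (chart₁_le h')).mpr ⟨rfl, hm' 2 (by simp)⟩, hc, hle⟩

lemma mem_f₂_iff (hη : η ∈ Y₂ T) (h : chartRing (T.chart₂ σ) ≤ η.toSubring) :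
    η ∈ f₂ T j ↔ j = σ 1 ∧ InMax η (T.chart₂ σ 0) := by
  constructor
  · rintro ⟨-, ξ, hξ, hc, hle⟩
    obtain ⟨rfl, hm⟩ := (mem_f₁_of_notMem_centre₂ hξ.1 hc (h.trans hle)).mp hξ
    exact ⟨rfl, hm.of_le hle (h (gen_mem_chartRing _ 0))⟩
  · rintro ⟨rfl, hm⟩
    obtain ⟨ξ, hξ, hc, hle, h', hm'⟩ := exists_generalization_chart₂ (S := {0}) (by decide)
      (isLoc_of_mem_Y₂ hη h) (by simpa using hm)
    exact ⟨hη, ξ, (mem_f₁_of_notMem_centre₂ hξ hc h').mpr ⟨rfl, hm' 0 (by simp)⟩, hc, hle⟩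

lemma mem_gamma₂_iff (hη : η ∈ Y₂ T) (h : chartRing (T.chart₂ σ) ≤ η.toSubring) :
    η ∈ gamma₂ T i j ↔ i = σ 0 ∧ j = σ 1 ∧ InMax η (T.chart₂ σ 0) ∧ InMax η (T.chart₂ σ 2) := by
  constructor
  · rintro ⟨-, ξ, ⟨hE, hf⟩, hc, hle⟩
    obtain ⟨rfl, hm⟩ := (mem_E₁_iff hE.1 (chart₁_le (h.trans hle))).mp hE
    obtain ⟨rfl, hm'⟩ := (mem_f₁_of_notMem_centre₂ hE.1 hc (h.trans hle)).mp hf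
    exact ⟨rfl, rfl, hm'.of_le hle (h (gen_mem_chartRing _ 0)),
      hm.of_le hle (h (gen_mem_chartRing _ 2))⟩
  · rintro ⟨rfl, rfl, hm0, hm2⟩
    obtain ⟨ξ, hξ, hc, hle, h', hm'⟩ := exists_generalization_chart₂ (S := {0, 2}) (by decide)
      (isLoc_of_mem_Y₂ hη h) (by simp [hm0, hm2])
    exact ⟨hη, ξ, ⟨(mem_E₁_iff hξ (chart₁_le h')).mpr ⟨rfl, hm' 2 (by simp)⟩,
      (mem_f₁_of_notMem_centre₂ hξ hc h').mpr ⟨rfl, hm' 0 (by simp)⟩⟩, hc, hle⟩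

lemma mem_centre₃_iff (hη : η ∈ Y₂ T) (h : chartRing (T.chart₂ σ) ≤ η.toSubring) :
    η ∈ centre₃ T ↔ InMax η (T.chart₂ σ 0) ∧ InMax η (T.chart₂ σ 2) := by
  simp only [centre₃, Set.mem_iUnion, mem_gamma₂_iff hη h]
  constructor
  · rintro ⟨i, j, -, -, -, h'⟩; exact h'
  · intro h'; exact ⟨σ 0, σ 1, by simp, rfl, rfl, h'⟩

/-! ### The blow-up of the lines `γ_ij` -/

lemma centre₃_subset (T : Tetrahedron) : centre₃ T ⊆ Y₂ T := by
  simp only [centre₃, Set.iUnion_subset_iff]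
  exact fun i j _ η hη => hη.1

lemma isIdealOf_centre₃ (T : Tetrahedron) (σ : Equiv.Perm (Fin 4)) :
    IsIdealOf (T.chart₂ σ) {0, 2} (centre₃ T) := by
  refine isIdealOf (T.algebraicIndependent_chart₂ σ) (fun η hη h k hk => ?_) fun η hη => ?_
  · have := (mem_centre₃_iff (centre₃_subset T hη) h).mp hη
    simp only [Finset.mem_insert, Finset.mem_singleton] at hk
    rcases hk with rfl | rfl
    exacts [this.1, this.2]
  · exact (mem_centre₃_iff ((mem_Y₂ T).mpr ⟨σ, hη.1⟩) hη.1.1).mpr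
      ⟨hη.inMax (by decide), hη.inMax (by decide)⟩

lemma mem_Y (T : Tetrahedron) : R ∈ Y T ↔
    ∃ σ, IsLoc (chartRing (T.faceChart σ)) R ∨ IsLoc (chartRing (T.excChart σ)) R := by
  rw [Y, mem_blowup_iff_exists_chart T.chart₂_ne_zero {0, 2} (fun _ => mem_Y₂ T)
    (isIdealOf_centre₃ T)]
  simp only [Finset.mem_insert, Finset.mem_singleton, exists_eq_or_imp, exists_eq_left,
    T.blowChart_chart₂, T.blowChart_chart₂']
  exact exists_congr fun σ => or_comm

lemma chart₂_le_of_faceChart (h : chartRing (T.faceChart σ) ≤ A) : chartRing (T.chart₂ σ) ≤ A :=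
  le_of_blowChart (T.chart₂_ne_zero σ 2) ((T.blowChart_chart₂ σ).symm ▸ h)

lemma chart₂_le_of_excChart (h : chartRing (T.excChart σ) ≤ A) : chartRing (T.chart₂ σ) ≤ A :=
  le_of_blowChart (T.chart₂_ne_zero σ 0) ((T.blowChart_chart₂' σ).symm ▸ h)

lemma chart₂_two_eq (T : Tetrahedron) (σ : Equiv.Perm (Fin 4)) :
    T.chart₂ σ 2 = T.faceChart σ 2 := by
  simp [Tetrahedron.chart₂, Tetrahedron.faceChart]

lemma chart₂_zero_eq (T : Tetrahedron) (σ : Equiv.Perm (Fin 4)) :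
    T.chart₂ σ 0 = T.excChart σ 0 := by
  simp [Tetrahedron.chart₂, Tetrahedron.excChart]

lemma mem_Y₂_of_faceChart (h : IsLoc (chartRing (T.faceChart σ)) η)
    (hu : UnitAt η (T.faceChart σ 2)) : η ∈ Y₂ T := by
  rw [← chart₂_two_eq] at hu
  rw [← T.blowChart_chart₂] at h
  exact (mem_Y₂ T).mpr ⟨σ, h.of_blowChart hu⟩

lemma mem_Y₂_of_excChart (h : IsLoc (chartRing (T.excChart σ)) η)
    (hu : UnitAt η (T.excChart σ 0)) : η ∈ Y₂ T := by
  rw [← chart₂_zero_eq] at hu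
  rw [← T.blowChart_chart₂'] at h
  exact (mem_Y₂ T).mpr ⟨σ, h.of_blowChart hu⟩

lemma chart₂_zero (T : Tetrahedron) (σ : Equiv.Perm (Fin 4)) :
    T.chart₂ σ 0 = T.faceChart σ 0 * T.faceChart σ 2 := by
  have h := congrFun (T.blowChart_chart₂ σ) 0
  have e : blowChart (T.chart₂ σ) {0, 2} 2 0 = T.chart₂ σ 0 / T.chart₂ σ 2 := by simp [blowChart]
  rw [← h, ← chart₂_two_eq, e, div_mul_cancel₀ _ (T.chart₂_ne_zero σ 2)]

lemma chart₂_two (T : Tetrahedron) (σ : Equiv.Perm (Fin 4)) :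
    T.chart₂ σ 2 = T.excChart σ 0 * T.excChart σ 2 := by
  have h := congrFun (T.blowChart_chart₂' σ) 2
  have e : blowChart (T.chart₂ σ) {0, 2} 0 2 = T.chart₂ σ 2 / T.chart₂ σ 0 := by simp [blowChart]
  rw [← h, ← chart₂_zero_eq, e, mul_div_cancel₀ _ (T.chart₂_ne_zero σ 0)]

/-- The strict transform of `E_i` does not meet the charts at the strict transforms of the
faces. -/
lemma notMem_excE_of_faceChart (h : chartRing (T.faceChart σ) ≤ R.toSubring) :
    R ∉ excE T i := by
  rintro ⟨-, η, hη, hc, hle⟩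
  have h2 := chart₂_le_of_faceChart (h.trans hle)
  obtain ⟨rfl, hm⟩ := (mem_E₂_iff hη.1 h2).mp hη
  refine hc ((mem_centre₃_iff hη.1 h2).mpr ⟨?_, hm⟩)
  rw [chart₂_zero, ← chart₂_two_eq]
  exact hm.mul_left (hle (h (gen_mem_chartRing _ 0)))

lemma notMem_strictFace_of_excChart (h : chartRing (T.excChart σ) ≤ R.toSubring) :
    R ∉ strictFace T j := by
  rintro ⟨-, η, hη, hc, hle⟩
  have h2 := chart₂_le_of_excChart (h.trans hle)
  obtain ⟨rfl, hm⟩ := (mem_f₂_iff hη.1 h2).mp hη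
  refine hc ((mem_centre₃_iff hη.1 h2).mpr ⟨hm, ?_⟩)
  rw [chart₂_two, ← chart₂_zero_eq]
  exact hm.mul_right (hle (h (gen_mem_chartRing _ 2)))

lemma mem_excE_iff (hR : IsLoc (chartRing (T.excChart σ)) R) :
    R ∈ excE T i ↔ i = σ 0 ∧ InMax R (T.excChart σ 2) := by
  constructor
  · rintro ⟨-, η, hη, hc, hle⟩
    have h2 := chart₂_le_of_excChart (hR.1.trans hle)
    obtain ⟨rfl, hm⟩ := (mem_E₂_iff hη.1 h2).mp hη
    have hm' := hm
    rw [chart₂_two, ← chart₂_zero_eq] at hm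
    refine ⟨rfl, InMax.of_le hle (hR.1 (gen_mem_chartRing _ 2)) ?_⟩
    refine (hm.or_of_mul (h2 (gen_mem_chartRing _ 0))
      (hle (hR.1 (gen_mem_chartRing _ 2)))).resolve_left fun hφ => hc ?_
    exact (mem_centre₃_iff hη.1 h2).mpr ⟨hφ, hm'⟩
  · rintro ⟨rfl, hm⟩
    obtain ⟨ξ, hξ⟩ := exists_isGenericPt (T.algebraicIndependent_excChart σ) {2}
    have hu : UnitAt ξ (T.excChart σ 0) := hξ.unitAt (by decide)
    have hY := mem_Y₂_of_excChart hξ.1 hu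
    have h2 := chart₂_le_of_excChart hξ.1.1
    refine ⟨(mem_Y T).mpr ⟨σ, .inr hR⟩, ξ, (mem_E₂_iff hY h2).mpr ⟨rfl, ?_⟩, ?_,
      hξ.toSubring_le hR (by simpa using hm)⟩
    · rw [chart₂_two]; exact (hξ.inMax (by simp)).mul_left hu.2.1
    · rw [mem_centre₃_iff hY h2]
      exact fun h' => h'.1.not_unitAt (chart₂_zero_eq T σ ▸ hu)

lemma mem_strictFace_iff (hR : IsLoc (chartRing (T.faceChart σ)) R) :
    R ∈ strictFace T j ↔ j = σ 1 ∧ InMax R (T.faceChart σ 0) := by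
  constructor
  · rintro ⟨-, η, hη, hc, hle⟩
    have h2 := chart₂_le_of_faceChart (hR.1.trans hle)
    obtain ⟨rfl, hm⟩ := (mem_f₂_iff hη.1 h2).mp hη
    have hm' := hm
    rw [chart₂_zero, ← chart₂_two_eq] at hm
    refine ⟨rfl, InMax.of_le hle (hR.1 (gen_mem_chartRing _ 0)) ?_⟩
    refine (hm.or_of_mul (hle (hR.1 (gen_mem_chartRing _ 0)))
      (h2 (gen_mem_chartRing _ 2))).resolve_right fun he => hc ?_
    exact (mem_centre₃_iff hη.1 h2).mpr ⟨hm', he⟩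
  · rintro ⟨rfl, hm⟩
    obtain ⟨ξ, hξ⟩ := exists_isGenericPt (T.algebraicIndependent_faceChart σ) {0}
    have hu : UnitAt ξ (T.faceChart σ 2) := hξ.unitAt (by decide)
    have hY := mem_Y₂_of_faceChart hξ.1 hu
    have h2 := chart₂_le_of_faceChart hξ.1.1
    refine ⟨(mem_Y T).mpr ⟨σ, .inl hR⟩, ξ, (mem_f₂_iff hY h2).mpr ⟨rfl, ?_⟩, ?_,
      hξ.toSubring_le hR (by simpa using hm)⟩
    · rw [chart₂_zero]; exact (hξ.inMax (by simp)).mul_right hu.2.1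
    · rw [mem_centre₃_iff hY h2]
      exact fun h' => h'.2.not_unitAt (chart₂_two_eq T σ ▸ hu)

lemma mem_excGamma_iff (hR : R ∈ Y T) (h : chartRing (T.chart₂ σ) ≤ R.toSubring) :
    R ∈ excGamma T i j ↔ i = σ 0 ∧ j = σ 1 ∧ InMax R (T.chart₂ σ 0) ∧ InMax R (T.chart₂ σ 2) := by
  obtain ⟨R₂, hR₂, hle⟩ := exists_isLoc_le h
  have hY : R₂ ∈ Y₂ T := (mem_Y₂ T).mpr ⟨σ, hR₂⟩
  constructor
  · rintro ⟨-, R', hR', hle'⟩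
    obtain rfl := separated_Y₂ T _ hY _ hR'.1 R hle hle'
    obtain ⟨rfl, rfl, h0, h2⟩ := (mem_gamma₂_iff hY hR₂.1).mp hR'
    exact ⟨rfl, rfl, h0.of_dominated hle, h2.of_dominated hle⟩
  · rintro ⟨rfl, rfl, h0, h2⟩
    have hle' := (le_iff.mp hle).1
    exact ⟨hR, R₂, (mem_gamma₂_iff hY hR₂.1).mpr ⟨rfl, rfl,
      h0.of_le hle' (hR₂.1 (gen_mem_chartRing _ 0)),
      h2.of_le hle' (hR₂.1 (gen_mem_chartRing _ 2))⟩, hle⟩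

/-! ### Monomials in the faces -/

/-- The chain rule for derivations. -/
lemma derivation_aeval {σ B : Type*} [Fintype σ] [CommRing B] [Algebra ℂ B]
    (D : Derivation ℂ B B) (f : σ → B) (p : MvPolynomial σ ℂ) :
    D (MvPolynomial.aeval f p) =
      ∑ c, MvPolynomial.aeval f (MvPolynomial.pderiv c p) * D (f c) := by
  classical
  induction p using MvPolynomial.induction_on with
  | C a => simp
  | add p q hp hq => simp [hp, hq, add_mul, Finset.sum_add_distrib]
  | mul_X p i hp =>
    simp only [map_mul, MvPolynomial.aeval_X, Derivation.leibniz, smul_eq_mul, hp, map_add,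
      MvPolynomial.pderiv_X, add_mul, Finset.sum_add_distrib, Finset.mul_sum]
    congr 1
    · simp [Pi.single_apply, apply_ite (MvPolynomial.aeval f)]
    · exact Finset.sum_congr rfl fun c _ => by ring

/-- The exponents of the sextic monomials that are double along the edges of the coordinate
tetrahedron. -/
def IsExp (a : Fin 4 → ℕ) : Prop := ∑ i, a i = 6 ∧ ∀ i j, i ≠ j → 2 ≤ a i + a j

instance (a : Fin 4 → ℕ) : Decidable (IsExp a) := by unfold IsExp; infer_instance

/-- The fourteen exponents: `s_i² S` and `S² / s_i²` for the four faces, and `s_i s_j S` for the six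
edges, where `S = s₀ s₁ s₂ s₃`. -/
def exps : Finset (Fin 4 → ℕ) :=
  {![3, 1, 1, 1], ![1, 3, 1, 1], ![1, 1, 3, 1], ![1, 1, 1, 3],
    ![0, 2, 2, 2], ![2, 0, 2, 2], ![2, 2, 0, 2], ![2, 2, 2, 0],
    ![2, 2, 1, 1], ![2, 1, 2, 1], ![2, 1, 1, 2], ![1, 2, 2, 1], ![1, 2, 1, 2], ![1, 1, 2, 2]}

lemma card_exps : exps.card = 14 := by decide

lemma eq_vec (a : Fin 4 → ℕ) : a = ![a 0, a 1, a 2, a 3] := by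
  funext i; fin_cases i <;> rfl

lemma mem_exps {a : Fin 4 → ℕ} : a ∈ exps ↔ IsExp a := by
  constructor
  · have : ∀ a ∈ exps, IsExp a := by decide
    exact this a
  · rintro ⟨h, h'⟩
    have h01 := h' 0 1 (by decide)
    have h02 := h' 0 2 (by decide)
    have h03 := h' 0 3 (by decide)
    have h12 := h' 1 2 (by decide)
    have h13 := h' 1 3 (by decide)
    have h23 := h' 2 3 (by decide)
    rw [Fin.sum_univ_four] at h
    rw [eq_vec a]
    generalize a 0 = x at *
    generalize a 1 = y at *
    generalize a 2 = z at *
    generalize a 3 = w at *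
    have hx : x ≤ 3 := by omega
    have hy : y ≤ 3 := by omega
    have hz : z ≤ 3 := by omega
    obtain rfl : w = 6 - x - y - z := by omega
    interval_cases x <;> interval_cases y <;> interval_cases z <;> first | omega | decide

namespace Tetrahedron

variable (T : Tetrahedron)

/-- The monomial with exponent `a` in the equations of the faces. -/
def mon (a : Fin 4 → ℕ) : Poly := ∏ i, T.face i ^ a i

lemma mon_eq (a : Fin 4 → ℕ) : T.mon a =
    T.coordEquiv (MvPolynomial.monomial (Finsupp.equivFunOnFinite.symm a) 1) := by
  rw [coordEquiv_apply, MvPolynomial.aeval_monomial, Finsupp.prod_fintype _ _ (by simp), mon]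
  simp

lemma mon_mul (a b : Fin 4 → ℕ) : T.mon a * T.mon b = T.mon (a + b) := by
  simp [mon, ← Finset.prod_mul_distrib, pow_add]

lemma mon_isHomogeneous {a : Fin 4 → ℕ} (h : ∑ i, a i = 6) : (T.mon a).IsHomogeneous 6 := by
  rw [← h]
  refine MvPolynomial.IsHomogeneous.prod _ _ _ fun i _ => ?_
  simpa using (T.isHomogeneous i).pow (a i)

lemma linearIndependent_mon : LinearIndependent ℂ T.mon := by
  have h := (MvPolynomial.basisMonomials (Fin 4) ℂ).linearIndependent.map'
    T.coordEquiv.toLinearMap (LinearMap.ker_eq_bot.mpr T.coordEquiv.injective)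
  have h' := h.comp Finsupp.equivFunOnFinite.symm (Equiv.injective _)
  have e : T.mon = (⇑T.coordEquiv.toLinearMap ∘ ⇑(MvPolynomial.basisMonomials (Fin 4) ℂ)) ∘
      ⇑Finsupp.equivFunOnFinite.symm := by
    funext a
    rw [mon_eq]
    simp
  rw [e]
  exact h'

/-- A product is double where two of its factors vanish. -/
lemma double_of_mul {P Q : Poly} (S : Poly) {x : Fin 4 → ℂ} (hP : MvPolynomial.eval x P = 0)
    (hQ : MvPolynomial.eval x Q = 0) : MvPolynomial.eval x (P * (Q * S)) = 0 ∧
      ∀ a, MvPolynomial.eval x (MvPolynomial.pderiv a (P * (Q * S))) = 0 := by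
  simp [hP, hQ]

lemma mon_mem_sextics {a : Fin 4 → ℕ} (ha : IsExp a) : T.mon a ∈ sextics T := by
  refine ⟨T.mon_isHomogeneous ha.1, fun i j hij x hi hj => ?_⟩
  have hsum := ha.2 i j hij
  have e : T.mon a = T.face i ^ a i * (T.face j ^ a j *
      ∏ k ∈ (Finset.univ.erase i).erase j, T.face k ^ a k) := by
    rw [mon, Finset.mul_prod_erase _ (fun k => T.face k ^ a k) (by simp [hij.symm]),
      Finset.mul_prod_erase _ (fun k => T.face k ^ a k) (by simp)]
  rw [e]
  generalize ∏ k ∈ (Finset.univ.erase i).erase j, T.face k ^ a k = S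
  have key : ∀ {G P Q : Poly} (S : Poly), MvPolynomial.eval x P = 0 → MvPolynomial.eval x Q = 0 →
      G = P * (Q * S) → MvPolynomial.eval x G = 0 ∧
        ∀ a, MvPolynomial.eval x (MvPolynomial.pderiv a G) = 0 := by
    rintro _ P Q S hP hQ rfl
    exact double_of_mul S hP hQ
  rcases Nat.lt_or_ge (a i) 2 with h | h
  · rcases Nat.eq_zero_or_pos (a i) with h0 | h0
    · obtain ⟨n, hn⟩ : ∃ n, a j = n + 2 := ⟨a j - 2, by omega⟩
      exact key (T.face j ^ n * S) hj hj (by rw [h0, hn]; ring)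
    · obtain ⟨n, hn⟩ : ∃ n, a j = n + 1 := ⟨a j - 1, by omega⟩
      exact key (T.face j ^ n * S) hi hj (by rw [show a i = 1 by omega, hn]; ring)
  · obtain ⟨n, hn⟩ : ∃ n, a i = n + 2 := ⟨a i - 2, by omega⟩
    exact key (T.face i ^ n * (T.face j ^ a j * S)) hi hi (by rw [hn]; ring)

/-- If a polynomial vanishes on the coordinate subspace `y_i = y_j = 0`, then the monomials that
involve neither variable do not occur in it. -/
lemma coeff_eq_zero_of_eval {H : Poly} {i j : Fin 4}
    (h : ∀ y : Fin 4 → ℂ, y i = 0 → y j = 0 → MvPolynomial.eval y H = 0) {m : Fin 4 →₀ ℕ}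
    (hi : m i = 0) (hj : m j = 0) : H.coeff m = 0 := by
  obtain ⟨q, hq⟩ := exists_eq_restrict_add {i, j} H
  have h0 : restrict {i, j} H = 0 := by
    refine MvPolynomial.funext fun y => ?_
    rw [map_zero, ← MvPolynomial.aeval_eq_eval, restrict, ← AlgHom.comp_apply,
      MvPolynomial.comp_aeval, MvPolynomial.aeval_eq_eval]
    exact h _ (by simp) (by simp)
  rw [h0, zero_add] at hq
  rw [hq, MvPolynomial.coeff_sum]
  refine Finset.sum_eq_zero fun k hk => ?_
  rw [MvPolynomial.coeff_mul_X', if_neg]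
  simp only [Finset.mem_insert, Finset.mem_singleton] at hk
  rcases hk with rfl | rfl <;> simpa

lemma eval_dualForm_face (y : Fin 4 → ℂ) (i : Fin 4) :
    MvPolynomial.eval (fun k => MvPolynomial.eval y (T.dualForm k)) (T.face i) = y i := by
  have := congrArg (MvPolynomial.aeval y : Poly →ₐ[ℂ] ℂ) (T.aeval_face i)
  rw [← AlgHom.comp_apply, MvPolynomial.comp_aeval, MvPolynomial.aeval_X] at this
  simpa [MvPolynomial.aeval_eq_eval] using this

lemma eval_aeval_dualForm (y : Fin 4 → ℂ) (F : Poly) :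
    MvPolynomial.eval y (MvPolynomial.aeval T.dualForm F) =
      MvPolynomial.eval (fun k => MvPolynomial.eval y (T.dualForm k)) F := by
  rw [← MvPolynomial.aeval_eq_eval, ← AlgHom.comp_apply, MvPolynomial.comp_aeval,
    MvPolynomial.aeval_eq_eval]

/-- A sextic that is double along the edges only involves the fourteen monomials. -/
lemma isExp_of_mem_sextics {F : Poly} (hF : F ∈ sextics T) {m : Fin 4 →₀ ℕ}
    (hm : (MvPolynomial.aeval T.dualForm F).coeff m ≠ 0) : IsExp m := by
  have hG : (MvPolynomial.aeval T.dualForm F).IsHomogeneous 6 := by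
    simpa using hF.1.aeval T.dualForm (n := 1) fun i => T.dualForm_isHomogeneous i
  have h0 : ∀ i j, i ≠ j → ∀ y : Fin 4 → ℂ, y i = 0 → y j = 0 →
      MvPolynomial.eval y (MvPolynomial.aeval T.dualForm F) = 0 := fun i j hij y hi hj => by
    rw [T.eval_aeval_dualForm]
    exact (hF.2 i j hij _ (by rw [T.eval_dualForm_face, hi])
      (by rw [T.eval_dualForm_face, hj])).1
  have h1 : ∀ i j, i ≠ j → ∀ y : Fin 4 → ℂ, y i = 0 → y j = 0 → ∀ a,
      MvPolynomial.eval y (MvPolynomial.pderiv a (MvPolynomial.aeval T.dualForm F)) = 0 :=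
    fun i j hij y hi hj a => by
      rw [derivation_aeval, map_sum]
      refine Finset.sum_eq_zero fun c _ => ?_
      rw [map_mul, T.eval_aeval_dualForm]
      rw [(hF.2 i j hij _ (by rw [T.eval_dualForm_face, hi])
        (by rw [T.eval_dualForm_face, hj])).2 c, zero_mul]
  have key : ∀ i j, i ≠ j → m j = 0 → m i ≠ 0 ∧ m i ≠ 1 := by
    intro i j hij hj
    refine ⟨fun hi => hm (coeff_eq_zero_of_eval (h0 i j hij) hi hj), fun hi => ?_⟩
    have := coeff_eq_zero_of_eval (m := m - Finsupp.single i 1)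
      (fun y hi hj => h1 i j hij y hi hj i) (by simp [hi]) (by simp [hj])
    rw [MvPolynomial.coeff_pderiv] at this
    have hle : Finsupp.single i 1 ≤ m := by
      rw [Finsupp.single_le_iff]; omega
    rw [tsub_add_cancel_of_le hle] at this
    simp only [mul_eq_zero, hm, false_or] at this
    simp [hi] at this
  refine ⟨?_, fun i j hij => ?_⟩
  · have h6 : m.degree = 6 := by
      by_contra hne
      exact hm (hG.coeff_eq_zero hne)
    rwa [Finsupp.degree_eq_sum] at h6
  · by_contra hlt
    have hi := key i j hij
    have hj := key j i hij.symm
    omega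

lemma mem_span_mon {F : Poly} (hF : F ∈ sextics T) :
    F ∈ Submodule.span ℂ (Set.range fun a : exps => T.mon a) := by
  have h3 : T.coordEquiv (MvPolynomial.aeval T.dualForm F) = F := T.coordEquiv.apply_symm_apply F
  rw [← h3, MvPolynomial.as_sum (MvPolynomial.aeval T.dualForm F), map_sum]
  refine Submodule.sum_mem _ fun m hm => ?_
  have ha := mem_exps.mpr (T.isExp_of_mem_sextics hF (MvPolynomial.mem_support_iff.mp hm))
  have : T.coordEquiv (MvPolynomial.monomial m
      (MvPolynomial.coeff m (MvPolynomial.aeval T.dualForm F))) =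
      MvPolynomial.coeff m (MvPolynomial.aeval T.dualForm F) • T.mon m := by
    rw [T.mon_eq, ← map_smul, MvPolynomial.smul_monomial]
    simp
  rw [this]
  exact Submodule.smul_mem _ _ (Submodule.subset_span ⟨⟨m, ha⟩, rfl⟩)

/-- The monomial basis of the space of sextics. -/
def monBasis : Module.Basis exps ℂ (sextics T) :=
  Module.Basis.mk
    (v := fun a : exps => (⟨T.mon a, T.mon_mem_sextics (mem_exps.mp a.2)⟩ : sextics T))
    (by
      refine LinearIndependent.of_comp (sextics T).subtype ?_
      exact T.linearIndependent_mon.comp (fun a : exps => (a : Fin 4 → ℕ)) Subtype.val_injective)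
    (by
      rintro ⟨F, hF⟩ -
      have h := T.mem_span_mon hF
      rw [Submodule.mem_span_range_iff_exists_fun] at h ⊢
      obtain ⟨c, hc⟩ := h
      exact ⟨c, Subtype.ext (by simpa using hc)⟩)

@[simp] lemma coe_monBasis (a : exps) : (T.monBasis a : Poly) = T.mon a := by
  simp [monBasis]

lemma finrank_sextics : Module.finrank ℂ (sextics T) = 14 := by
  rw [Module.finrank_eq_card_basis T.monBasis, Fintype.card_coe, card_exps]

end Tetrahedron

/-! ### The ideal of the threefold -/

lemma aeval_mul_of_isHomogeneous {ι B : Type*} [CommRing B] [Algebra ℂ B] {n : ℕ}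
    {F : MvPolynomial ι ℂ} (hF : F.IsHomogeneous n) (c : B) (f : ι → B) :
    MvPolynomial.aeval (fun i => c * f i) F = c ^ n * MvPolynomial.aeval f F := by
  simp only [MvPolynomial.aeval_def, MvPolynomial.eval₂_eq, Finset.mul_sum]
  refine Finset.sum_congr rfl fun d hd => ?_
  have hdeg : ∑ i ∈ d.support, d i = n :=
    (hF.degree_eq_sum_deg_support hd).symm
  simp only [mul_pow, Finset.prod_mul_distrib, Finset.prod_pow_eq_pow_sum, hdeg]
  ring

lemma eval_smul_of_isHomogeneous {ι : Type*} {n : ℕ}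
    {F : MvPolynomial ι ℂ} (hF : F.IsHomogeneous n) (c : ℂ) (w : ι → ℂ) :
    MvPolynomial.eval (c • w) F = c ^ n * MvPolynomial.eval w F := by
  have := aeval_mul_of_isHomogeneous hF c w
  rw [MvPolynomial.aeval_eq_eval, MvPolynomial.aeval_eq_eval] at this
  exact this

section

variable {T : Tetrahedron} (b : Module.Basis (Fin 14) ℂ (sextics T))

/-- The homomorphism that substitutes the sextics `b k` for the coordinates of `P13`. -/
def substHom : MvPolynomial (Fin 14) ℂ →ₐ[ℂ] Poly := MvPolynomial.aeval fun k => (b k : Poly)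

/-- The values of the sextics `b k` at a vector. -/
def sexticVec (x : Fin 4 → ℂ) : Fin 14 → ℂ := fun k => MvPolynomial.eval x (b k : Poly)

lemma eval_substHom (x : Fin 4 → ℂ) (F : MvPolynomial (Fin 14) ℂ) :
    MvPolynomial.eval x (substHom b F) = MvPolynomial.eval (sexticVec b x) F := by
  rw [substHom, ← MvPolynomial.aeval_eq_eval, ← AlgHom.comp_apply, MvPolynomial.comp_aeval,
    MvPolynomial.aeval_eq_eval]
  rfl

lemma substHom_homogeneousComponent {F : MvPolynomial (Fin 14) ℂ} (h : substHom b F = 0) (n : ℕ) :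
    substHom b (MvPolynomial.homogeneousComponent n F) = 0 := by
  have hhom : ∀ i, (substHom b (MvPolynomial.homogeneousComponent i F)).IsHomogeneous (6 * i) :=
    fun i => (MvPolynomial.homogeneousComponent_isHomogeneous i F).aeval _ fun k => (b k).2.1
  rcases lt_or_ge F.totalDegree n with hn | hn
  · rw [MvPolynomial.homogeneousComponent_eq_zero _ _ hn, map_zero]
  · have h1 := congrArg (MvPolynomial.homogeneousComponent (6 * n)) h
    rw [← MvPolynomial.sum_homogeneousComponent F, map_sum, map_sum, map_zero,
      Finset.sum_eq_single n] at h1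
    · rwa [MvPolynomial.homogeneousComponent_of_mem
        ((MvPolynomial.mem_homogeneousSubmodule _ _).mpr (hhom n)), if_pos rfl] at h1
    · intro i _ hi
      rw [MvPolynomial.homogeneousComponent_of_mem
        ((MvPolynomial.mem_homogeneousSubmodule _ _).mpr (hhom i)), if_neg (by omega)]
    · intro hn'
      exact absurd (Finset.mem_range.mpr (by omega)) hn'

lemma eval_eq_zero_of_components {ι : Type*} {F : MvPolynomial ι ℂ} {w : ι → ℂ}
    (h : ∀ n, MvPolynomial.eval w (MvPolynomial.homogeneousComponent n F) = 0) :
    MvPolynomial.eval w F = 0 := by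
  rw [← MvPolynomial.sum_homogeneousComponent F, map_sum]
  exact Finset.sum_eq_zero fun n _ => h n

lemma eval_mk_rep {n : ℕ} {F : MvPolynomial (Fin 14) ℂ} (hF : F.IsHomogeneous n)
    {w : Fin 14 → ℂ} (hw : w ≠ 0) :
    MvPolynomial.eval (Projectivization.mk ℂ w hw).rep F = 0 ↔ MvPolynomial.eval w F = 0 := by
  obtain ⟨c, hc⟩ := Projectivization.exists_smul_eq_mk_rep ℂ w hw
  rw [← hc, Units.smul_def, eval_smul_of_isHomogeneous hF]
  simp

lemma mk_mem_threefold_iff {w : Fin 14 → ℂ} (hw : w ≠ 0) :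
    Projectivization.mk ℂ w hw ∈ threefold b ↔
      ∀ F, substHom b F = 0 → MvPolynomial.eval w F = 0 := by
  constructor
  · intro h F hF
    refine eval_eq_zero_of_components fun n => ?_
    have hn := MvPolynomial.homogeneousComponent_isHomogeneous n F
    rw [← eval_mk_rep hn hw]
    refine h n _ hn ?_
    rintro q ⟨x, hx, rfl⟩
    rw [eval_mk_rep hn]
    change MvPolynomial.eval (sexticVec b x) _ = 0
    rw [← eval_substHom, substHom_homogeneousComponent b hF, map_zero]
  · intro h n F hF hvan
    rw [eval_mk_rep hF]
    refine h F ?_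
    -- multiplication by `b 0` takes care of the points of the base locus
    have hb : substHom b F * ((b (0 : Fin 14) : sextics T) : Poly) = 0 := by
      refine MvPolynomial.funext fun x => ?_
      rw [map_mul, (MvPolynomial.eval x).map_zero, eval_substHom]
      by_cases hx : sexticVec b x = 0
      · have : MvPolynomial.eval x ((b (0 : Fin 14) : sextics T) : Poly) = 0 := congrFun hx 0
        rw [this, mul_zero]
      · have h' : MvPolynomial.eval (sexticVec b x) F = 0 :=
          (eval_mk_rep hF hx).mp (hvan _ ⟨x, hx, rfl⟩)
        rw [h', zero_mul]
    refine (mul_eq_zero.mp hb).resolve_right fun h0 => b.ne_zero 0 (Subtype.ext h0)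

lemma sexticVec_zero : sexticVec b 0 = 0 := by
  funext k
  have := eval_smul_of_isHomogeneous (b k).2.1 0 (0 : Fin 4 → ℂ)
  rw [smul_zero] at this
  simpa [sexticVec] using this

lemma eval_eq_zero_of_mem_cone {w : Fin 14 → ℂ} (hw : w ∈ affineCone (threefold b))
    {F : MvPolynomial (Fin 14) ℂ} (hF : substHom b F = 0) : MvPolynomial.eval w F = 0 := by
  by_cases h : w = 0
  · rw [h, ← sexticVec_zero b, ← eval_substHom, hF, map_zero]
  · exact (mk_mem_threefold_iff b h).mp (hw h) F hF

lemma vanishingIdeal_eq : MvPolynomial.vanishingIdeal ℂ (affineCone (threefold b)) =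
    RingHom.ker (substHom b) := by
  ext F
  rw [MvPolynomial.mem_vanishingIdeal_iff, RingHom.mem_ker]
  simp only [MvPolynomial.aeval_eq_eval]
  constructor
  · intro h
    refine MvPolynomial.funext fun x => ?_
    rw [map_zero, eval_substHom]
    refine h _ fun hx => (mk_mem_threefold_iff b hx).mpr fun G hG => ?_
    rw [← eval_substHom, hG, map_zero]
  · exact fun h w hw => eval_eq_zero_of_mem_cone b hw h

/-! ### Monomial coordinates on the ambient space -/

/-- The linear change of coordinates from the basis `b` of the space of sextics to the monomial
basis: both sides are identified with the dual of the space of sextics. -/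
def monCoord : (Fin 14 → ℂ) ≃ₗ[ℂ] (exps → ℂ) :=
  (b.constr ℂ).trans (T.monBasis.constr ℂ).symm

lemma monCoord_apply (w : Fin 14 → ℂ) (a : exps) :
    monCoord b w a = ∑ k, b.repr (T.monBasis a) k * w k := by
  simp [monCoord, Module.Basis.constr_apply_fintype]

lemma monCoord_symm_apply (z : exps → ℂ) (k : Fin 14) :
    (monCoord b).symm z k = ∑ a, T.monBasis.repr (b k) a * z a := by
  simp [monCoord, Module.Basis.constr_apply_fintype]

/-- The linear form on the ambient space that gives the monomial coordinate `a`. -/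
def monForm (a : exps) : MvPolynomial (Fin 14) ℂ :=
  ∑ k, MvPolynomial.C (b.repr (T.monBasis a) k) * MvPolynomial.X k

lemma eval_monForm (w : Fin 14 → ℂ) (a : exps) :
    MvPolynomial.eval w (monForm b a) = monCoord b w a := by
  simp [monForm, monCoord_apply]

lemma substHom_monForm (a : exps) : substHom b (monForm b a) = T.mon a := by
  have h := congrArg (Subtype.val) (b.sum_repr (T.monBasis a))
  simp only [Tetrahedron.coe_monBasis] at h
  rw [← h]
  rw [Submodule.coe_sum, substHom, monForm, map_sum]
  refine Finset.sum_congr rfl fun k _ => ?_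
  rw [map_mul, MvPolynomial.aeval_X, MvPolynomial.aeval_C, Submodule.coe_smul,
    MvPolynomial.smul_eq_C_mul, MvPolynomial.algebraMap_eq]

/-- The differential of `F` at `w`, applied to `v`. -/
def diff (F : MvPolynomial (Fin 14) ℂ) (w v : Fin 14 → ℂ) : ℂ :=
  ∑ k, MvPolynomial.eval w (MvPolynomial.pderiv k F) * v k

lemma mem_coneTangentSpace_iff {w v : Fin 14 → ℂ} :
    v ∈ coneTangentSpace (threefold b) w ↔ ∀ F, substHom b F = 0 → diff F w v = 0 := by
  simp only [coneTangentSpace, vanishingIdeal_eq, Submodule.mem_iInf, RingHom.mem_ker,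
    LinearMap.mem_ker, diff]
  simp

lemma diff_monForm (a : exps) (w v : Fin 14 → ℂ) :
    diff (monForm b a) w v = monCoord b v a := by
  rw [diff, monCoord_apply]
  refine Finset.sum_congr rfl fun k _ => ?_
  simp [monForm, MvPolynomial.pderiv_X, Pi.single_apply]

lemma diff_mul (F G : MvPolynomial (Fin 14) ℂ) (w v : Fin 14 → ℂ) :
    diff (F * G) w v = MvPolynomial.eval w F * diff G w v + MvPolynomial.eval w G * diff F w v := by
  simp only [diff, MvPolynomial.pderiv_mul, map_add, map_mul, add_mul, Finset.sum_add_distrib,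
    Finset.mul_sum]
  rw [add_comm]
  congr 1 <;> exact Finset.sum_congr rfl fun k _ => by ring

lemma diff_sub (F G : MvPolynomial (Fin 14) ℂ) (w v : Fin 14 → ℂ) :
    diff (F - G) w v = diff F w v - diff G w v := by
  simp [diff, sub_mul, Finset.sum_sub_distrib]

/-- The quadratic relations between the monomials. -/
lemma substHom_relation {a a' c c' : exps} (h : (a : Fin 4 → ℕ) + a' = c + c') :
    substHom b (monForm b a * monForm b a' - monForm b c * monForm b c') = 0 := by
  rw [map_sub, map_mul, map_mul]
  simp only [substHom_monForm, Tetrahedron.mon_mul, h, sub_self]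

lemma relation_of_mem_cone {w : Fin 14 → ℂ} (hw : w ∈ affineCone (threefold b)) {a a' c c' : exps}
    (h : (a : Fin 4 → ℕ) + a' = c + c') :
    monCoord b w a * monCoord b w a' = monCoord b w c * monCoord b w c' := by
  have := eval_eq_zero_of_mem_cone b hw (substHom_relation b h)
  rw [map_sub, map_mul, map_mul] at this
  simp only [eval_monForm] at this
  exact sub_eq_zero.mp this

lemma relation_of_mem_tangent {w v : Fin 14 → ℂ} (hv : v ∈ coneTangentSpace (threefold b) w)
    {a a' c c' : exps} (h : (a : Fin 4 → ℕ) + a' = c + c') :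
    monCoord b w a * monCoord b v a' + monCoord b w a' * monCoord b v a =
      monCoord b w c * monCoord b v c' + monCoord b w c' * monCoord b v c := by
  have := (mem_coneTangentSpace_iff b).mp hv _ (substHom_relation b h)
  rw [diff_sub, diff_mul, diff_mul] at this
  simp only [eval_monForm, diff_monForm] at this
  exact sub_eq_zero.mp this

/-! ### The parametrization by a product of three lines -/

/-- The parametrization of the cone by three copies of the plane: `S² / s_i²`, `s_i² S` and
`s_i s_j S` correspond to the forms of multidegree `(2, 2, 2)` that are invariant under the
simultaneous change of signs of `t 1`, `t 3` and `t 5`. -/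
def segre {B : Type*} [CommSemiring B] (σ : Equiv.Perm (Fin 4)) (t : Fin 6 → B)
    (a : Fin 4 → ℕ) : B :=
  t 0 ^ (a (σ 0) + a (σ 1) - 2) * t 1 ^ (a (σ 2) + a (σ 3) - 2) *
  (t 2 ^ (a (σ 0) + a (σ 2) - 2) * t 3 ^ (a (σ 1) + a (σ 3) - 2)) *
  (t 4 ^ (a (σ 0) + a (σ 3) - 2) * t 5 ^ (a (σ 1) + a (σ 2) - 2))

/-- The values of the equations of the faces at the point with parameters `t`. -/
def segreFace {B : Type*} [CommSemiring B] (t : Fin 6 → B) : Fin 4 → B :=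
  ![t 0 * t 2 * t 4, t 0 * t 3 * t 5, t 1 * t 2 * t 5, t 1 * t 3 * t 4]

lemma prod_segreFace {B : Type*} [CommSemiring B] (σ : Equiv.Perm (Fin 4)) (t : Fin 6 → B)
    {a : Fin 4 → ℕ} (ha : IsExp a) :
    ∏ i, segreFace t (σ.symm i) ^ a i =
      (t 0 * t 1 * t 2 * t 3 * t 4 * t 5) ^ 2 * segre σ t a := by
  have h : ∀ i j, i ≠ j → ∃ n, a (σ i) + a (σ j) = n + 2 := fun i j hij =>
    ⟨a (σ i) + a (σ j) - 2, by have := ha.2 (σ i) (σ j) (by simpa using hij); omega⟩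
  obtain ⟨n01, h01⟩ := h 0 1 (by decide)
  obtain ⟨n02, h02⟩ := h 0 2 (by decide)
  obtain ⟨n03, h03⟩ := h 0 3 (by decide)
  obtain ⟨n12, h12⟩ := h 1 2 (by decide)
  obtain ⟨n13, h13⟩ := h 1 3 (by decide)
  obtain ⟨n23, h23⟩ := h 2 3 (by decide)
  rw [← Equiv.prod_comp σ]
  simp only [Equiv.symm_apply_apply, Fin.prod_univ_four, segreFace, segre]
  simp only [Matrix.cons_val]
  calc _ = t 0 ^ (a (σ 0) + a (σ 1)) * t 1 ^ (a (σ 2) + a (σ 3)) *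
      (t 2 ^ (a (σ 0) + a (σ 2)) * t 3 ^ (a (σ 1) + a (σ 3))) *
      (t 4 ^ (a (σ 0) + a (σ 3)) * t 5 ^ (a (σ 1) + a (σ 2))) := by ring
    _ = _ := by
      rw [h01, h02, h03, h12, h13, h23]
      simp only [Nat.add_sub_cancel]
      ring

/-- The points of the parametrization satisfy the equations of the cone: for a generic point they
are, up to the nonzero factor of `prod_segreFace`, values of the sextics. -/
lemma eval_segre (σ : Equiv.Perm (Fin 4)) (t : Fin 6 → ℂ) {F : MvPolynomial (Fin 14) ℂ}
    (hF : substHom b F = 0) :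
    MvPolynomial.eval ((monCoord b).symm fun a => segre σ t a) F = 0 := by
  refine eval_eq_zero_of_components fun n => ?_
  have hFn := substHom_homogeneousComponent b hF n
  have hn := MvPolynomial.homogeneousComponent_isHomogeneous n F
  generalize MvPolynomial.homogeneousComponent n F = G at hFn hn ⊢
  let x : Fin 6 → MvPolynomial (Fin 6) ℂ := MvPolynomial.X
  let θ : Poly →ₐ[ℂ] MvPolynomial (Fin 6) ℂ :=
    (MvPolynomial.aeval fun i => segreFace x (σ.symm i)).comp (MvPolynomial.aeval T.dualForm)
  let P : MvPolynomial (Fin 6) ℂ := (x 0 * x 1 * x 2 * x 3 * x 4 * x 5) ^ 2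
  have hP : P ≠ 0 := by
    simp only [P, x]
    simp [MvPolynomial.X_ne_zero]
  have hmon : ∀ a : exps, θ (T.mon a) = P * segre σ x a := fun a => by
    rw [← prod_segreFace σ x (mem_exps.mp a.2), Tetrahedron.mon, map_prod]
    refine Finset.prod_congr rfl fun i _ => ?_
    rw [map_pow, AlgHom.comp_apply, T.aeval_face, MvPolynomial.aeval_X]
  have hb : ∀ k, θ (b k : Poly) = P * ∑ a : exps, T.monBasis.repr (b k) a • segre σ x a := by
    intro k
    have h := congrArg Subtype.val (T.monBasis.sum_repr (b k))
    rw [← h]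
    simp only [Submodule.coe_sum, Submodule.coe_smul, Tetrahedron.coe_monBasis, map_sum, map_smul,
      hmon, Finset.mul_sum, mul_smul_comm]
  have h0 : P ^ n * MvPolynomial.aeval
      (fun k => ∑ a : exps, T.monBasis.repr (b k) a • segre σ x a) G = 0 := by
    rw [← aeval_mul_of_isHomogeneous hn]
    simp only [← hb]
    have := congrArg θ hFn
    rw [map_zero, substHom, ← AlgHom.comp_apply, MvPolynomial.comp_aeval] at this
    exact this
  have h1 := (mul_eq_zero.mp h0).resolve_left (pow_ne_zero n hP)
  have h2 := congrArg (MvPolynomial.aeval t : MvPolynomial (Fin 6) ℂ →ₐ[ℂ] ℂ) h1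
  rw [map_zero, ← AlgHom.comp_apply, MvPolynomial.comp_aeval, MvPolynomial.aeval_eq_eval] at h2
  convert h2 using 3
  funext k
  rw [monCoord_symm_apply, map_sum]
  refine Finset.sum_congr rfl fun a _ => ?_
  simp [segre, x]

lemma mk_segre_mem (σ : Equiv.Perm (Fin 4)) (t : Fin 6 → ℂ) {w : Fin 14 → ℂ} (hw : w ≠ 0)
    (h : ∀ a, monCoord b w a = segre σ t a) : Projectivization.mk ℂ w hw ∈ threefold b := by
  refine (mk_mem_threefold_iff b hw).mpr fun F hF => ?_
  have e : w = (monCoord b).symm fun a => segre σ t a := by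
    rw [LinearEquiv.eq_symm_apply]; exact funext h
  rw [e]
  exact eval_segre b σ t hF

/-- The velocity of a polynomial curve in the cone is a tangent vector. -/
lemma velocity_mem_tangent (z : exps → Polynomial ℂ)
    (h : ∀ τ : ℂ, ∃ σ t, ∀ a : exps, (z a).eval τ = segre σ t a) {w v : Fin 14 → ℂ}
    (hw : ∀ a, monCoord b w a = (z a).eval 0)
    (hv : ∀ a, monCoord b v a = (Polynomial.derivative (z a)).eval 0) :
    v ∈ coneTangentSpace (threefold b) w := by
  refine (mem_coneTangentSpace_iff b).mpr fun F hF => ?_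
  let γ : Fin 14 → Polynomial ℂ := fun k => ∑ a, T.monBasis.repr (b k) a • z a
  have hγ : ∀ τ, (fun k => (γ k).eval τ) = (monCoord b).symm fun a => (z a).eval τ := by
    intro τ
    funext k
    rw [monCoord_symm_apply]
    simp [γ, Polynomial.eval_finsetSum]
  have heval : ∀ (G : MvPolynomial (Fin 14) ℂ) (τ : ℂ),
      (MvPolynomial.aeval γ G).eval τ = MvPolynomial.eval (fun k => (γ k).eval τ) G := by
    intro G τ
    have := (MvPolynomial.comp_aeval (R := ℂ) γ (Polynomial.aeval τ : Polynomial ℂ →ₐ[ℂ] ℂ))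
    have := DFunLike.congr_fun this G
    simpa [Polynomial.aeval_def, Polynomial.coe_aeval_eq_eval,
      MvPolynomial.aeval_eq_eval] using this
  have h0 : MvPolynomial.aeval γ F = 0 := by
    refine Polynomial.funext fun τ => ?_
    obtain ⟨σ, t, ht⟩ := h τ
    rw [heval, hγ, Polynomial.eval_zero]
    simp only [ht]
    exact eval_segre b σ t hF
  have h1 := derivation_aeval (Polynomial.derivative' (R := ℂ)) γ F
  rw [h0, map_zero] at h1
  have h2 := congrArg (Polynomial.eval 0) h1
  rw [Polynomial.eval_zero, Polynomial.eval_finsetSum] at h2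
  have ew : w = fun k => (γ k).eval 0 := by
    rw [hγ, LinearEquiv.eq_symm_apply]; exact funext hw
  have ev : v = fun k => (Polynomial.derivative (γ k)).eval 0 := by
    have : v = (monCoord b).symm fun a => (Polynomial.derivative (z a)).eval 0 := by
      rw [LinearEquiv.eq_symm_apply]; exact funext hv
    rw [this]
    funext k
    rw [monCoord_symm_apply]
    simp [γ, Polynomial.eval_finsetSum]
  rw [diff, ew, ev]
  refine Eq.trans ?_ h2.symm
  refine Finset.sum_congr rfl fun k _ => ?_
  rw [Polynomial.eval_mul, heval]
  rfl

end

/-! ### Solutions of the quadratic relations -/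

/-- The exponent of `s_i² S`, where `S = s₀ s₁ s₂ s₃`. -/
def expA (i : Fin 4) : exps := ⟨fun k => if k = i then 3 else 1, by revert i; decide⟩

/-- The exponent of `S² / s_j²`. -/
def expB (j : Fin 4) : exps := ⟨fun k => if k = j then 0 else 2, by revert j; decide⟩

/-- The exponent of `s_i s_j S`. -/
def expC (i j : Fin 4) : exps :=
  ⟨fun k => (if k = i then 1 else 0) + (if k = j then 1 else 0) + 1, by revert i j; decide⟩

/-- The action of a permutation of the faces on the exponents. -/
def permExp (σ : Equiv.Perm (Fin 4)) : exps ≃ exps :=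
  (Equiv.arrowCongr σ (Equiv.refl ℕ)).subtypeEquiv fun a => by
    rw [mem_exps, mem_exps, IsExp, IsExp]
    refine and_congr ?_ ⟨fun h i j hij => ?_, fun h i j hij => ?_⟩
    · simp [Equiv.sum_comp σ.symm a]
    · exact h _ _ (by simpa using hij)
    · simpa using h (σ i) (σ j) (by simpa using hij)

lemma permExp_apply (σ : Equiv.Perm (Fin 4)) (a : exps) (k : Fin 4) :
    (permExp σ a : Fin 4 → ℕ) (σ k) = (a : Fin 4 → ℕ) k := by
  simp [permExp]

lemma permExp_expA (σ : Equiv.Perm (Fin 4)) (i : Fin 4) :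
    permExp σ (expA i) = expA (σ i) := by
  refine Subtype.ext (funext fun k => ?_)
  obtain ⟨m, rfl⟩ := σ.surjective k
  rw [permExp_apply]
  simp [expA]

lemma permExp_expB (σ : Equiv.Perm (Fin 4)) (i : Fin 4) :
    permExp σ (expB i) = expB (σ i) := by
  refine Subtype.ext (funext fun k => ?_)
  obtain ⟨m, rfl⟩ := σ.surjective k
  rw [permExp_apply]
  simp [expB]

lemma permExp_add (σ : Equiv.Perm (Fin 4)) {a a' c c' : exps}
    (h : (a : Fin 4 → ℕ) + a' = c + c') :
    (permExp σ a : Fin 4 → ℕ) + permExp σ a' = permExp σ c + permExp σ c' := by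
  funext k
  obtain ⟨m, rfl⟩ := σ.surjective k
  simp only [Pi.add_apply, permExp_apply]
  exact congrFun h m

lemma exps_cases (a : exps) : (∃ i, a = expA i) ∨ (∃ j, a = expB j) ∨
    a = expC 0 1 ∨ a = expC 0 2 ∨ a = expC 0 3 ∨ a = expC 1 2 ∨ a = expC 1 3 ∨ a = expC 2 3 := by
  revert a
  decide

/-- The quadratic relations between the monomials hold for the vector `z`. -/
def Related (z : exps → ℂ) : Prop :=
  ∀ a a' c c' : exps, (a : Fin 4 → ℕ) + a' = c + c' → z a * z a' = z c * z c'

/-- The differentials at `z` of the quadratic relations vanish on the vector `v`. -/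
def TangentRelated (z v : exps → ℂ) : Prop :=
  ∀ a a' c c' : exps, (a : Fin 4 → ℕ) + a' = c + c' →
    z a * v a' + z a' * v a = z c * v c' + z c' * v c

/-- Where the coordinates of `s₀² S` and `S² / s₁²` do not vanish, a tangent vector is determined by
four of its coordinates. -/
lemma TangentRelated.eq_zero {z v : exps → ℂ} (h : TangentRelated z v)
    (hA : z (expA 0) ≠ 0) (hB : z (expB 1) ≠ 0) (h0 : v (expA 0) = 0) (h1 : v (expB 1) = 0)
    (h2 : v (expC 0 2) = 0) (h3 : v (expC 0 3) = 0) : v = 0 := by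
  have solveA : ∀ a c c' : exps, (a : Fin 4 → ℕ) + expA 0 = c + c' → v c = 0 → v c' = 0 →
      v a = 0 := fun a c c' e hc hc' => by
    have := h _ _ _ _ e
    rw [h0, hc, hc'] at this
    simpa [hA] using this
  have solveB : ∀ a c c' : exps, (a : Fin 4 → ℕ) + expB 1 = c + c' → v c = 0 → v c' = 0 →
      v a = 0 := fun a c c' e hc hc' => by
    have := h _ _ _ _ e
    rw [h1, hc, hc'] at this
    simpa [hB] using this
  -- each of the following relations involves at most one coordinate that is not yet known to vanish
  have hA2 := solveA (expA 2) (expC 0 2) (expC 0 2) (by decide) h2 h2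
  have hA3 := solveA (expA 3) (expC 0 3) (expC 0 3) (by decide) h3 h3
  have hB3 := solveB (expB 3) (expC 0 2) (expC 0 2) (by decide) h2 h2
  have hB2 := solveB (expB 2) (expC 0 3) (expC 0 3) (by decide) h3 h3
  have hC23 := solveA (expC 2 3) (expC 0 2) (expC 0 3) (by decide) h2 h3
  have hC01 := solveB (expC 0 1) (expC 0 2) (expC 0 3) (by decide) h2 h3
  have hA1 := solveA (expA 1) (expC 0 1) (expC 0 1) (by decide) hC01 hC01
  have hB0 := solveB (expB 0) (expC 2 3) (expC 2 3) (by decide) hC23 hC23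
  have hC12 := solveA (expC 1 2) (expC 0 1) (expC 0 2) (by decide) hC01 h2
  have hC13 := solveA (expC 1 3) (expC 0 1) (expC 0 3) (by decide) hC01 h3
  funext a
  rcases exps_cases a with ⟨i, rfl⟩ | ⟨j, rfl⟩ | rfl | rfl | rfl | rfl | rfl | rfl
  · fin_cases i <;> assumption
  · fin_cases j <;> assumption
  all_goals assumption

/-- If the exponent `c` is the midpoint of `e` and `f`, and the coordinate at `e` or at `f`
vanishes, then so does the coordinate at `c`. -/
lemma Related.mid {z : exps → ℂ} (h : Related z) {c e f : exps} (hsum : (c : Fin 4 → ℕ) + c = e + f)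
    (h0 : z e = 0 ∨ z f = 0) : z c = 0 := by
  have := h _ _ _ _ hsum
  rw [mul_eq_zero.mpr h0] at this
  exact mul_self_eq_zero.mp this

lemma Related.eq_zero_of_left {z : exps → ℂ} (h : Related z) {a a' c c' : exps}
    (ha : z a ≠ 0) (hsum : (a : Fin 4 → ℕ) + a' = c + c') (h0 : z c = 0) : z a' = 0 := by
  have := h _ _ _ _ hsum
  rw [h0, zero_mul] at this
  exact (mul_eq_zero.mp this).resolve_left ha

lemma Related.eq_single_expA {z : exps → ℂ} (h : Related z) (h0 : z (expA 0) ≠ 0)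
    (hB : ∀ j, j ≠ 0 → z (expB j) = 0) : z = Pi.single (expA 0) (z (expA 0)) := by
  have hB1 := hB 1 (by decide)
  have hB2 := hB 2 (by decide)
  have hB3 := hB 3 (by decide)
  have hC01 : z (expC 0 1) = 0 := h.mid (e := expB 2) (f := expB 3) (by decide) (Or.inl hB2)
  have hC02 : z (expC 0 2) = 0 := h.mid (e := expB 1) (f := expB 3) (by decide) (Or.inl hB1)
  have hC03 : z (expC 0 3) = 0 := h.mid (e := expB 1) (f := expB 2) (by decide) (Or.inl hB1)
  have hC12 : z (expC 1 2) = 0 := h.mid (e := expB 3) (f := expB 0) (by decide) (Or.inl hB3)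
  have hC13 : z (expC 1 3) = 0 := h.mid (e := expB 2) (f := expB 0) (by decide) (Or.inl hB2)
  have hC23 : z (expC 2 3) = 0 := h.mid (e := expB 1) (f := expB 0) (by decide) (Or.inl hB1)
  have hA1 : z (expA 1) = 0 := h.eq_zero_of_left h0 (c' := expC 0 1) (by decide) hC01
  have hA2 : z (expA 2) = 0 := h.eq_zero_of_left h0 (c' := expC 0 2) (by decide) hC02
  have hA3 : z (expA 3) = 0 := h.eq_zero_of_left h0 (c' := expC 0 3) (by decide) hC03
  have hB0 : z (expB 0) = 0 := h.eq_zero_of_left h0 (c' := expC 2 3) (by decide) hC01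
  funext a
  by_cases ha : a = expA 0
  · rw [ha, Pi.single_eq_same]
  rw [Pi.single_eq_of_ne ha]
  rcases exps_cases a with ⟨i, rfl⟩ | ⟨j, rfl⟩ | rfl | rfl | rfl | rfl | rfl | rfl
  · fin_cases i <;> first | assumption | exact absurd rfl ha
  · fin_cases j <;> assumption
  all_goals assumption

lemma Related.eq_single_expB {z : exps → ℂ} (h : Related z) (h0 : z (expB 1) ≠ 0)
    (hA : ∀ i, i ≠ 1 → z (expA i) = 0) : z = Pi.single (expB 1) (z (expB 1)) := by
  have hA0 := hA 0 (by decide)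
  have hA2 := hA 2 (by decide)
  have hA3 := hA 3 (by decide)
  have hC01 : z (expC 0 1) = 0 := h.mid (e := expA 0) (f := expA 1) (by decide) (Or.inl hA0)
  have hC02 : z (expC 0 2) = 0 := h.mid (e := expA 0) (f := expA 2) (by decide) (Or.inl hA0)
  have hC03 : z (expC 0 3) = 0 := h.mid (e := expA 0) (f := expA 3) (by decide) (Or.inl hA0)
  have hC12 : z (expC 1 2) = 0 := h.mid (e := expA 2) (f := expA 1) (by decide) (Or.inl hA2)
  have hC13 : z (expC 1 3) = 0 := h.mid (e := expA 3) (f := expA 1) (by decide) (Or.inl hA3)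
  have hC23 : z (expC 2 3) = 0 := h.mid (e := expA 2) (f := expA 3) (by decide) (Or.inl hA2)
  have hA1 : z (expA 1) = 0 := 
    h.eq_zero_of_left h0 (c' := expC 2 3) (c := expC 0 1) (by decide) hC01
  have hB0 : z (expB 0) = 0 := h.eq_zero_of_left h0 (c' := expC 2 3) (by decide) hC23
  have hB2 : z (expB 2) = 0 := h.eq_zero_of_left h0 (c' := expC 0 3) (by decide) hC03
  have hB3 : z (expB 3) = 0 := h.eq_zero_of_left h0 (c' := expC 0 2) (by decide) hC02
  funext a
  by_cases ha : a = expB 1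
  · rw [ha, Pi.single_eq_same]
  rw [Pi.single_eq_of_ne ha]
  rcases exps_cases a with ⟨i, rfl⟩ | ⟨j, rfl⟩ | rfl | rfl | rfl | rfl | rfl | rfl
  · fin_cases i <;> assumption
  · fin_cases j <;> first | assumption | exact absurd rfl ha
  all_goals assumption

lemma Related.comp_permExp {z : exps → ℂ} (h : Related z) (σ : Equiv.Perm (Fin 4)) :
    Related (z ∘ permExp σ) :=
  fun _ _ _ _ e => h _ _ _ _ (permExp_add σ e)

lemma TangentRelated.comp_permExp {z v : exps → ℂ} (h : TangentRelated z v)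
    (σ : Equiv.Perm (Fin 4)) : TangentRelated (z ∘ permExp σ) (v ∘ permExp σ) :=
  fun _ _ _ _ e => h _ _ _ _ (permExp_add σ e)

/-- A nonzero solution of the quadratic relations is a coordinate vector of an `expA i` or an
`expB j`, or it has nonzero coordinates at `expA i` and `expB j` for some `i ≠ j`. -/
lemma Related.trichotomy {z : exps → ℂ} (h : Related z) (hz : z ≠ 0) :
    (∃ i c, z = Pi.single (expA i) c) ∨ (∃ j c, z = Pi.single (expB j) c) ∨
      ∃ i j, i ≠ j ∧ z (expA i) ≠ 0 ∧ z (expB j) ≠ 0 := by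
  by_cases hAB : ∃ i j, i ≠ j ∧ z (expA i) ≠ 0 ∧ z (expB j) ≠ 0
  · exact Or.inr (Or.inr hAB)
  push Not at hAB
  have hsingle : ∀ (σ : Equiv.Perm (Fin 4)) (e : exps) (c : ℂ),
      z ∘ permExp σ = Pi.single e c → z = Pi.single (permExp σ e) c := by
    intro σ e c hc
    funext a
    obtain ⟨a, rfl⟩ := (permExp σ).surjective a
    have := congrFun hc a
    simpa [Pi.single_apply] using this
  by_cases hA : ∃ i, z (expA i) ≠ 0
  · obtain ⟨i, hi⟩ := hA
    refine Or.inl ⟨i, z (expA i), ?_⟩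
    have := hsingle (Equiv.swap 0 i) _ _ ((h.comp_permExp (Equiv.swap 0 i)).eq_single_expA
      (by simpa [permExp_expA] using hi) fun j hj => by
        simp only [Function.comp_apply, permExp_expB]
        refine hAB i _ (fun e => hj ?_) hi
        exact (Equiv.swap 0 i).injective (by rw [← e]; simp))
    simpa [permExp_expA] using this
  · push Not at hA
    by_cases hB : ∃ j, z (expB j) ≠ 0
    · obtain ⟨j, hj⟩ := hB
      refine Or.inr (Or.inl ⟨j, z (expB j), ?_⟩)
      have := hsingle (Equiv.swap 1 j) _ _ ((h.comp_permExp (Equiv.swap 1 j)).eq_single_expB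
        (by simpa [permExp_expB] using hj) fun i _ => by
        simpa [permExp_expA] using hA _)
      simpa [permExp_expB] using this
    · push Not at hB
      refine absurd (funext fun a => ?_) hz
      rcases exps_cases a with ⟨i, rfl⟩ | ⟨j, rfl⟩ | rfl | rfl | rfl | rfl | rfl | rfl
      · exact hA i
      · exact hB j
      · exact h.mid (e := expA 0) (f := expA 1) (by decide) (Or.inl (hA _))
      · exact h.mid (e := expA 0) (f := expA 2) (by decide) (Or.inl (hA _))
      · exact h.mid (e := expA 0) (f := expA 3) (by decide) (Or.inl (hA _))
      · exact h.mid (e := expA 1) (f := expA 2) (by decide) (Or.inl (hA _))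
      · exact h.mid (e := expA 1) (f := expA 3) (by decide) (Or.inl (hA _))
      · exact h.mid (e := expA 2) (f := expA 3) (by decide) (Or.inl (hA _))

/-! ### Tangent spaces of the cone -/

section

variable {T : Tetrahedron} (b : Module.Basis (Fin 14) ℂ (sextics T))

lemma exists_perm_of_ne {i j : Fin 4} (h : i ≠ j) :
    ∃ σ : Equiv.Perm (Fin 4), σ 0 = i ∧ σ 1 = j := by
  revert i j
  decide

/-- The cone is smooth where the coordinates of `s_i² S` and `S² / s_j²` do not vanish. -/
lemma finrank_coneTangentSpace_le {w : Fin 14 → ℂ} {i j : Fin 4} (hij : i ≠ j)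
    (hA : monCoord b w (expA i) ≠ 0) (hB : monCoord b w (expB j) ≠ 0) :
    Module.finrank ℂ (coneTangentSpace (threefold b) w) ≤ 4 := by
  obtain ⟨σ, rfl, rfl⟩ := exists_perm_of_ne hij
  let e : Fin 4 → exps := ![expA 0, expB 1, expC 0 2, expC 0 3]
  let φ : coneTangentSpace (threefold b) w →ₗ[ℂ] (Fin 4 → ℂ) :=
    (LinearMap.funLeft ℂ ℂ fun k => permExp σ (e k)) ∘ₗ (monCoord b).toLinearMap ∘ₗ
      (coneTangentSpace (threefold b) w).subtype
  have hφ : Function.Injective φ := by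
    rw [injective_iff_map_eq_zero]
    rintro ⟨v, hv⟩ h0
    have hk : ∀ k, monCoord b v (permExp σ (e k)) = 0 := fun k => congrFun h0 k
    have hT : TangentRelated (monCoord b w) (monCoord b v) :=
      fun _ _ _ _ h => relation_of_mem_tangent b hv h
    have h1 := (hT.comp_permExp σ).eq_zero (by simpa [permExp_expA] using hA)
      (by simpa [permExp_expB] using hB) (hk 0) (hk 1) (hk 2) (hk 3)
    have h2 : monCoord b v = 0 := by
      funext a
      obtain ⟨a, rfl⟩ := (permExp σ).surjective a
      exact congrFun h1 a
    exact Subtype.ext ((LinearEquiv.map_eq_zero_iff _).mp h2)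
  simpa using LinearMap.finrank_le_finrank_of_injective hφ

/-- The curves `τ ↦ c τ^n α^p β^q γ^r` in the cone, where `n`, `p`, `q`, `r` are functions of the
exponent, have enough velocities at a point to span five dimensions. -/
lemma five_le_finrank_of_curves {w : Fin 14 → ℂ} {c : ℂ} (hc : c ≠ 0) {a₀ : exps}
    (hw : monCoord b w = Pi.single a₀ c) (n p q r : exps → ℕ)
    (hcurve : ∀ α β γ τ : ℂ, ∃ σ t, ∀ a : exps,
      c * τ ^ n a * (α ^ p a * β ^ q a * γ ^ r a) = segre σ t a)
    (hn : ∀ a, n a = 0 ↔ a = a₀) (hp : p a₀ = 0) (hq : q a₀ = 0) (hr : r a₀ = 0)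
    (e : Fin 5 → exps) (hne : ∀ k, n (e k) = 1) (hpe : ∀ k, p (e k) = ![2, 0, 0, 1, 0] k)
    (hqe : ∀ k, q (e k) = ![0, 2, 0, 1, 1] k) (hre : ∀ k, r (e k) = ![0, 0, 2, 0, 1] k) :
    5 ≤ Module.finrank ℂ (coneTangentSpace (threefold b) w) := by
  let V : ℂ → ℂ → ℂ → exps → ℂ := fun α β γ a =>
    (Polynomial.derivative (Polynomial.C (c * (α ^ p a * β ^ q a * γ ^ r a)) *
      Polynomial.X ^ n a)).eval 0
  have hV : ∀ α β γ, (monCoord b).symm (V α β γ) ∈ coneTangentSpace (threefold b) w := by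
    intro α β γ
    refine velocity_mem_tangent b (fun a => Polynomial.C (c * (α ^ p a * β ^ q a * γ ^ r a)) *
      Polynomial.X ^ n a) (fun τ => ?_) (fun a => ?_) (fun a => ?_)
    · obtain ⟨σ, t, h⟩ := hcurve α β γ τ
      refine ⟨σ, t, fun a => ?_⟩
      rw [← h a]
      simp only [Polynomial.eval_mul, Polynomial.eval_C, Polynomial.eval_pow, Polynomial.eval_X]
      ring
    · rw [hw]
      by_cases ha : a = a₀
      · rw [ha, (hn a₀).mpr rfl, hp, hq, hr]
        simp
      · have := mt (hn a).mp ha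
        simp [ha, this]
    · rw [LinearEquiv.apply_symm_apply]
  have hVe : ∀ α β γ k, V α β γ (e k) =
      c * (α ^ (![2, 0, 0, 1, 0] k) * β ^ (![0, 2, 0, 1, 1] k) * γ ^ (![0, 0, 2, 0, 1] k)) := by
    intro α β γ k
    simp only [V, hne, hpe, hqe, hre]
    simp
  let φ : coneTangentSpace (threefold b) w →ₗ[ℂ] (Fin 5 → ℂ) :=
    (LinearMap.funLeft ℂ ℂ e) ∘ₗ (monCoord b).toLinearMap ∘ₗ
      (coneTangentSpace (threefold b) w).subtype
  have hφV : ∀ α β γ, φ ⟨_, hV α β γ⟩ = fun k => V α β γ (e k) := by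
    intro α β γ
    funext k
    simp [φ, LinearMap.funLeft_apply]
  have hφ : Function.Surjective φ := by
    intro y
    refine ⟨c⁻¹ • ((y 0 - y 3) • ⟨_, hV 1 0 0⟩ + (y 1 - y 3 - y 4) • ⟨_, hV 0 1 0⟩ +
      (y 2 - y 4) • ⟨_, hV 0 0 1⟩ + y 3 • ⟨_, hV 1 1 0⟩ + y 4 • ⟨_, hV 0 1 1⟩), ?_⟩
    simp only [map_smul, map_add, hφV]
    funext k
    simp only [Pi.smul_apply, Pi.add_apply, hVe, smul_eq_mul]
    rw [inv_mul_eq_iff_eq_mul₀ hc]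
    fin_cases k <;> simp <;> ring
  have := LinearMap.finrank_le_finrank_of_surjective hφ
  simpa using this

/-- At the point of `s_i² S`, the parameter `τ` enters a monomial to the power `3 - a_i`. -/
lemma five_le_finrank_expA {w : Fin 14 → ℂ} {c : ℂ} (hc : c ≠ 0) (i : Fin 4)
    (hw : monCoord b w = Pi.single (expA i) c) :
    5 ≤ Module.finrank ℂ (coneTangentSpace (threefold b) w) := by
  obtain ⟨σ, rfl⟩ := Tetrahedron.exists_perm i
  let a' : exps → Fin 4 → ℕ := fun a => ((permExp σ).symm a : exps)
  refine five_le_finrank_of_curves b hc hw (fun a => 3 - a' a 0) (fun a => a' a 2 + a' a 3 - 2)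
    (fun a => a' a 1 + a' a 3 - 2) (fun a => a' a 1 + a' a 2 - 2) ?_ ?_ ?_ ?_ ?_
    (fun k => permExp σ (![expB 1, expB 2, expB 3, expC 0 3, expC 0 1] k)) ?_ ?_ ?_ ?_
  · intro α β γ τ
    obtain ⟨ρ, rfl⟩ := IsAlgClosed.exists_pow_nat_eq c two_pos
    obtain ⟨s, rfl⟩ := IsAlgClosed.exists_pow_nat_eq τ two_pos
    -- on each of the three lines the parameter is proportional to the square root `s` of `τ`
    refine ⟨σ, ![ρ, ρ * s * α, 1, s * β, 1, s * γ], fun a => ?_⟩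
    obtain ⟨a, rfl⟩ := (permExp σ).surjective a
    simp only [a', segre, permExp_apply, Equiv.symm_apply_apply, Matrix.cons_val]
    have h1 : ∀ a : exps, (a : Fin 4 → ℕ) 0 + (a : Fin 4 → ℕ) 1 - 2 +
      ((a : Fin 4 → ℕ) 2 + (a : Fin 4 → ℕ) 3 - 2) = 2 := by decide
    have h2 : ∀ a : exps, ((a : Fin 4 → ℕ) 2 + (a : Fin 4 → ℕ) 3 - 2) +
      ((a : Fin 4 → ℕ) 1 + (a : Fin 4 → ℕ) 3 - 2) + ((a : Fin 4 → ℕ) 1 + (a : Fin 4 → ℕ) 2 - 2) =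
      2 * (3 - (a : Fin 4 → ℕ) 0) := by decide
    have h3 := congrArg (ρ ^ ·) (h1 a)
    rw [← pow_mul, ← h2 a, ← h3]
    ring
  · intro a
    obtain ⟨a, rfl⟩ := (permExp σ).surjective a
    rw [← permExp_expA, (permExp σ).injective.eq_iff]
    simp only [a', Equiv.symm_apply_apply]
    revert a
    decide
  all_goals simp only [a', ← permExp_expA, Equiv.symm_apply_apply]; decide

/-- At the point of `S² / s_j²`, the parameter `τ` enters a monomial to the power `a_j`. -/
lemma five_le_finrank_expB {w : Fin 14 → ℂ} {c : ℂ} (hc : c ≠ 0) (j : Fin 4)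
    (hw : monCoord b w = Pi.single (expB j) c) :
    5 ≤ Module.finrank ℂ (coneTangentSpace (threefold b) w) := by
  obtain ⟨σ, rfl⟩ := Tetrahedron.exists_perm j
  let a' : exps → Fin 4 → ℕ := fun a => ((permExp σ).symm a : exps)
  refine five_le_finrank_of_curves b hc hw (fun a => a' a 0) (fun a => a' a 0 + a' a 1 - 2)
    (fun a => a' a 0 + a' a 2 - 2) (fun a => a' a 0 + a' a 3 - 2) ?_ ?_ ?_ ?_ ?_
    (fun k => permExp σ (![expA 1, expA 2, expA 3, expC 1 2, expC 2 3] k)) ?_ ?_ ?_ ?_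
  · intro α β γ τ
    obtain ⟨ρ, rfl⟩ := IsAlgClosed.exists_pow_nat_eq c two_pos
    obtain ⟨s, rfl⟩ := IsAlgClosed.exists_pow_nat_eq τ two_pos
    refine ⟨σ, ![ρ * s * α, ρ, s * β, 1, s * γ, 1], fun a => ?_⟩
    obtain ⟨a, rfl⟩ := (permExp σ).surjective a
    simp only [a', segre, permExp_apply, Equiv.symm_apply_apply, Matrix.cons_val]
    have h1 : ∀ a : exps, (a : Fin 4 → ℕ) 0 + (a : Fin 4 → ℕ) 1 - 2 +
      ((a : Fin 4 → ℕ) 2 + (a : Fin 4 → ℕ) 3 - 2) = 2 := by decide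
    have h2 : ∀ a : exps, ((a : Fin 4 → ℕ) 0 + (a : Fin 4 → ℕ) 1 - 2) +
      ((a : Fin 4 → ℕ) 0 + (a : Fin 4 → ℕ) 2 - 2) + ((a : Fin 4 → ℕ) 0 + (a : Fin 4 → ℕ) 3 - 2) =
      2 * (a : Fin 4 → ℕ) 0 := by decide
    have h3 := congrArg (ρ ^ ·) (h1 a)
    rw [← pow_mul, ← h2 a, ← h3]
    ring
  · intro a
    obtain ⟨a, rfl⟩ := (permExp σ).surjective a
    rw [← permExp_expB, (permExp σ).injective.eq_iff]
    simp only [a', Equiv.symm_apply_apply]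
    revert a
    decide
  all_goals simp only [a', ← permExp_expB, Equiv.symm_apply_apply]; decide

/-! ### The eight points and the twelve lines -/

/-- The point whose only nonzero monomial coordinate is the one with exponent `a`. -/
def vertexPt (a : exps) : P13 :=
  Projectivization.mk ℂ ((monCoord b).symm (Pi.single a 1)) (by simp)

lemma vertexPt_submodule (a : exps) : (vertexPt b a).submodule =
    Submodule.span ℂ {(monCoord b).symm (Pi.single a 1)} :=
  Projectivization.submodule_mk _ _

lemma mk_eq_vertexPt {w : Fin 14 → ℂ} (hw : w ≠ 0) {a : exps} {c : ℂ}
    (h : monCoord b w = Pi.single a c) : Projectivization.mk ℂ w hw = vertexPt b a := by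
  rw [vertexPt, Projectivization.mk_eq_mk_iff']
  refine ⟨c, ?_⟩
  rw [← map_smul, LinearEquiv.symm_apply_eq, h, ← Pi.single_smul]
  simp

lemma monCoord_rep_vertexPt (a : exps) :
    ∃ c : ℂ, c ≠ 0 ∧ monCoord b (vertexPt b a).rep = Pi.single a c := by
  obtain ⟨c, hc⟩ := Projectivization.exists_smul_eq_mk_rep ℂ
    ((monCoord b).symm (Pi.single a 1)) (by simp)
  refine ⟨c, c.ne_zero, ?_⟩
  rw [vertexPt, ← hc, Units.smul_def, map_smul, LinearEquiv.apply_symm_apply, ← Pi.single_smul]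
  simp

lemma vertexPt_injective : Function.Injective (vertexPt b) := by
  intro a a' h
  obtain ⟨c, hc, h1⟩ := monCoord_rep_vertexPt b a
  obtain ⟨c', hc', h2⟩ := monCoord_rep_vertexPt b a'
  rw [h, h2] at h1
  by_contra hne
  have := congrFun h1 a
  rw [Pi.single_eq_same, Pi.single_eq_of_ne hne] at this
  exact hc this.symm

lemma expA_injective : Function.Injective expA := by decide

lemma expB_injective : Function.Injective expB := by decide

lemma expA_ne_expB (i j : Fin 4) : expA i ≠ expB j := by revert i j; decide

lemma sumElim_injective : Function.Injective
    (Sum.elim (fun i => vertexPt b (expA i)) fun j => vertexPt b (expB j)) :=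
  ((vertexPt_injective b).comp expA_injective).sumElim ((vertexPt_injective b).comp expB_injective)
    fun i j h => expA_ne_expB i j (vertexPt_injective b h)

/-- The points of the line joining `vertexPt b (expA i)` and `vertexPt b (expB j)`. -/
lemma mem_line_iff {a a' : exps} {w : Fin 14 → ℂ} (hw : w ≠ 0) :
    Projectivization.mk ℂ w hw ∈ line (vertexPt b a) (vertexPt b a') ↔
      ∃ x y : ℂ, monCoord b w = Pi.single a x + Pi.single a' y := by
  rw [line, Set.mem_ofPred_eq, vertexPt_submodule, vertexPt_submodule,
    Projectivization.submodule_mk, Submodule.span_singleton_le_iff_mem]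
  simp only [Submodule.mem_sup, Submodule.mem_span_singleton, exists_exists_eq_and]
  refine exists_congr fun x => exists_congr fun y => ?_
  rw [← map_smul, ← map_smul, ← map_add, LinearEquiv.symm_apply_eq, ← Pi.single_smul,
    ← Pi.single_smul, eq_comm]
  simp

lemma line_comm (p q : P13) : line p q = line q p := by
  rw [line, line, sup_comm]

lemma line_subset {i j : Fin 4} (hij : i ≠ j) :
    line (vertexPt b (expA i)) (vertexPt b (expB j)) ⊆ threefold b := by
  intro p hp
  rw [← p.mk_rep] at hp ⊢
  obtain ⟨x, y, h⟩ := (mem_line_iff b p.rep_nonzero).mp hp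
  obtain ⟨σ, rfl, rfl⟩ := exists_perm_of_ne hij
  obtain ⟨ξ, rfl⟩ := IsAlgClosed.exists_pow_nat_eq x two_pos
  obtain ⟨η, rfl⟩ := IsAlgClosed.exists_pow_nat_eq y two_pos
  -- the points with parameters in a line times two points
  refine mk_segre_mem b σ ![ξ, η, 1, 0, 1, 0] p.rep_nonzero fun a => ?_
  obtain ⟨a, rfl⟩ := (permExp σ).surjective a
  rw [h, ← permExp_expA, ← permExp_expB]
  simp only [Pi.add_apply, Pi.single_apply, (permExp σ).injective.eq_iff, segre, permExp_apply,
    Matrix.cons_val, one_pow, one_mul]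
  have key : ∀ a : exps, a = expA 0 ∨ a = expB 1 ∨ (a ≠ expA 0 ∧ a ≠ expB 1 ∧
    ((a : Fin 4 → ℕ) 1 + (a : Fin 4 → ℕ) 3 - 2 ≠ 0 ∨
      (a : Fin 4 → ℕ) 1 + (a : Fin 4 → ℕ) 2 - 2 ≠ 0)) := by decide
  rcases key a with rfl | rfl | ⟨h1, h2, h3 | h3⟩
  · have : expA 0 ≠ expB 1 := by decide
    rw [if_pos rfl, if_neg this]
    simp [expA]
  · have : expB 1 ≠ expA 0 := by decide
    rw [if_pos rfl, if_neg this]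
    simp [expB]
  · simp [h1, h2, h3]
  · simp [h1, h2, h3]

lemma left_mem_line (p q : P13) : p ∈ line p q := le_sup_left (a := p.submodule)

lemma right_mem_line (p q : P13) : q ∈ line p q := le_sup_right (a := p.submodule)

lemma exists_ne_fin (i : Fin 4) : ∃ j, i ≠ j := by revert i; decide

lemma vertexPt_expA_mem (i : Fin 4) : vertexPt b (expA i) ∈ threefold b := by
  obtain ⟨j, hj⟩ := exists_ne_fin i
  exact line_subset b hj (left_mem_line _ _)

lemma vertexPt_expB_mem (j : Fin 4) : vertexPt b (expB j) ∈ threefold b := by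
  obtain ⟨i, hi⟩ := exists_ne_fin j
  exact line_subset b hi.symm (right_mem_line _ _)

/-- As the cone is four-dimensional, the threefold is singular exactly in the eight points. -/
lemma singularPoints_eq
    (hdim : ringKrullDim (MvPolynomial (Fin 14) ℂ ⧸
      MvPolynomial.vanishingIdeal ℂ (affineCone (threefold b))) = 4) :
    singularPoints (threefold b) =
      (Set.range fun i => vertexPt b (expA i)) ∪ Set.range fun j => vertexPt b (expB j) := by
  have key : ∀ p, p ∈ singularPoints (threefold b) ↔ p ∈ threefold b ∧
      4 < Module.finrank ℂ (coneTangentSpace (threefold b) p.rep) := fun p => by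
    rw [singularPoints, Set.mem_ofPred_eq, hdim]
    exact and_congr_right fun _ => by exact_mod_cast Iff.rfl
  ext p
  rw [key]
  constructor
  · rintro ⟨hp, hfin⟩
    have hcone : p.rep ∈ affineCone (threefold b) := fun h => by rwa [p.mk_rep]
    have hrel : Related (monCoord b p.rep) := fun _ _ _ _ h => relation_of_mem_cone b hcone h
    rcases hrel.trichotomy (by simpa using p.rep_nonzero) with
      ⟨i, c, h⟩ | ⟨j, c, h⟩ | ⟨i, j, hij, hA, hB⟩
    · refine Or.inl ⟨i, ?_⟩
      rw [← p.mk_rep, mk_eq_vertexPt b _ h]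
    · refine Or.inr ⟨j, ?_⟩
      rw [← p.mk_rep, mk_eq_vertexPt b _ h]
    · exact absurd (finrank_coneTangentSpace_le b hij hA hB) (by omega)
  · rintro (⟨i, rfl⟩ | ⟨j, rfl⟩)
    · obtain ⟨c, hc, h⟩ := monCoord_rep_vertexPt b (expA i)
      exact ⟨vertexPt_expA_mem b i, five_le_finrank_expA b hc i h⟩
    · obtain ⟨c, hc, h⟩ := monCoord_rep_vertexPt b (expB j)
      exact ⟨vertexPt_expB_mem b j, five_le_finrank_expB b hc j h⟩

/-- Every one of the eight points lies on three of the twelve lines. -/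
lemma three_le_encard_associated
    (h : singularPoints (threefold b) =
      (Set.range fun i => vertexPt b (expA i)) ∪ Set.range fun j => vertexPt b (expB j))
    {p : P13} (hp : p ∈ singularPoints (threefold b)) :
    3 ≤ {q | AreAssociated (threefold b) p q}.encard := by
  have hthree : ∀ i : Fin 4, ({k | k ≠ i} : Set (Fin 4)).encard = 3 := fun i => by
    have : ({k | k ≠ i} : Set (Fin 4)) =
        ((Finset.univ.erase i : Finset (Fin 4)) : Set (Fin 4)) := by
      ext; simp
    rw [this, Set.encard_coe_eq_coe_finsetCard, Finset.card_erase_of_mem (Finset.mem_univ _)]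
    rfl
  have hpq : ∀ i j, i ≠ j →
      AreAssociated (threefold b) (vertexPt b (expA i)) (vertexPt b (expB j)) := fun i j hij =>
    ⟨h ▸ Or.inl ⟨i, rfl⟩, h ▸ Or.inr ⟨j, rfl⟩,
      fun e => expA_ne_expB i j (vertexPt_injective b e), line_subset b hij⟩
  have hp' := hp
  rw [h] at hp'
  rcases hp' with ⟨i, rfl⟩ | ⟨j, rfl⟩
  · rw [← hthree i, ← ((vertexPt_injective b).comp expB_injective).encard_image]
    refine Set.encard_le_encard ?_
    rintro _ ⟨k, hk, rfl⟩
    exact hpq i k (Ne.symm hk)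
  · rw [← hthree j, ← ((vertexPt_injective b).comp expA_injective).encard_image]
    refine Set.encard_le_encard ?_
    rintro _ ⟨k, hk, rfl⟩
    obtain ⟨h1, h2, h3, h4⟩ := hpq k j hk
    exact ⟨h2, h1, h3.symm, by rwa [line_comm] at h4⟩

end

/-! ### The dimension of the cone -/

lemma ringKrullDim_eq_of_isIntegral {R S : Type*} [CommRing R] [CommRing S] [Algebra R S]
    [Algebra.IsIntegral R S] (h : Function.Injective (algebraMap R S)) :
    ringKrullDim R = ringKrullDim S := by
  apply le_antisymm
  · refine iSup_le fun l => ?_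
    obtain ⟨P, -, hP, hP'⟩ := Ideal.exists_ideal_over_prime_of_isIntegral (S := S)
      l.head.asIdeal ⊥ (by
      rw [← RingHom.ker_eq_comap_bot, (RingHom.injective_iff_ker_eq_bot _).mp h]
      exact bot_le)
    have : P.LiesOver l.head.asIdeal := ⟨hP'.symm⟩
    obtain ⟨l', hl', -⟩ := Ideal.exists_ltSeries_of_hasGoingUp l P
    rw [← hl']
    exact le_iSup (fun l : LTSeries (PrimeSpectrum S) => (l.length : WithBot ℕ∞)) l'
  · exact Order.krullDim_le_of_strictMono (PrimeSpectrum.comap (algebraMap R S))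
      fun p q hpq => Ideal.IsIntegral.comap_lt_comap (I := p.asIdeal) hpq

/-- The Krull dimension of a finitely generated domain is its transcendence degree. -/
lemma ringKrullDim_eq_of_trdeg {A : Type} [CommRing A] [IsDomain A] [Algebra ℂ A]
    [Algebra.FiniteType ℂ A] {n : ℕ} (h : Algebra.trdeg ℂ A = n) : ringKrullDim A = n := by
  obtain ⟨s, g, hg, hint⟩ := exists_integral_inj_algHom_of_fg ℂ A
  algebraize [g.toRingHom]
  have : Algebra.IsIntegral (MvPolynomial (Fin s) ℂ) A := ⟨hint⟩
  have hinj : Function.Injective (algebraMap (MvPolynomial (Fin s) ℂ) A) := hg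
  have : FaithfulSMul (MvPolynomial (Fin s) ℂ) A :=
    (faithfulSMul_iff_algebraMap_injective _ _).mpr hg
  have hs := trdeg_add_eq ℂ (MvPolynomial (Fin s) ℂ) (A := A)
  rw [trdeg_eq_zero (R := MvPolynomial (Fin s) ℂ), add_zero, h,
    MvPolynomial.trdeg_of_isDomain] at hs
  have hs' : s = n := by simpa using hs
  rw [← ringKrullDim_eq_of_isIntegral hinj, MvPolynomial.ringKrullDim_of_isNoetherianRing, ← hs']
  simp

section

variable {T : Tetrahedron} (b : Module.Basis (Fin 14) ℂ (sextics T))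

/-- The twelfth powers of the equations of the faces are quotients of polynomials in the sextics. -/
lemma isAlgebraic_range_substHom : Algebra.IsAlgebraic (substHom b).range Poly := by
  have hmem : ∀ a : exps, T.mon a ∈ (substHom b).range := fun a => ⟨_, substHom_monForm b a⟩
  have hmon : ∀ a, T.mon a ≠ 0 := fun a => T.linearIndependent_mon.ne_zero a
  have hface : ∀ i, IsAlgebraic (substHom b).range (T.face i) := by
    intro i
    have halg : ∀ a : exps, IsAlgebraic (substHom b).range (T.mon a) := fun a =>
      isAlgebraic_algebraMap (A := Poly) (⟨T.mon a, hmem a⟩ : (substHom b).range)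
    have hrel : T.mon (expB 0) * T.mon (expB 1) * (T.mon (expB 2) * T.mon (expB 3)) *
        T.face i ^ 12 = T.mon (expA i) ^ 6 := by
      simp only [Tetrahedron.mon, expA, expB, Fin.prod_univ_four]
      fin_cases i <;> simp <;> ring
    have h12 : IsAlgebraic (substHom b).range (T.mon (expB 0) * T.mon (expB 1) *
        (T.mon (expB 2) * T.mon (expB 3)) * T.face i ^ 12) := by
      rw [hrel]
      exact (halg _).pow 6
    have hB : IsAlgebraic (substHom b).range (T.mon (expB 0) * T.mon (expB 1) *
        (T.mon (expB 2) * T.mon (expB 3))) :=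
      ((halg _).mul (halg _)).mul ((halg _).mul (halg _))
    have hB0 : T.mon (expB 0) * T.mon (expB 1) * (T.mon (expB 2) * T.mon (expB 3)) ≠ 0 :=
      mul_ne_zero (mul_ne_zero (hmon _) (hmon _)) (mul_ne_zero (hmon _) (hmon _))
    exact (IsAlgebraic.of_mul (mem_nonZeroDivisors_of_ne_zero hB0) hB h12).of_pow (by norm_num)
  refine ⟨fun F => ?_⟩
  obtain ⟨G, rfl⟩ := T.coordEquiv.surjective F
  rw [T.coordEquiv_apply]
  induction G using MvPolynomial.induction_on with
  | C c =>
    rw [MvPolynomial.aeval_C]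
    exact isAlgebraic_algebraMap (A := Poly) (algebraMap ℂ (substHom b).range c)
  | add p q hp hq =>
    rw [map_add]
    exact hp.add hq
  | mul_X p i hp =>
    rw [map_mul, MvPolynomial.aeval_X]
    exact hp.mul (hface i)

lemma trdeg_range_substHom : Algebra.trdeg ℂ (substHom b).range = (4 : ℕ) := by
  have := isAlgebraic_range_substHom b
  have h := trdeg_add_eq ℂ (substHom b).range (A := Poly)
  rw [trdeg_eq_zero (R := (substHom b).range), add_zero, MvPolynomial.trdeg_of_isDomain] at h
  simpa using h

lemma ringKrullDim_cone : ringKrullDim (MvPolynomial (Fin 14) ℂ ⧸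
    MvPolynomial.vanishingIdeal ℂ (affineCone (threefold b))) = 4 := by
  have e := ringKrullDim_eq_of_ringEquiv (RingHom.quotientKerEquivRange (substHom b).toRingHom)
  rw [vanishingIdeal_eq]
  refine e.trans ?_
  have : Algebra.FiniteType ℂ (substHom b).range :=
    Algebra.FiniteType.of_surjective (substHom b).rangeRestrict
      (substHom b).rangeRestrict_surjective
  exact ringKrullDim_eq_of_trdeg (A := (substHom b).range) (trdeg_range_substHom b)

end

/-! ### Values of the sextics at the points of `Y` -/

section

variable {R : LocalSubring L} {x y : L} {c d : ℂ}

lemma hasValue_zero_iff : HasValue R x 0 ↔ InMax R x := by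
  rw [HasValue, map_zero, sub_zero]
  exact ⟨And.right, fun h => ⟨h.mem, h⟩⟩

lemma HasValue.add (hx : HasValue R x c) (hy : HasValue R y d) : HasValue R (x + y) (c + d) := by
  refine ⟨add_mem hx.1 hy.1, ?_⟩
  rw [map_add, add_sub_add_comm]
  exact hx.2.add hy.2

lemma HasValue.mul (hc : algebraMap ℂ L c ∈ R.toSubring) (hx : HasValue R x c)
    (hy : HasValue R y d) : HasValue R (x * y) (c * d) := by
  refine ⟨mul_mem hx.1 hy.1, ?_⟩
  have e : x * y - algebraMap ℂ L (c * d) =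
      (x - algebraMap ℂ L c) * y + algebraMap ℂ L c * (y - algebraMap ℂ L d) := by
    rw [map_mul]; ring
  rw [e]
  exact (hx.2.mul_right hy.1).add (hy.2.mul_left hc)

lemma hasValue_algebraMap (hc : algebraMap ℂ L c ∈ R.toSubring) :
    HasValue R (algebraMap ℂ L c) c := by
  refine ⟨hc, ?_⟩
  rw [sub_self]
  exact InMax.zero R

lemma HasValue.sum {ι : Type*} (s : Finset ι) {f : ι → L} {v : ι → ℂ}
    (h : ∀ i, HasValue R (f i) (v i)) : HasValue R (∑ i ∈ s, f i) (∑ i ∈ s, v i) := by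
  classical
  induction s using Finset.induction_on with
  | empty => simpa [hasValue_zero_iff] using InMax.zero R
  | insert i s hi ih => rw [Finset.sum_insert hi, Finset.sum_insert hi]; exact (h i).add ih

lemma InMax.pow (hx : InMax R x) {n : ℕ} (hn : n ≠ 0) : InMax R (x ^ n) := by
  obtain ⟨m, rfl⟩ := Nat.exists_eq_succ_of_ne_zero hn
  rw [pow_succ]
  exact hx.mul_left (pow_mem hx.mem m)

end

section

variable {T : Tetrahedron} (b : Module.Basis (Fin 14) ℂ (sextics T)) {R : LocalSubring L}
  {σ : Equiv.Perm (Fin 4)} {i j : Fin 4}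

/-- The image of a point is determined by the values of the monomials. -/
lemma mapsPoint_of_hasValue (hR : ∀ c, algebraMap ℂ L c ∈ R.toSubring) {p : P13} {g : L}
    {z : exps → ℂ} (h : ∀ a : exps, HasValue R (algebraMap Poly L (T.mon a) * g) (z a)) {t : ℂ}
    (hp : monCoord b p.rep = t • z) : MapsPoint b R p := by
  have hrep : p.rep = t • (monCoord b).symm z := by
    rw [← map_smul, LinearEquiv.eq_symm_apply, hp]
  have hw : (monCoord b).symm z ≠ 0 := fun h0 => p.rep_nonzero (by rw [hrep, h0, smul_zero])
  refine ⟨(monCoord b).symm z, hw, g, fun k => ?_, ?_⟩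
  · have e : (b k : Poly) = ∑ a : exps, T.monBasis.repr (b k) a • T.mon a := by
      have := congrArg Subtype.val (T.monBasis.sum_repr (b k))
      simpa only [Submodule.coe_sum, Submodule.coe_smul, Tetrahedron.coe_monBasis] using this.symm
    rw [monCoord_symm_apply, e, map_sum, Finset.sum_mul]
    refine HasValue.sum _ fun a => ?_
    rw [MvPolynomial.smul_eq_C_mul, map_mul, mul_assoc]
    exact (hasValue_algebraMap (hR _)).mul (hR _) (h a)
  · conv_lhs => rw [← p.mk_rep]
    rw [Projectivization.mk_eq_mk_iff']
    exact ⟨t, hrep.symm⟩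

lemma algebraMap_mon (T : Tetrahedron) (σ : Equiv.Perm (Fin 4)) (a : exps) :
    algebraMap Poly L (T.mon (permExp σ a)) = ∏ k, T.coord (σ k) ^ (a : Fin 4 → ℕ) k := by
  rw [Tetrahedron.mon, map_prod, ← Equiv.prod_comp σ]
  refine Finset.prod_congr rfl fun k _ => ?_
  rw [permExp_apply, map_pow]
  rfl

lemma algebraMap_mon_ne_zero (T : Tetrahedron) (a : exps) : algebraMap Poly L (T.mon a) ≠ 0 := by
  rw [ne_eq, map_eq_zero_iff _ (IsFractionRing.injective Poly L)]
  exact T.linearIndependent_mon.ne_zero (a : Fin 4 → ℕ)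

/-- In the charts at the strict transforms of the faces, the monomial `S² / s_{σ 1}²` divides all
others. -/
lemma mon_eq_faceChart (T : Tetrahedron) (σ : Equiv.Perm (Fin 4)) (a : exps) :
    algebraMap Poly L (T.mon (permExp σ a)) = T.faceChart σ 0 ^ (a : Fin 4 → ℕ) 1 *
      T.faceChart σ 1 ^ ((a : Fin 4 → ℕ) 1 + (a : Fin 4 → ℕ) 2 - 2) *
      T.faceChart σ 2 ^ ((a : Fin 4 → ℕ) 1 + 2 - (a : Fin 4 → ℕ) 0) *
      algebraMap Poly L (T.mon (expB (σ 1))) := by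
  rw [← permExp_expB, algebraMap_mon, algebraMap_mon, Fin.prod_univ_four, Fin.prod_univ_four]
  simp only [Tetrahedron.faceChart, Matrix.cons_val]
  have h0 := T.coord_ne_zero (σ 0)
  have h2 := T.coord_ne_zero (σ 2)
  have h3 := T.coord_ne_zero (σ 3)
  generalize T.coord (σ 0) = s₀ at *
  generalize T.coord (σ 1) = s₁ at *
  generalize T.coord (σ 2) = s₂ at *
  generalize T.coord (σ 3) = s₃ at *
  obtain ⟨a, ha⟩ := a
  simp only [exps, Finset.mem_insert, Finset.mem_singleton] at ha
  rcases ha with rfl | rfl | rfl | rfl | rfl | rfl | rfl | rfl | rfl | rfl | rfl | rfl | rfl |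
    rfl <;> simp [expB] <;> field_simp

/-- In the charts at the strict transforms of the exceptional divisors, the monomial `s_{σ 0}² S`
divides all others. -/
lemma mon_eq_excChart (T : Tetrahedron) (σ : Equiv.Perm (Fin 4)) (a : exps) :
    algebraMap Poly L (T.mon (permExp σ a)) =
      T.excChart σ 0 ^ ((a : Fin 4 → ℕ) 1 + 2 - (a : Fin 4 → ℕ) 0) *
      T.excChart σ 1 ^ ((a : Fin 4 → ℕ) 1 + (a : Fin 4 → ℕ) 2 - 2) *
      T.excChart σ 2 ^ (3 - (a : Fin 4 → ℕ) 0) * algebraMap Poly L (T.mon (expA (σ 0))) := by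
  rw [← permExp_expA, algebraMap_mon, algebraMap_mon, Fin.prod_univ_four, Fin.prod_univ_four]
  simp only [Tetrahedron.excChart, Matrix.cons_val]
  have h0 := T.coord_ne_zero (σ 0)
  have h1 := T.coord_ne_zero (σ 1)
  have h2 := T.coord_ne_zero (σ 2)
  have h3 := T.coord_ne_zero (σ 3)
  generalize T.coord (σ 0) = s₀ at *
  generalize T.coord (σ 1) = s₁ at *
  generalize T.coord (σ 2) = s₂ at *
  generalize T.coord (σ 3) = s₃ at *
  obtain ⟨a, ha⟩ := a
  simp only [exps, Finset.mem_insert, Finset.mem_singleton] at ha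
  rcases ha with rfl | rfl | rfl | rfl | rfl | rfl | rfl | rfl | rfl | rfl | rfl | rfl | rfl |
    rfl <;> simp [expA] <;> field_simp

/-- The exponents that occur in `mon_eq_faceChart` and `mon_eq_excChart`: with two exceptions, the
quotients of monomials considered there vanish along `Γ`, and along the strict transform of the face
respectively of the exceptional divisor. -/
lemma exps_eq_or_pos (a : exps) : a = expA 0 ∨ a = expB 1 ∨
    (a ≠ expA 0 ∧ a ≠ expB 1 ∧ (a : Fin 4 → ℕ) 1 ≠ 0 ∧ 3 - (a : Fin 4 → ℕ) 0 ≠ 0 ∧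
      (a : Fin 4 → ℕ) 1 + 2 - (a : Fin 4 → ℕ) 0 ≠ 0) := by
  revert a
  decide

lemma hasValue_faceChart (hR : chartRing (T.faceChart σ) ≤ R.toSubring) {c : ℂ}
    (h0 : HasValue R (T.faceChart σ 0) c) (h2 : c = 0 ∨ InMax R (T.faceChart σ 2)) (a : exps) :
    HasValue R (algebraMap Poly L (T.mon a) * (algebraMap Poly L (T.mon (expB (σ 1))))⁻¹)
      ((Pi.single (expA (σ 0)) c + Pi.single (expB (σ 1)) 1 : exps → ℂ) a) := by
  obtain ⟨a, rfl⟩ := (permExp σ).surjective a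
  rw [mon_eq_faceChart, mul_inv_cancel_right₀ (algebraMap_mon_ne_zero T _), ← permExp_expA,
    ← permExp_expB]
  simp only [Pi.add_apply, Pi.single_apply, (permExp σ).injective.eq_iff]
  have hmem := (chartRing_le.mp hR).2
  have hone : HasValue R 1 1 := by
    simpa using hasValue_algebraMap ((chartRing_le.mp hR).1 1)
  rcases exps_eq_or_pos a with rfl | rfl | ⟨hA, hB, h1, -, he⟩
  · have : expA 0 ≠ expB 1 := by decide
    rw [if_pos rfl, if_neg this]
    simpa [expA] using h0
  · have : expB 1 ≠ expA 0 := by decide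
    rw [if_pos rfl, if_neg this]
    simpa [expB] using hone
  · rw [if_neg hA, if_neg hB, add_zero, hasValue_zero_iff]
    rcases h2 with rfl | h2
    · rw [hasValue_zero_iff] at h0
      exact ((h0.pow h1).mul_right (pow_mem (hmem 1) _)).mul_right (pow_mem (hmem 2) _)
    · exact (h2.pow he).mul_left (mul_mem (pow_mem (hmem 0) _) (pow_mem (hmem 1) _))

lemma hasValue_excChart (hR : chartRing (T.excChart σ) ≤ R.toSubring) {c : ℂ}
    (h2 : HasValue R (T.excChart σ 2) c) (h0 : c = 0 ∨ InMax R (T.excChart σ 0)) (a : exps) :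
    HasValue R (algebraMap Poly L (T.mon a) * (algebraMap Poly L (T.mon (expA (σ 0))))⁻¹)
      ((Pi.single (expA (σ 0)) 1 + Pi.single (expB (σ 1)) c : exps → ℂ) a) := by
  obtain ⟨a, rfl⟩ := (permExp σ).surjective a
  rw [mon_eq_excChart, mul_inv_cancel_right₀ (algebraMap_mon_ne_zero T _), ← permExp_expA,
    ← permExp_expB]
  simp only [Pi.add_apply, Pi.single_apply, (permExp σ).injective.eq_iff]
  have hmem := (chartRing_le.mp hR).2
  have hone : HasValue R 1 1 := by
    simpa using hasValue_algebraMap ((chartRing_le.mp hR).1 1)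
  rcases exps_eq_or_pos a with rfl | rfl | ⟨hA, hB, -, hg, he⟩
  · have : expA 0 ≠ expB 1 := by decide
    rw [if_pos rfl, if_neg this]
    simpa [expA] using hone
  · have : expB 1 ≠ expA 0 := by decide
    rw [if_pos rfl, if_neg this]
    simpa [expB] using h2
  · rw [if_neg hA, if_neg hB, add_zero, hasValue_zero_iff]
    rcases h0 with rfl | h0
    · rw [hasValue_zero_iff] at h2
      exact (h2.pow hg).mul_left (mul_mem (pow_mem (hmem 0) _) (pow_mem (hmem 1) _))
    · exact ((h0.pow he).mul_right (pow_mem (hmem 1) _)).mul_right (pow_mem (hmem 2) _)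

lemma exists_perm_one (j : Fin 4) : ∃ σ : Equiv.Perm (Fin 4), σ 1 = j := ⟨Equiv.swap 1 j, by simp⟩

/-- `E_i` is contracted to the vertex of `s_i² S`. -/
lemma mapsOnto_excE (i : Fin 4) : MapsOnto b (excE T i) {vertexPt b (expA i)} := by
  obtain ⟨t, -, ht⟩ := monCoord_rep_vertexPt b (expA i)
  have key : ∀ σ R, IsLoc (chartRing (T.excChart σ)) R → R ∈ excE T i →
      MapsPoint b R (vertexPt b (expA i)) := by
    intro σ R hR hmem
    obtain ⟨rfl, hm⟩ := (mem_excE_iff hR).mp hmem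
    refine mapsPoint_of_hasValue b (chartRing_le.mp hR.1).1
      (hasValue_excChart hR.1 (hasValue_zero_iff.mpr hm) (Or.inl rfl)) (t := t) ?_
    rw [ht, Pi.single_zero, add_zero, ← Pi.single_smul, smul_eq_mul, mul_one]
  constructor
  · intro R hR _
    obtain ⟨σ, h | h⟩ := (mem_Y T).mp hR.1
    · exact absurd hR (notMem_excE_of_faceChart h.1)
    · exact ⟨_, rfl, key σ R h hR⟩
  · rintro _ rfl
    obtain ⟨σ, hσ⟩ := Tetrahedron.exists_perm i
    obtain ⟨R, hR⟩ := exists_isPoint (T.algebraicIndependent_excChart σ) 0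
    have hmem : R ∈ excE T i :=
      (mem_excE_iff hR.1).mpr ⟨hσ.symm, hasValue_zero_iff.mp (hR.hasValue 2)⟩
    exact ⟨R, hmem, hR.isClosedPt, key σ R hR.1 hmem⟩

/-- The strict transform of `f_j` is contracted to the vertex of `S² / s_j²`. -/
lemma mapsOnto_strictFace (j : Fin 4) : MapsOnto b (strictFace T j) {vertexPt b (expB j)} := by
  obtain ⟨t, -, ht⟩ := monCoord_rep_vertexPt b (expB j)
  have key : ∀ σ R, IsLoc (chartRing (T.faceChart σ)) R → R ∈ strictFace T j →
      MapsPoint b R (vertexPt b (expB j)) := by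
    intro σ R hR hmem
    obtain ⟨rfl, hm⟩ := (mem_strictFace_iff hR).mp hmem
    refine mapsPoint_of_hasValue b (chartRing_le.mp hR.1).1
      (hasValue_faceChart hR.1 (hasValue_zero_iff.mpr hm) (Or.inl rfl)) (t := t) ?_
    rw [ht, Pi.single_zero, zero_add, ← Pi.single_smul, smul_eq_mul, mul_one]
  constructor
  · intro R hR _
    obtain ⟨σ, h | h⟩ := (mem_Y T).mp hR.1
    · exact ⟨_, rfl, key σ R h hR⟩
    · exact absurd hR (notMem_strictFace_of_excChart h.1)
  · rintro _ rfl
    obtain ⟨σ, hσ⟩ := exists_perm_one j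
    obtain ⟨R, hR⟩ := exists_isPoint (T.algebraicIndependent_faceChart σ) 0
    have hmem : R ∈ strictFace T j :=
      (mem_strictFace_iff hR.1).mpr ⟨hσ.symm, hasValue_zero_iff.mp (hR.hasValue 0)⟩
    exact ⟨R, hmem, hR.isClosedPt, key σ R hR.1 hmem⟩

lemma exists_rep_eq_smul {z : exps → ℂ} (hz : z ≠ 0) : ∃ (p : P13) (t : ℂ), t ≠ 0 ∧
    monCoord b p.rep = t • z := by
  have hw : (monCoord b).symm z ≠ 0 := by simpa using hz
  obtain ⟨t, ht⟩ := Projectivization.exists_smul_eq_mk_rep ℂ _ hw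
  refine ⟨Projectivization.mk ℂ _ hw, t, t.ne_zero, ?_⟩
  rw [← ht, Units.smul_def, map_smul, LinearEquiv.apply_symm_apply]

lemma mem_line_iff_rep {a a' : exps} {p : P13} : p ∈ line (vertexPt b a) (vertexPt b a') ↔
    ∃ x y : ℂ, monCoord b p.rep = Pi.single a x + Pi.single a' y := by
  rw [← mem_line_iff b p.rep_nonzero, p.mk_rep]

/-- `Γ_ij` is mapped onto the line through the vertices of `s_i² S` and `S² / s_j²`: the ratio of
these two monomials is a coordinate along the fibres of `Γ_ij`. -/
lemma mapsOnto_excGamma (hij : i ≠ j) :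
    MapsOnto b (excGamma T i j) (line (vertexPt b (expA i)) (vertexPt b (expB j))) := by
  constructor
  · intro R hR hcl
    obtain ⟨σ, h | h⟩ := (mem_Y T).mp hR.1
    · obtain ⟨rfl, rfl, -, hm⟩ := (mem_excGamma_iff hR.1 (chart₂_le_of_faceChart h.1)).mp hR
      rw [chart₂_two_eq] at hm
      obtain ⟨c, hc⟩ := hcl _ (h.1 (gen_mem_chartRing _ 0))
      have hz : (Pi.single (expA (σ 0)) c + Pi.single (expB (σ 1)) 1 : exps → ℂ) ≠ 0 := fun h0 => by
        have := congrFun h0 (expB (σ 1))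
        simp [(expA_ne_expB (σ 0) (σ 1)).symm] at this
      obtain ⟨p, t, -, hp⟩ := exists_rep_eq_smul b hz
      refine ⟨p, (mem_line_iff_rep b).mpr ⟨t • c, t • 1, ?_⟩, mapsPoint_of_hasValue b
        (chartRing_le.mp h.1).1 (hasValue_faceChart h.1 hc (Or.inr hm)) hp⟩
      rw [hp, smul_add, Pi.single_smul, Pi.single_smul]
    · obtain ⟨rfl, rfl, hm, -⟩ := (mem_excGamma_iff hR.1 (chart₂_le_of_excChart h.1)).mp hR
      rw [chart₂_zero_eq] at hm
      obtain ⟨c, hc⟩ := hcl _ (h.1 (gen_mem_chartRing _ 2))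
      have hz : (Pi.single (expA (σ 0)) 1 + Pi.single (expB (σ 1)) c : exps → ℂ) ≠ 0 := fun h0 => by
        have := congrFun h0 (expA (σ 0))
        simp [expA_ne_expB (σ 0) (σ 1)] at this
      obtain ⟨p, t, -, hp⟩ := exists_rep_eq_smul b hz
      refine ⟨p, (mem_line_iff_rep b).mpr ⟨t • 1, t • c, ?_⟩, mapsPoint_of_hasValue b
        (chartRing_le.mp h.1).1 (hasValue_excChart h.1 hc (Or.inr hm)) hp⟩
      rw [hp, smul_add, Pi.single_smul, Pi.single_smul]
  · intro p hp
    obtain ⟨x, y, hxy⟩ := (mem_line_iff_rep b).mp hp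
    obtain ⟨σ, rfl, rfl⟩ := exists_perm_of_ne hij
    by_cases hy : y = 0
    · subst hy
      obtain ⟨R, hR⟩ := exists_isPoint (T.algebraicIndependent_excChart σ) 0
      have h0 := hasValue_zero_iff.mp (hR.hasValue 0)
      have hg := hR.hasValue 2
      have hmem : R ∈ excGamma T (σ 0) (σ 1) := by
        refine (mem_excGamma_iff ((mem_Y T).mpr ⟨σ, Or.inr hR.1⟩)
          (chart₂_le_of_excChart hR.1.1)).mpr ⟨rfl, rfl, ?_, ?_⟩
        · rw [chart₂_zero_eq]; exact h0
        · rw [chart₂_two]; exact h0.mul_right hg.1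
      refine ⟨R, hmem, hR.isClosedPt, mapsPoint_of_hasValue b (chartRing_le.mp hR.1.1).1
        (hasValue_excChart hR.1.1 hg (Or.inr h0)) (t := x) ?_⟩
      rw [hxy, smul_add, ← Pi.single_smul, ← Pi.single_smul]
      simp
    · obtain ⟨R, hR⟩ := exists_isPoint (T.algebraicIndependent_faceChart σ) ![x / y, 0, 0]
      have hf := hR.hasValue 0
      have h2 := hasValue_zero_iff.mp (hR.hasValue 2)
      have hmem : R ∈ excGamma T (σ 0) (σ 1) := by
        refine (mem_excGamma_iff ((mem_Y T).mpr ⟨σ, Or.inl hR.1⟩)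
          (chart₂_le_of_faceChart hR.1.1)).mpr ⟨rfl, rfl, ?_, ?_⟩
        · rw [chart₂_zero]; exact h2.mul_left hf.1
        · rw [chart₂_two_eq]; exact h2
      refine ⟨R, hmem, hR.isClosedPt, mapsPoint_of_hasValue b (chartRing_le.mp hR.1.1).1
        (hasValue_faceChart hR.1.1 hf (Or.inr h2)) (t := y) ?_⟩
      rw [hxy, smul_add, ← Pi.single_smul, ← Pi.single_smul]
      simp [mul_div_cancel₀ _ hy]

end

end EnriquesFano

end

theorem mainTheorem8 (T : EnriquesFano.Tetrahedron) :
    Module.finrank ℂ (EnriquesFano.sextics T) = 14 ∧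
    ∀ b : Module.Basis (Fin 14) ℂ (EnriquesFano.sextics T),
      (∀ p ∈ EnriquesFano.singularPoints (EnriquesFano.threefold b),
        3 ≤ {q | EnriquesFano.AreAssociated (EnriquesFano.threefold b) p q}.encard) ∧
      ∃ P P' : Fin 4 → EnriquesFano.P13,
        (∀ i, EnriquesFano.MapsOnto b (EnriquesFano.excE T i) {P i}) ∧
        (∀ j, EnriquesFano.MapsOnto b (EnriquesFano.strictFace T j) {P' j}) ∧
        Function.Injective (Sum.elim P P') ∧
        EnriquesFano.singularPoints (EnriquesFano.threefold b) = Set.range P ∪ Set.range P' ∧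
        ∀ i j, i ≠ j →
          EnriquesFano.MapsOnto b (EnriquesFano.excGamma T i j)
            (EnriquesFano.line (P i) (P' j)) ∧
          EnriquesFano.line (P i) (P' j) ⊆ EnriquesFano.threefold b := by
  refine ⟨T.finrank_sextics, fun b => ?_⟩
  have h := EnriquesFano.singularPoints_eq b (EnriquesFano.ringKrullDim_cone b)
  exact ⟨fun p hp => EnriquesFano.three_le_encard_associated b h hp, _, _,
    EnriquesFano.mapsOnto_excE b, EnriquesFano.mapsOnto_strictFace b,
    EnriquesFano.sumElim_injective b, h,
    fun i j hij => ⟨EnriquesFano.mapsOnto_excGamma b hij, EnriquesFano.line_subset b hij⟩⟩
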